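/- All objects are smooth, and a closed manifold is a compact (Hausdorff) manifold without boundary. A Kähler manifold $(M,g,J)$ of arbitrary signature is a manifold of real dimension $2n\ge 4$ with a pseudo-Riemannian metric $g$ and an endomorphism field $J$ of $TM$ such that $J^2=-\mathrm{Id}$, $g(JX,JY)=g(X,Y)$ and $\nabla J=0$, where $\nabla$ is the Levi-Civita connection of $g$. A regular curve $\gamma$ is called $J$-planar if $\nabla_{\dot\gamma}\dot\gamma=\alpha\dot\gamma+\beta J\dot\gamma$ for some real-valued functions $\alpha,\beta$ of the parameter. A vector field is called c-projective if its local flow maps $J$-planar curves to $J$-planar curves, and affine if its local flow preserves $\nabla$. An endomorphism field $A$ of $TM$ is called c-compatible with $(g,J)$ if it is $g$-selfadjoint, commutes with $J$, and satisfies for all vector fields $X$ $$\nabla_X A = X^\flat\otimes\Lambda+\Lambda^\flat\otimes X+(JX)^\flat\otimes J\Lambda+(J\Lambda)^\flat\otimes JX,\qquad \Lambda=\tfrac14\,\mathrm{grad}\,\mathrm{tr}A,\quad X^\flat=g(X,\cdot).$$ The c-compatible endomorphism fields form a real vector space $\mathcal A(g,J)$; its dimension $D(g,J)$ is the (c-projective)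 degree of mobility. **Proposition.** Let $(M,g,J)$ be a closed connected Kähler manifold of arbitrary signature and of real dimension $2n\ge4$, with $D(g,J)=2$, that admits a c-projective vector field which is not affine. Then for every $A\in\mathcal A(g,J)$, every non-constant eigenvalue of $A$ is real-valued. That is: if $S\subseteq M$ is connected, and $\rho:S\to\mathbb C$ is a continuous function such that $\rho(p)$ is an eigenvalue of the complexification of $A_p$ for every $p\in S$, and $\rho$ is not constant on $S$, then $\rho(p)\in\mathbb R$ for all $p\in S$. -/

import Mathlib

open Bundle Set
open scoped Manifold ContDiff Topology TensorProduct

set_option linter.unusedSectionVars false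

noncomputable section

namespace CProj

variable {E : Type*} [NormedAddCommGroup E] [NormedSpace ℝ E] [FiniteDimensional ℝ E]
  {M : Type*} [TopologicalSpace M] [ChartedSpace E M] [IsManifold 𝓘(ℝ, E) ∞ M]

/-! ### Smooth tensor fields on a manifold `M` modelled on `E` -/

instance instFiniteDimensionalTangentSpace (x : M) :
    FiniteDimensional ℝ (TangentSpace 𝓘(ℝ, E) x) :=
  inferInstanceAs (FiniteDimensional ℝ E)

instance instT2SpaceTangentSpace (x : M) : T2Space (TangentSpace 𝓘(ℝ, E) x) :=
  inferInstanceAs (T2Space E)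

variable (E M) in
/-- Smooth pseudo-Riemannian metrics of arbitrary signature. -/
structure PseudoRiemannianMetric where
  val (x : M) : TangentSpace 𝓘(ℝ, E) x →L[ℝ] TangentSpace 𝓘(ℝ, E) x →L[ℝ] ℝ
  symm (x : M) (u w : TangentSpace 𝓘(ℝ, E) x) : val x u w = val x w u
  nondegenerate (x : M) (u : TangentSpace 𝓘(ℝ, E) x) (hu : ∀ w, val x u w = 0) : u = 0
  contMDiff : ContMDiff 𝓘(ℝ, E) (𝓘(ℝ, E).prod 𝓘(ℝ, E →L[ℝ] E →L[ℝ] ℝ)) ∞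
    (fun x ↦ TotalSpace.mk' (E →L[ℝ] E →L[ℝ] ℝ) x (val x))

variable (E M) in
/-- Smooth sections of `End(TM)`. -/
abbrev EndField : Type _ :=
  Cₛ^∞⟮𝓘(ℝ, E); E →L[ℝ] E,
    fun x : M ↦ TangentSpace 𝓘(ℝ, E) x →L[ℝ] TangentSpace 𝓘(ℝ, E) x⟯

variable (E M) in
/-- Smooth vector fields. -/
abbrev SmoothVectorField : Type _ :=
  Cₛ^∞⟮𝓘(ℝ, E); E, fun x : M ↦ TangentSpace 𝓘(ℝ, E) x⟯

/-- A (not necessarily continuous) vector field `Y` is differentiable at the point `x`. -/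
def VFDiffAt (Y : (x : M) → TangentSpace 𝓘(ℝ, E) x) (x : M) : Prop :=
  MDifferentiableAt 𝓘(ℝ, E) (𝓘(ℝ, E).prod 𝓘(ℝ, E)) (fun y ↦ TotalSpace.mk' E y (Y y)) x

/-! ### The Levi-Civita connection -/

/-- The coordinate frame at `y` of the preferred chart around `x`, as a linear map `E → T_y M`
(an isomorphism for `y` in the domain of that chart; the identity for `y = x`). -/
def coordFrame (x y : M) : E →L[ℝ] TangentSpace 𝓘(ℝ, E) y :=
  (trivializationAt E (TangentSpace 𝓘(ℝ, E) : M → Type _) x).symmL ℝ y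

/-- The components `Y^i` of a vector field `Y` in the preferred chart around `x`. -/
def components (Y : (y : M) → TangentSpace 𝓘(ℝ, E) y) (x y : M) : E :=
  (trivializationAt E (TangentSpace 𝓘(ℝ, E) : M → Type _) x
    (TotalSpace.mk' E y (Y y))).2

/-- The componentwise derivative `u ↦ ∂_u Y^k` at `x`, in the preferred chart around `x`. -/
def coordDeriv (Y : (y : M) → TangentSpace 𝓘(ℝ, E) y) (x : M) :
    TangentSpace 𝓘(ℝ, E) x →L[ℝ] TangentSpace 𝓘(ℝ, E) x :=
  mvfderiv 𝓘(ℝ, E) (components Y x) x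

lemma components_self (Y : (y : M) → TangentSpace 𝓘(ℝ, E) y) (x : M) :
    components Y x x = Y x := by
  exact tangentCoordChange_self (I := 𝓘(ℝ, E)) (mem_extChartAt_source x)

lemma coordDeriv_add {Y Y' : (y : M) → TangentSpace 𝓘(ℝ, E) y} {x : M}
    (hY : VFDiffAt Y x) (hY' : VFDiffAt Y' x) :
    coordDeriv (Y + Y') x = coordDeriv Y x + coordDeriv Y' x := by
  have h : components (Y + Y') x =ᶠ[𝓝 x] components Y x + components Y' x := by
    have hb := (trivializationAt E (TangentSpace 𝓘(ℝ, E) : M → Type _) x).open_baseSet.mem_nhds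
      (FiberBundle.mem_baseSet_trivializationAt' x)
    filter_upwards [hb] with y hy
    exact ((trivializationAt E (TangentSpace 𝓘(ℝ, E) : M → Type _) x).linear ℝ hy).1 _ _
  have h1 := (mdifferentiableAt_section _ Y).1 hY
  have h2 := (mdifferentiableAt_section _ Y').1 hY'
  unfold coordDeriv
  rw [mvfderiv, h.mfderiv_eq]
  exact mvfderiv_add h1 h2

lemma coordDeriv_smul {Y : (y : M) → TangentSpace 𝓘(ℝ, E) y} {f : M → ℝ} {x : M}
    (hY : VFDiffAt Y x) (hf : MDifferentiableAt 𝓘(ℝ, E) 𝓘(ℝ, ℝ) f x) :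
    coordDeriv (f • Y) x = f x • coordDeriv Y x
      + (mvfderiv 𝓘(ℝ, E) f x).smulRight (Y x) := by
  have h : components (f • Y) x =ᶠ[𝓝 x] f • components Y x := by
    have hb := (trivializationAt E (TangentSpace 𝓘(ℝ, E) : M → Type _) x).open_baseSet.mem_nhds
      (FiberBundle.mem_baseSet_trivializationAt' x)
    filter_upwards [hb] with y hy
    exact ((trivializationAt E (TangentSpace 𝓘(ℝ, E) : M → Type _) x).linear ℝ hy).2 _ _
  have h1 := (mdifferentiableAt_section _ Y).1 hY
  unfold coordDeriv
  rw [mvfderiv, h.mfderiv_eq]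
  refine (mvfderiv_smul hf h1).trans ?_
  have h2 := components_self Y x
  unfold components at h2 ⊢
  rw [h2]
  rfl

namespace PseudoRiemannianMetric

variable (g : PseudoRiemannianMetric E M)

/-- The musical isomorphism `u ↦ g(u, ·)`. -/
def flat (x : M) :
    TangentSpace 𝓘(ℝ, E) x ≃ₗ[ℝ] Module.Dual ℝ (TangentSpace 𝓘(ℝ, E) x) :=
  LinearMap.linearEquivOfInjective
    (ContinuousLinearMap.coeLM ℝ ∘ₗ (g.val x).toLinearMap)
    (by
      rw [← LinearMap.ker_eq_bot, LinearMap.ker_eq_bot']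
      intro u hu
      exact g.nondegenerate x u fun w ↦ by simpa using congrArg (fun f ↦ f w) hu)
    Subspace.dual_finrank_eq.symm

@[simp] lemma flat_apply (x : M) (u w : TangentSpace 𝓘(ℝ, E) x) :
    g.flat x u w = g.val x u w := rfl

lemma val_flat_symm (x : M) (φ : Module.Dual ℝ (TangentSpace 𝓘(ℝ, E) x))
    (w : TangentSpace 𝓘(ℝ, E) x) : g.val x ((g.flat x).symm φ) w = φ w := by
  rw [← flat_apply, LinearEquiv.apply_symm_apply]

/-- The gradient of a function: `g(grad f, ·) = df`. -/
def grad (f : M → ℝ) (x : M) : TangentSpace 𝓘(ℝ, E) x :=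
  (g.flat x).symm (mvfderiv 𝓘(ℝ, E) f x).toLinearMap

/-- The components `g_{ij}(y)` of the metric in the preferred chart around `x`. -/
def inChart (x y : M) : E →L[ℝ] E →L[ℝ] ℝ :=
  ((coordFrame x y).precomp ℝ) ∘L (g.val y) ∘L (coordFrame x y)

lemma inChart_apply (x y : M) (a b : E) :
    g.inChart x y a b = g.val y (coordFrame x y a) (coordFrame x y b) := rfl

/-- `∂_u g_{ab}` at `x`, in the preferred chart around `x`. -/
def partialDeriv (x : M) : E →L[ℝ] E →L[ℝ] E →L[ℝ] ℝ :=
  mvfderiv 𝓘(ℝ, E) (g.inChart x) x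

set_option maxSynthPendingDepth 3 in
/-- The Christoffel symbols of the first kind at `x` in the preferred chart around `x`:
`Γ_{ua,z} = (∂_u g_{az} + ∂_a g_{uz} - ∂_z g_{ua}) / 2`. -/
def christoffelFirst (x : M) : E →ₗ[ℝ] E →ₗ[ℝ] E →ₗ[ℝ] ℝ :=
  let D : E →ₗ[ℝ] E →ₗ[ℝ] E →ₗ[ℝ] ℝ :=
    (g.partialDeriv x).toLinearMap₁₂.compr₂ (ContinuousLinearMap.coeLM ℝ)
  (1 / 2 : ℝ) • (D + D.flip - LinearMap.lflip.toLinearMap ∘ₗ D.flip)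

set_option maxSynthPendingDepth 3 in
lemma christoffelFirst_apply (x : M) (u a z : E) :
    g.christoffelFirst x u a z =
      1 / 2 * (g.partialDeriv x u a z + g.partialDeriv x a u z - g.partialDeriv x z u a) :=
  rfl

/-- The Christoffel symbols of the second kind `Γ^k_{ij}` at `x` in the preferred chart
around `x`. -/
def christoffel (x : M) :
    TangentSpace 𝓘(ℝ, E) x →ₗ[ℝ] TangentSpace 𝓘(ℝ, E) x →ₗ[ℝ] TangentSpace 𝓘(ℝ, E) x :=
  LinearMap.compr₂ (g.christoffelFirst x) (g.flat x).symm.toLinearMap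

lemma val_christoffel (x : M) (u a z : TangentSpace 𝓘(ℝ, E) x) :
    g.val x (g.christoffel x u a) z =
      1 / 2 * (g.partialDeriv x u a z + g.partialDeriv x a u z - g.partialDeriv x z u a) :=
  g.val_flat_symm x _ z

/-- The Levi-Civita connection of `g`, by the classical coordinate formula
`(∇_u Y)^k = ∂_u Y^k + Γ^k_{ij} u^i Y^j` at `x`, in the preferred chart around `x`.
The value `∇_u Y` at `x` is `g.leviCivita Y x u`. -/
def leviCivita : CovariantDerivative 𝓘(ℝ, E) E (TangentSpace 𝓘(ℝ, E) : M → Type _) where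
  toFun Y x := coordDeriv Y x + LinearMap.toContinuousLinearMap ((g.christoffel x).flip (Y x))
  isCovariantDerivativeOnUniv :=
    { add := by
        intro Y Y' x hY hY' _
        ext u
        have h := coordDeriv_add hY hY'
        simp [h]
        abel
      leibniz := by
        intro Y f x hY hf _
        ext u
        have h := coordDeriv_smul hY hf
        simp [h]
        abel }


end PseudoRiemannianMetric

/-! ### Kähler structures, c-compatible endomorphisms, degree of mobility -/

/-- `(g, J)` is a Kähler structure of arbitrary signature: `J` is an almost complex structure,
`g` is `J`-invariant, and `J` is parallel for the Levi-Civita connection of `g`, i.e.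
`∇_u (J Y) = J (∇_u Y)`. -/
structure IsKahler (g : PseudoRiemannianMetric E M) (J : EndField E M) : Prop where
  sq (x : M) (u : TangentSpace 𝓘(ℝ, E) x) : J x (J x u) = -u
  invariant (x : M) (u w : TangentSpace 𝓘(ℝ, E) x) : g.val x (J x u) (J x w) = g.val x u w
  parallel (x : M) (Y : (y : M) → TangentSpace 𝓘(ℝ, E) y) (hY : VFDiffAt Y x)
    (u : TangentSpace 𝓘(ℝ, E) x) :
    g.leviCivita (fun y ↦ J y (Y y)) x u = J x (g.leviCivita Y x u)

/-- `A` is hermitian: `g`-selfadjoint and commuting with `J`. -/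
structure IsHermitian (g : PseudoRiemannianMetric E M) (J A : EndField E M) : Prop where
  selfadjoint (x : M) (u w : TangentSpace 𝓘(ℝ, E) x) : g.val x (A x u) w = g.val x u (A x w)
  commutes (x : M) (u : TangentSpace 𝓘(ℝ, E) x) : A x (J x u) = J x (A x u)

/-- The function `tr A`. -/
def traceField (A : EndField E M) (x : M) : ℝ :=
  LinearMap.trace ℝ (TangentSpace 𝓘(ℝ, E) x) (A x).toLinearMap

/-- The vector field `Λ = (1/4) grad (tr A)`. -/
def lambdaField (g : PseudoRiemannianMetric E M) (A : EndField E M) (x : M) :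
    TangentSpace 𝓘(ℝ, E) x :=
  (1 / 4 : ℝ) • g.grad (traceField A) x

/-- The equation
`∇_u A = u♭ ⊗ Λ + Λ♭ ⊗ u + (Ju)♭ ⊗ JΛ + (JΛ)♭ ⊗ Ju`, where `u♭ = g(u, ·)`,
evaluated on vector fields `Y` (with `(∇_u A) Y = ∇_u (A Y) - A (∇_u Y)`). -/
def MainEquation (g : PseudoRiemannianMetric E M) (J A : EndField E M) : Prop :=
  ∀ (x : M) (Y : (y : M) → TangentSpace 𝓘(ℝ, E) y), VFDiffAt Y x →
    ∀ u : TangentSpace 𝓘(ℝ, E) x,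
      g.leviCivita (fun y ↦ A y (Y y)) x u - A x (g.leviCivita Y x u) =
        g.val x u (Y x) • lambdaField g A x + g.val x (lambdaField g A x) (Y x) • u
        + g.val x (J x u) (Y x) • J x (lambdaField g A x)
        + g.val x (J x (lambdaField g A x)) (Y x) • J x u

lemma traceField_mdifferentiableAt (A : EndField E M) (x : M) :
    MDifferentiableAt 𝓘(ℝ, E) 𝓘(ℝ, ℝ) (traceField A) x := by
  have h := ((contMDiffAt_hom_bundle _).1 (A.contMDiff x)).2.mdifferentiableAt (by simp)
  have hT : MDifferentiableAt 𝓘(ℝ, E →L[ℝ] E) 𝓘(ℝ, ℝ)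
      (fun B : E →L[ℝ] E ↦ LinearMap.trace ℝ E B.toLinearMap)
      (ContinuousLinearMap.inCoordinates E (TangentSpace 𝓘(ℝ, E) : M → Type _) E
        (TangentSpace 𝓘(ℝ, E) : M → Type _) x x x x (A x)) :=
    (LinearMap.toContinuousLinearMap
      (LinearMap.trace ℝ E ∘ₗ ContinuousLinearMap.coeLM ℝ)).mdifferentiableAt
  refine (hT.comp x h).congr_of_eventuallyEq ?_
  have hb := (trivializationAt E (TangentSpace 𝓘(ℝ, E) : M → Type _) x).open_baseSet.mem_nhds
    (FiberBundle.mem_baseSet_trivializationAt' x)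
  filter_upwards [hb] with y hy
  simp only [Function.comp]
  rw [ContinuousLinearMap.inCoordinates_eq hy hy]
  exact (LinearMap.trace_conj' (A y).toLinearMap
    ((trivializationAt E (TangentSpace 𝓘(ℝ, E) : M → Type _) x).continuousLinearEquivAt
      ℝ y hy).toLinearEquiv).symm

lemma lambdaField_add (g : PseudoRiemannianMetric E M) (A B : EndField E M) (x : M) :
    lambdaField g (A + B) x = lambdaField g A x + lambdaField g B x := by
  have h : traceField (A + B) = traceField A + traceField B := by
    ext y; simp [traceField]
  simp only [lambdaField, PseudoRiemannianMetric.grad, h]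
  rw [mvfderiv_add (traceField_mdifferentiableAt A x) (traceField_mdifferentiableAt B x)]
  simp

lemma lambdaField_smul (g : PseudoRiemannianMetric E M) (c : ℝ) (A : EndField E M) (x : M) :
    lambdaField g (c • A) x = c • lambdaField g A x := by
  have h : traceField (c • A) = (fun _ : M ↦ c) • traceField A := by
    ext y; simp [traceField]
  simp only [lambdaField, PseudoRiemannianMetric.grad, h]
  rw [mvfderiv_smul mdifferentiableAt_const (traceField_mdifferentiableAt A x)]
  have h0 : (mvfderiv 𝓘(ℝ, E) (fun _ : M ↦ c) x).smulRight (traceField A x) = 0 := by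
    rw [mvfderiv_const]; ext; simp
  rw [h0, add_zero]
  have h1 (L : TangentSpace 𝓘(ℝ, E) x →L[ℝ] ℝ) :
      (g.flat x).symm (c • L).toLinearMap = c • (g.flat x).symm L.toLinearMap := by
    rw [← map_smul]; rfl
  rw [h1, smul_comm]

lemma VFDiffAt.endField_apply {Y : (y : M) → TangentSpace 𝓘(ℝ, E) y} {x : M}
    (hY : VFDiffAt Y x) (A : EndField E M) : VFDiffAt (fun y ↦ A y (Y y)) x :=
  ((A.contMDiff x).mdifferentiableAt (by simp)).clm_bundle_apply hY

/-- The real vector space `𝒜(g, J)` of endomorphisms c-compatible with `(g, J)`: smooth hermitian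
solutions of the main equation. -/
def cCompatible (g : PseudoRiemannianMetric E M) (J : EndField E M) :
    Submodule ℝ (EndField E M) where
  carrier := {A | IsHermitian g J A ∧ MainEquation g J A}
  zero_mem' := by
    have h : lambdaField g (0 : EndField E M) = 0 := by
      ext x
      have h := lambdaField_smul g 0 (0 : EndField E M) x
      have e : (0 : ℝ) • (0 : EndField E M) = 0 := by ext; simp
      rw [e, zero_smul] at h
      simpa using h
    refine ⟨⟨fun x u w ↦ by simp, fun x u ↦ by simp⟩, fun x Y hY u ↦ ?_⟩
    have h0 : g.leviCivita (fun y ↦ (0 : EndField E M) y (Y y)) = 0 :=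
      g.leviCivita.zero
    rw [h0, h]
    simp
  add_mem' := by
    rintro A B ⟨hA, hA'⟩ ⟨hB, hB'⟩
    refine ⟨⟨fun x u w ↦ ?_, fun x u ↦ ?_⟩, fun x Y hY u ↦ ?_⟩
    · simp [hA.selfadjoint x u w, hB.selfadjoint x u w]
    · simp [hA.commutes x u, hB.commutes x u]
    · have h := g.leviCivita.isCovariantDerivativeOnUniv.add (hY.endField_apply A)
        (hY.endField_apply B)
      have hs : (fun y ↦ (A + B) y (Y y)) = (fun y ↦ A y (Y y)) + (fun y ↦ B y (Y y)) := by
        ext y; simp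
      have h' : g.leviCivita (fun y ↦ (A + B) y (Y y)) x u =
          g.leviCivita (fun y ↦ A y (Y y)) x u + g.leviCivita (fun y ↦ B y (Y y)) x u := by
        rw [hs]; exact congrArg (fun L ↦ L u) h
      have h₁ := hA' x Y hY u
      have h₂ := hB' x Y hY u
      rw [sub_eq_iff_eq_add] at h₁ h₂
      rw [h', h₁, h₂, lambdaField_add]
      simp only [map_add, ContMDiffSection.coe_add, Pi.add_apply, add_apply]
      module
  smul_mem' := by
    rintro c A ⟨hA, hA'⟩
    refine ⟨⟨fun x u w ↦ ?_, fun x u ↦ ?_⟩, fun x Y hY u ↦ ?_⟩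
    · simp [hA.selfadjoint x u w]
    · simp [hA.commutes x u]
    · have h := g.leviCivita.isCovariantDerivativeOnUniv.smul_const c (hY.endField_apply A)
      have hs : (fun y ↦ (c • A) y (Y y)) = c • (fun y ↦ A y (Y y)) := by
        ext y; simp
      have h' : g.leviCivita (fun y ↦ (c • A) y (Y y)) x u =
          c • g.leviCivita (fun y ↦ A y (Y y)) x u := by
        rw [hs]; exact congrArg (fun L ↦ L u) h
      have h₁ := hA' x Y hY u
      rw [sub_eq_iff_eq_add] at h₁
      rw [h', h₁, lambdaField_smul]
      simp only [map_smul, ContMDiffSection.coe_smul, Pi.smul_apply,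
        smul_apply, smul_eq_mul]
      module

/-- The degree of mobility `D(g, J)`. -/
def degreeOfMobility (g : PseudoRiemannianMetric E M) (J : EndField E M) : ℕ :=
  Module.finrank ℝ (cCompatible g J)

/-! ### `J`-planar curves, c-projective and affine vector fields -/

/-- The velocity `γ'(t)` of a curve. -/
def velocity (γ : ℝ → M) (t : ℝ) : TangentSpace 𝓘(ℝ, E) (γ t) :=
  mfderiv 𝓘(ℝ, ℝ) 𝓘(ℝ, E) γ t (1 : ℝ)

/-- The second derivatives `(γ^k)''` at time `t`, in the preferred chart around `γ t`. -/
def coordSecondDeriv (γ : ℝ → M) (t : ℝ) : E :=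
  iteratedDeriv 2 (fun s ↦ extChartAt 𝓘(ℝ, E) (γ t) (γ s)) t

/-- The acceleration `∇_{γ'} γ'` at time `t`, by the classical coordinate formula
`(γ^k)'' + Γ^k_{ij} (γ^i)' (γ^j)'` in the preferred chart around `γ t`. -/
def acceleration (g : PseudoRiemannianMetric E M) (γ : ℝ → M) (t : ℝ) :
    TangentSpace 𝓘(ℝ, E) (γ t) :=
  let c : TangentSpace 𝓘(ℝ, E) (γ t) := coordSecondDeriv (E := E) γ t
  c + g.christoffel (γ t) (velocity γ t) (velocity γ t)

/-- The restriction of `γ` to the open interval `I` is a (regular, smooth) `J`-planar curve. -/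
structure IsJPlanar (g : PseudoRiemannianMetric E M) (J : EndField E M) (γ : ℝ → M)
    (I : Set ℝ) : Prop where
  isOpen : IsOpen I
  ordConnected : I.OrdConnected
  smooth : ContMDiffOn 𝓘(ℝ, ℝ) 𝓘(ℝ, E) ∞ γ I
  regular : ∀ t ∈ I, (velocity γ t : TangentSpace 𝓘(ℝ, E) (γ t)) ≠ 0
  planar : ∃ α β : ℝ → ℝ, ∀ t ∈ I,
    acceleration g γ t = α t • velocity γ t + β t • J (γ t) (velocity γ t)

/-- `Φ` is a local flow of `v`, defined for times in `(-ε, ε)` on the open set `U`. -/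
structure IsLocalFlow (v : SmoothVectorField E M) (U : Set M) (ε : ℝ) (Φ : ℝ → M → M) :
    Prop where
  isOpen : IsOpen U
  pos : 0 < ε
  smooth : ContMDiffOn (𝓘(ℝ, ℝ).prod 𝓘(ℝ, E)) 𝓘(ℝ, E) ∞ (fun p : ℝ × M ↦ Φ p.1 p.2)
    (Ioo (-ε) ε ×ˢ U)
  zero : ∀ x ∈ U, Φ 0 x = x
  integralCurve : ∀ x ∈ U, IsMIntegralCurveOn (fun t ↦ Φ t x) (fun y ↦ v y) (Ioo (-ε) ε)

/-- `v` is c-projective: its local flow (around every point) sends `J`-planar curves to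
`J`-planar curves. -/
def IsCProjective (g : PseudoRiemannianMetric E M) (J : EndField E M)
    (v : SmoothVectorField E M) : Prop :=
  ∀ p : M, ∃ (U : Set M) (ε : ℝ) (Φ : ℝ → M → M), p ∈ U ∧ IsLocalFlow v U ε Φ ∧
    ∀ t ∈ Ioo (-ε) ε, ∀ (γ : ℝ → M) (I : Set ℝ), IsJPlanar g J γ I → MapsTo γ I U →
      IsJPlanar g J (fun s ↦ Φ t (γ s)) I

/-- A map `φ`, smooth and locally invertible on the open set `U`, preserves the Levi-Civita
connection of `g`: `dφ (∇_u Y) = ∇_{dφ u} W` whenever `W` is `φ`-related to `Y`. -/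
def PreservesConnectionOn (g : PseudoRiemannianMetric E M) (φ : M → M) (U : Set M) : Prop :=
  ∀ Y W : (y : M) → TangentSpace 𝓘(ℝ, E) y,
    (∀ x ∈ U, W (φ x) = mfderiv 𝓘(ℝ, E) 𝓘(ℝ, E) φ x (Y x)) →
    ∀ x ∈ U, VFDiffAt Y x → VFDiffAt W (φ x) → ∀ u : TangentSpace 𝓘(ℝ, E) x,
      mfderiv 𝓘(ℝ, E) 𝓘(ℝ, E) φ x (g.leviCivita Y x u) =
        g.leviCivita W (φ x) (mfderiv 𝓘(ℝ, E) 𝓘(ℝ, E) φ x u)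

/-- `v` is affine: its local flow (around every point) preserves the Levi-Civita connection. -/
def IsAffine (g : PseudoRiemannianMetric E M) (v : SmoothVectorField E M) : Prop :=
  ∀ p : M, ∃ (U : Set M) (ε : ℝ) (Φ : ℝ → M → M), p ∈ U ∧ IsLocalFlow v U ε Φ ∧
    ∀ t ∈ Ioo (-ε) ε, PreservesConnectionOn g (Φ t) U

/-! ### Eigenvalues -/

/-- The complex number `z` is an eigenvalue of the real endomorphism `A` of `T_p M`, i.e. an
eigenvalue of the complexification of `A` on `ℂ ⊗ T_p M`. -/
def IsEigenvalueAt (A : EndField E M) (p : M) (z : ℂ) : Prop :=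
  Module.End.HasEigenvalue ((A p).toLinearMap.baseChange ℂ) z

/-- `ρ` is a (continuous) eigenvalue of `A` over `S ⊆ M`. -/
structure IsEigenvalueOn (A : EndField E M) (S : Set M) (ρ : M → ℂ) : Prop where
  continuousOn : ContinuousOn ρ S
  isEigenvalueAt : ∀ p ∈ S, IsEigenvalueAt A p (ρ p)

end CProj

namespace CProj

set_option maxSynthPendingDepth 3

/-! ### Differential calculus on a normed space -/

section LocalCalculus

variable {V W : Type*} [NormedAddCommGroup V] [NormedSpace ℝ V]
  [NormedAddCommGroup W] [NormedSpace ℝ W]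

/-! The theorem splits into a differential-geometric half, which turns the hypotheses into a
quadratic equation, and a spectral half, which reads the conclusion off that equation.

Geometry. Differentiating the flow of the c-projective field `v` along `J`-planar curves shows that
`L_v J = 0` and that `L_v ∇` is the tensor `φ ⊙ Id - φ∘J ⊙ J` for a one-form `φ`
(`IsCProjective.infinitesimal`, `IsCProjective.lieEnd_eq_zero`,
`IsCProjective.exists_lieConn_form`). The endomorphism representing `L_v g`, corrected by a multiple
of its trace, is then an element `B` of `𝒜(g, J)`, and `φ` is dual to the field `Λ` of `B`
(`lieSolution_mem`, `lieConn_eq`). For any solution `A` the endomorphism `L_v A - A B` is again a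
solution (`variation_mem`). If `B` were a multiple of the identity, then `L_v ∇ = 0` and the flow
would preserve `∇`; as `v` is not affine and the degree of mobility is two, `Id` and `B` form a
basis of `𝒜(g, J)` (`exists_combination`). Expanding the variation of `B` itself in this basis gives
`L_v B = Q(B)` for a real monic quadratic polynomial `Q` with constant coefficients
(`exists_quadratic`).

Spectrum. Since `g` may be indefinite, `B` may have nonreal eigenvalues and Jordan blocks, so its
eigenvalues are not differentiated individually. Instead, let `z₀` be an eigenvalue of `B` at a
point where `Re (c z)` attains its maximum over all eigenvalues at all points. There is a real
polynomial `r` with `r'(z₀) ≠ 0` for which `tr r(B)` is critical at that point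
(`exists_critical_polynomial`). By the main equation this criticality says `r'(B) Λ = 0`. Then `tr
(θ(B) r'(B) Q(B)) = tr (θ(B) r'(B) ∇_v B) = 4 g(θ(B) r'(B) Λ, v) = 0` for every real polynomial `θ`,
so `r' Q` vanishes at `z₀`, and `Q(z₀) = 0` (`root_of_max`).

The set of pairs (point, eigenvalue) is compact, so extremal eigenvalues exist. If some eigenvalue
is not real, an eigenvalue of largest imaginary part is a nonreal root of `Q`, hence both roots of
`Q` have the same real part. Eigenvalues of largest and of smallest real part are roots as well, so
all eigenvalues have this real part; each of them is therefore extremal and a root of `Q`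
(`real_or_root`). Consequently either all eigenvalues of `B` are real, or they lie in a finite set
and continuous eigenvalues on connected sets are constant. Both alternatives pass to `A = α Id + β
B`. -/

lemma hasDerivAt_line {f : V → W} {e : V} (hf : DifferentiableAt ℝ f e) (w : V) :
    HasDerivAt (fun t : ℝ ↦ f (e + t • w)) (fderiv ℝ f e w) 0 := by
  have h : HasDerivAt (fun t : ℝ ↦ e + t • w) w 0 := by
    simpa using ((hasDerivAt_id (0 : ℝ)).smul_const w).const_add e
  have h0 : HasFDerivAt f (fderiv ℝ f e) (e + (0 : ℝ) • w) := by simpa using hf.hasFDerivAt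
  exact h0.comp_hasDerivAt (0 : ℝ) h

lemma eventually_line {p : V → Prop} {e : V} (h : ∀ᶠ y in 𝓝 e, p y) (w : V) :
    ∀ᶠ t : ℝ in 𝓝 0, p (e + t • w) := by
  have hc : ContinuousAt (fun t : ℝ ↦ e + t • w) 0 := by fun_prop
  have : Filter.Tendsto (fun t : ℝ ↦ e + t • w) (𝓝 0) (𝓝 e) := by simpa using hc.tendsto
  exact this.eventually h

/-- This is the device by which tensor identities valid near `e` are differentiated: the product
rule computes both sides along a line, and uniqueness of the derivative equates the results. -/
lemma deriv_line_unique {a b : V → W} {e w : V} {a' b' : W}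
    (ha : HasDerivAt (fun t : ℝ ↦ a (e + t • w)) a' 0)
    (hb : HasDerivAt (fun t : ℝ ↦ b (e + t • w)) b' 0) (h : ∀ᶠ y in 𝓝 e, a y = b y) : a' = b' :=
  ha.unique (hb.congr_of_eventuallyEq (eventually_line h w))

lemma contDiffAt_fderiv {f : V → W} {e : V} (hf : ContDiffAt ℝ ∞ f e) :
    ContDiffAt ℝ ∞ (fderiv ℝ f) e :=
  hf.fderiv_right (by simp)

lemma _root_.ContDiffAt.diffAt {f : V → W} {e : V} (hf : ContDiffAt ℝ ∞ f e) : DifferentiableAt ℝ f e :=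
  hf.differentiableAt (by simp)

lemma fderiv_fderiv_comm {f : V → W} {e : V} (hf : ContDiffAt ℝ ∞ f e) (u w : V) :
    fderiv ℝ (fderiv ℝ f) e u w = fderiv ℝ (fderiv ℝ f) e w u :=
  (hf.isSymmSndFDerivAt (by simpa using (by exact_mod_cast le_top : ((2 : ℕ∞) : WithTop ℕ∞) ≤ ∞))) u w

end LocalCalculus

/-! ### Lie and covariant derivatives in coordinates -/

section LocalTensors

variable {V : Type*} [NormedAddCommGroup V] [NormedSpace ℝ V]

/-- The right hand side of the main equation, at a point. -/
def mainRHS (g : V →L[ℝ] V →L[ℝ] ℝ) (J : V →L[ℝ] V) (l u y : V) : V :=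
  g u y • l + g l y • u + g (J u) y • J l + g (J l) y • J u

/-- The covariant derivative of an endomorphism field, in coordinates. -/
def covEnd (Γ : V → V →L[ℝ] V →L[ℝ] V) (A : V → V →L[ℝ] V) (e u : V) : V →L[ℝ] V :=
  fderiv ℝ A e u + (Γ e u ∘L A e - A e ∘L Γ e u)

/-- The Lie derivative of an endomorphism field, in coordinates. -/
def lieEnd (v : V → V) (A : V → V →L[ℝ] V) (e : V) : V →L[ℝ] V :=
  fderiv ℝ A e (v e) - (fderiv ℝ v e ∘L A e - A e ∘L fderiv ℝ v e)

/-- The Lie derivative of a vector field, in coordinates. -/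
def lieVec (v : V → V) (l : V → V) (e : V) : V := fderiv ℝ l e (v e) - fderiv ℝ v e (l e)

/-- The Lie derivative of a bilinear form, in coordinates. -/
def lieForm (v : V → V) (G : V → V →L[ℝ] V →L[ℝ] ℝ) (e a b : V) : ℝ :=
  fderiv ℝ G e (v e) a b + G e (fderiv ℝ v e a) b + G e a (fderiv ℝ v e b)

/-- The Lie derivative of a connection, in coordinates. -/
def lieConn (v : V → V) (Γ : V → V →L[ℝ] V →L[ℝ] V) (e x y : V) : V :=
  fderiv ℝ (fderiv ℝ v) e x y + fderiv ℝ Γ e (v e) x y + Γ e (fderiv ℝ v e x) y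
    + Γ e x (fderiv ℝ v e y) - fderiv ℝ v e (Γ e x y)

/-- `Γ` is a metric connection for `G` near `e`. -/
def IsMetricAt (Γ : V → V →L[ℝ] V →L[ℝ] V) (G : V → V →L[ℝ] V →L[ℝ] ℝ) (e : V) : Prop :=
  ∀ᶠ y in 𝓝 e, ∀ u a b, fderiv ℝ G y u a b = G y (Γ y u a) b + G y a (Γ y u b)

variable {Γ : V → V →L[ℝ] V →L[ℝ] V} {G : V → V →L[ℝ] V →L[ℝ] ℝ} {A J : V → V →L[ℝ] V}
  {v l : V → V} {e : V}

/-- Torsion-freeness holds on a neighbourhood and can be differentiated along `v`; the remaining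
non-tensorial term is a second derivative of `v`, which is symmetric. -/
lemma lieConn_symm (hv : ContDiffAt ℝ ∞ v e) (hΓ : ContDiffAt ℝ ∞ Γ e)
    (hs : ∀ᶠ y in 𝓝 e, ∀ a b, Γ y a b = Γ y b a) (x y : V) :
    lieConn v Γ e x y = lieConn v Γ e y x := by
  have h1 : fderiv ℝ Γ e (v e) x y = fderiv ℝ Γ e (v e) y x := by
    have d (a b : V) : HasDerivAt (fun t : ℝ ↦ Γ (e + t • v e) a b) (fderiv ℝ Γ e (v e) a b) 0 := by
      have := ((hasDerivAt_line hΓ.diffAt (v e)).clm_apply (hasDerivAt_const _ a)).clm_apply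
        (hasDerivAt_const _ b)
      simpa using this
    exact deriv_line_unique (a := fun z ↦ Γ z x y) (b := fun z ↦ Γ z y x) (d x y) (d y x)
      (hs.mono fun z hz ↦ hz x y)
  have hs0 := hs.self_of_nhds
  simp only [lieConn, h1, fderiv_fderiv_comm hv x y, hs0 (fderiv ℝ v e x) y,
    hs0 x (fderiv ℝ v e y), hs0 x y]
  abel

/-- Covariant derivative of the Lie derivative of the metric. -/
lemma cov_lieForm (hG : ContDiffAt ℝ ∞ G e) (hv : ContDiffAt ℝ ∞ v e) (hΓ : ContDiffAt ℝ ∞ Γ e)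
    (hm : IsMetricAt Γ G e) (x y z : V) :
    fderiv ℝ (fun e' ↦ lieForm v G e' y z) e x - lieForm v G e (Γ e x y) z
      - lieForm v G e y (Γ e x z) = G e (lieConn v Γ e x y) z + G e y (lieConn v Γ e x z) := by
  have hG1 := contDiffAt_fderiv hG
  have hv1 := contDiffAt_fderiv hv
  have h1 : HasDerivAt (fun t : ℝ ↦ lieForm v G (e + t • x) y z)
      (fderiv ℝ (fderiv ℝ G) e x (v e) y z + fderiv ℝ G e (fderiv ℝ v e x) y z
        + (fderiv ℝ G e x (fderiv ℝ v e y) z + G e (fderiv ℝ (fderiv ℝ v) e x y) z)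
        + (fderiv ℝ G e x y (fderiv ℝ v e z) + G e y (fderiv ℝ (fderiv ℝ v) e x z))) 0 := by
    have a1 := (((hasDerivAt_line hG1.diffAt x).clm_apply (hasDerivAt_line hv.diffAt x)).clm_apply
      (hasDerivAt_const _ y)).clm_apply (hasDerivAt_const _ z)
    have a2 := ((hasDerivAt_line hG.diffAt x).clm_apply ((hasDerivAt_line hv1.diffAt x).clm_apply
      (hasDerivAt_const _ y))).clm_apply (hasDerivAt_const _ z)
    have a3 := ((hasDerivAt_line hG.diffAt x).clm_apply (hasDerivAt_const _ y)).clm_apply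
      ((hasDerivAt_line hv1.diffAt x).clm_apply (hasDerivAt_const _ z))
    refine ((a1.add a2).add a3).congr_deriv ?_
    simp
  have hd : DifferentiableAt ℝ (fun e' ↦ lieForm v G e' y z) e := by
    unfold lieForm
    have := hG1.diffAt; have := hv.diffAt; have := hG.diffAt; have := hv1.diffAt
    fun_prop
  have h2 := (hasDerivAt_line hd x).unique h1
  -- Metric compatibility, differentiated in the direction `v e`. Once the two derivatives of `G`
  -- are interchanged, this removes all second derivatives of the metric.
  have h3 : fderiv ℝ (fderiv ℝ G) e (v e) x y z =
      fderiv ℝ G e (v e) (Γ e x y) z + G e (fderiv ℝ Γ e (v e) x y) z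
      + (fderiv ℝ G e (v e) y (Γ e x z) + G e y (fderiv ℝ Γ e (v e) x z)) := by
    have a1 := (((hasDerivAt_line hG1.diffAt (v e)).clm_apply (hasDerivAt_const _ x)).clm_apply
      (hasDerivAt_const _ y)).clm_apply (hasDerivAt_const _ z)
    have a2 := ((hasDerivAt_line hG.diffAt (v e)).clm_apply (((hasDerivAt_line hΓ.diffAt
      (v e)).clm_apply (hasDerivAt_const _ x)).clm_apply (hasDerivAt_const _ y))).clm_apply
      (hasDerivAt_const _ z)
    have a3 := ((hasDerivAt_line hG.diffAt (v e)).clm_apply (hasDerivAt_const _ y)).clm_apply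
      (((hasDerivAt_line hΓ.diffAt (v e)).clm_apply (hasDerivAt_const _ x)).clm_apply
      (hasDerivAt_const _ z))
    have := deriv_line_unique (a := fun e' ↦ fderiv ℝ G e' x y z)
      (b := fun e' ↦ G e' (Γ e' x y) z + G e' y (Γ e' x z)) a1 (a2.add a3)
      (hm.mono fun e' h ↦ h x y z)
    simpa using this
  have hm0 := hm.self_of_nhds
  rw [h2, fderiv_fderiv_comm hG x (v e), h3]
  simp only [lieForm, lieConn, hm0, map_add, map_sub, add_apply, sub_apply]
  ring

/-- The Lie derivative along `v` of a section of `T^* ⊗ End T`, in coordinates, on constant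
arguments. -/
lemma cov_lieEnd (hA : ContDiffAt ℝ ∞ A e) (hv : ContDiffAt ℝ ∞ v e) (hΓ : ContDiffAt ℝ ∞ Γ e)
    {T : V → V → V → V} (hT : ∀ᶠ e' in 𝓝 e, ∀ u y, covEnd Γ A e' u y = T e' u y) {u y T' : V}
    (hT' : HasDerivAt (fun t : ℝ ↦ T (e + t • v e) u y) T' 0) :
    covEnd Γ (lieEnd v A) e u y = T' + T e (fderiv ℝ v e u) y - fderiv ℝ v e (T e u y)
      + T e u (fderiv ℝ v e y) - (lieConn v Γ e u (A e y) - A e (lieConn v Γ e u y)) := by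
  have hA1 := contDiffAt_fderiv hA
  have hv1 := contDiffAt_fderiv hv
  have h1 : HasDerivAt (fun t : ℝ ↦ lieEnd v A (e + t • u) y)
      (fderiv ℝ (fderiv ℝ A) e u (v e) y + fderiv ℝ A e (fderiv ℝ v e u) y
        - ((fderiv ℝ (fderiv ℝ v) e u (A e y) + fderiv ℝ v e (fderiv ℝ A e u y))
        - (fderiv ℝ A e u (fderiv ℝ v e y) + A e (fderiv ℝ (fderiv ℝ v) e u y)))) 0 := by
    have a1 := ((hasDerivAt_line hA1.diffAt u).clm_apply (hasDerivAt_line hv.diffAt u)).clm_apply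
      (hasDerivAt_const _ y)
    have a2 := (hasDerivAt_line hv1.diffAt u).clm_apply ((hasDerivAt_line hA.diffAt u).clm_apply
      (hasDerivAt_const _ y))
    have a3 := (hasDerivAt_line hA.diffAt u).clm_apply ((hasDerivAt_line hv1.diffAt u).clm_apply
      (hasDerivAt_const _ y))
    refine (a1.sub (a2.sub a3)).congr_deriv ?_
    simp
  have hd : DifferentiableAt ℝ (lieEnd v A) e := by
    unfold lieEnd
    have := hA1.diffAt; have := hv.diffAt; have := hA.diffAt; have := hv1.diffAt
    fun_prop
  have a1 := (hasDerivAt_line hd u).clm_apply (hasDerivAt_const _ y)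
  simp only [map_zero, add_zero] at a1
  have h2 := a1.unique h1
  -- The formula for `∇A` holds near `e`; differentiating it along `v` expresses the mixed second
  -- derivative of `A` through `T'`.
  have h3 : T' = fderiv ℝ (fderiv ℝ A) e (v e) u y
      + ((fderiv ℝ Γ e (v e) u (A e y) + Γ e u (fderiv ℝ A e (v e) y))
      - (fderiv ℝ A e (v e) (Γ e u y) + A e (fderiv ℝ Γ e (v e) u y))) := by
    have a1 := ((hasDerivAt_line hA1.diffAt (v e)).clm_apply (hasDerivAt_const _ u)).clm_apply
      (hasDerivAt_const _ y)
    have a2 := ((hasDerivAt_line hΓ.diffAt (v e)).clm_apply (hasDerivAt_const _ u)).clm_apply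
      ((hasDerivAt_line hA.diffAt (v e)).clm_apply (hasDerivAt_const _ y))
    have a3 := (hasDerivAt_line hA.diffAt (v e)).clm_apply (((hasDerivAt_line hΓ.diffAt
      (v e)).clm_apply (hasDerivAt_const _ u)).clm_apply (hasDerivAt_const _ y))
    have := deriv_line_unique (a := fun e' ↦ T e' u y)
      (b := fun e' ↦ fderiv ℝ A e' u y + (Γ e' u (A e' y) - A e' (Γ e' u y))) hT'
      (a1.add (a2.sub a3)) (hT.mono fun e' h ↦ by rw [← h u y]; rfl)
    simpa using this
  have hT0 (a b : V) : T e a b = fderiv ℝ A e a b + (Γ e a (A e b) - A e (Γ e a b)) :=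
    (hT.self_of_nhds a b).symm
  have h4 : covEnd Γ (lieEnd v A) e u y = fderiv ℝ (lieEnd v A) e u y
      + (Γ e u (lieEnd v A e y) - lieEnd v A e (Γ e u y)) := rfl
  have h5 (a : V) : lieEnd v A e a = fderiv ℝ A e (v e) a - (fderiv ℝ v e (A e a)
      - A e (fderiv ℝ v e a)) := rfl
  rw [h4, h2, h3, h5, h5, fderiv_fderiv_comm hA u (v e)]
  simp only [hT0, lieConn, map_add, map_sub]
  abel

lemma hasDerivAt_mainRHS (hG : ContDiffAt ℝ ∞ G e) (hJ : ContDiffAt ℝ ∞ J e)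
    (hl : ContDiffAt ℝ ∞ l e) (w u y : V) :
    HasDerivAt (fun t : ℝ ↦ mainRHS (G (e + t • w)) (J (e + t • w)) (l (e + t • w)) u y)
      (fderiv ℝ G e w u y • l e + G e u y • fderiv ℝ l e w
      + (fderiv ℝ G e w (l e) y + G e (fderiv ℝ l e w) y) • u
      + ((fderiv ℝ G e w (J e u) y + G e (fderiv ℝ J e w u) y) • J e (l e)
        + G e (J e u) y • (fderiv ℝ J e w (l e) + J e (fderiv ℝ l e w)))
      + ((fderiv ℝ G e w (J e (l e)) y + G e (fderiv ℝ J e w (l e) + J e (fderiv ℝ l e w)) y)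
          • J e u
        + G e (J e (l e)) y • fderiv ℝ J e w u)) 0 := by
  have dG := hasDerivAt_line hG.diffAt w
  have dl := hasDerivAt_line hl.diffAt w
  have dJ := hasDerivAt_line hJ.diffAt w
  have dJu := dJ.clm_apply (hasDerivAt_const _ u)
  have dJl := dJ.clm_apply dl
  have cu := hasDerivAt_const (0 : ℝ) u
  have cy := hasDerivAt_const (0 : ℝ) y
  have a1 := ((dG.clm_apply cu).clm_apply cy).smul dl
  have a2 := ((dG.clm_apply dl).clm_apply cy).smul cu
  have a3 := ((dG.clm_apply dJu).clm_apply cy).smul dJl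
  have a4 := ((dG.clm_apply dJl).clm_apply cy).smul dJu
  refine (((a1.add a2).add a3).add a4).congr_deriv ?_
  simp
  module

end LocalTensors

/-! ### Linear algebra of complex structures -/

section ComplexLinearAlgebra

/-- A symmetric bilinear map `P` such that `P x x` is a multiple of `x` for every `x` is
of the form `φ x • y + φ y • x`. -/
lemma exists_form_of_diagonal {K V : Type*} [Field K] [NeZero (2 : K)] [AddCommGroup V] [Module K V]
    (P : V →ₗ[K] V →ₗ[K] V) (hs : ∀ x y, P x y = P y x) (h : ∀ x, ∃ c : K, P x x = c • x) :
    ∃ φ : V →ₗ[K] K, ∀ x y, P x y = φ x • y + φ y • x := by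
  classical
  -- The coefficient is not determined at `x = 0`; the value zero there makes `c` homogeneous
  -- without exception.
  have h' : ∀ x, ∃ c : K, P x x = c • x ∧ (x = 0 → c = 0) := by
    intro x
    by_cases hx : x = 0
    · exact ⟨0, by simp [hx], fun _ ↦ rfl⟩
    · obtain ⟨c, hc⟩ := h x
      exact ⟨c, hc, fun h0 ↦ (hx h0).elim⟩
  choose c hc hc0 using h'
  have h2 : (2 : K) ≠ 0 := NeZero.ne 2
  have hsmul : ∀ (z : K) x, c (z • x) = z * c x := by
    intro z x
    by_cases hx : z • x = 0
    · rw [hc0 _ hx]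
      rcases smul_eq_zero.1 hx with h | h
      · simp [h]
      · simp [hc0 _ h]
    · have e : (c (z • x)) • (z • x) = (z * c x) • (z • x) := by
        rw [← hc]
        simp only [map_smul, LinearMap.smul_apply, hc x, smul_smul]
        ring_nf
      exact smul_left_injective K hx e
  have hadd : ∀ x y, c (x + y) = c x + c y := by
    intro x y
    -- For independent vectors, adding the diagonal identities at `x + y` and `x - y` eliminates `P
    -- x y`. Comparing coefficients gives `c (x + y) + c (x - y) = 2 c x` and `c (x + y) - c (x - y)
    -- = 2 c y`. Dependent pairs reduce to homogeneity.
    by_cases hli : LinearIndependent K ![x, y]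
    · have e1 := hc (x + y)
      have e2 := hc (x - y)
      simp only [map_add, map_sub, LinearMap.add_apply, LinearMap.sub_apply, hc x, hc y,
        hs y x] at e1 e2
      rw [LinearIndependent.pair_iff] at hli
      have e3 : (c (x + y) + c (x - y) - 2 * c x) • x + (c (x + y) - c (x - y) - 2 * c y) • y = 0 := by
        have : c (x + y) • (x + y) + c (x - y) • (x - y) = (2 * c x) • x + (2 * c y) • y := by
          rw [← e1, ← e2]; module
        rw [← sub_eq_zero] at this
        rw [← this]; module
      obtain ⟨a, b⟩ := hli _ _ e3
      apply mul_left_cancel₀ h2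
      linear_combination a + b
    · rw [LinearIndependent.pair_iff] at hli
      push Not at hli
      obtain ⟨s, t, hst, hne⟩ := hli
      by_cases hs0 : s = 0
      · have ht := hne hs0
        have hy : y = 0 := by
          rw [hs0, zero_smul, zero_add] at hst
          exact (smul_eq_zero.1 hst).resolve_left ht
        simp [hy, hc0 0 rfl]
      · have hx : x = (-(s⁻¹ * t)) • y := by
          rw [neg_smul, mul_smul, eq_neg_iff_add_eq_zero]
          have := congrArg (fun w ↦ s⁻¹ • w) hst
          simpa [smul_add, smul_smul, hs0] using this
        have : x + y = (-(s⁻¹ * t) + 1) • y := by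
          conv_lhs => rw [hx]
          module
        rw [this, hsmul]
        conv_rhs => rw [hx, hsmul]
        ring
  refine ⟨((2 : K)⁻¹) • { toFun := c, map_add' := hadd, map_smul' := fun z x ↦ hsmul z x }, ?_⟩
  intro x y
  have e1 := hc (x + y)
  simp only [map_add, LinearMap.add_apply, hc x, hc y, hs y x, hadd] at e1
  have e2 : (2 : K) • P x y = c x • y + c y • x := by
    have : (2 : K) • P x y = (c x • x + P x y + (P x y + c y • y)) - c x • x - c y • y := by module
    rw [this, e1]; module
  have e3 : P x y = (2 : K)⁻¹ • ((2 : K) • P x y) := by rw [smul_smul, inv_mul_cancel₀ h2, one_smul]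
  rw [e3, e2]
  simp [smul_smul]

variable {V : Type*} [AddCommGroup V] [Module ℝ V]

/-- The complex vector space structure defined by a complex structure `J`. -/
abbrev complexModule (J : V →ₗ[ℝ] V) (hJ : ∀ x, J (J x) = -x) : Module ℂ V where
  smul z x := z.re • x + z.im • J x
  one_smul x := by change (1 : ℂ).re • x + (1 : ℂ).im • J x = x; simp
  mul_smul z w x := by
    change (z * w).re • x + (z * w).im • J x =
      z.re • (w.re • x + w.im • J x) + z.im • J (w.re • x + w.im • J x)
    simp only [Complex.mul_re, Complex.mul_im, map_add, map_smul, hJ]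
    module
  smul_zero z := by change z.re • (0 : V) + z.im • J 0 = 0; simp
  smul_add z x y := by
    change z.re • (x + y) + z.im • J (x + y) = z.re • x + z.im • J x + (z.re • y + z.im • J y)
    simp only [map_add]; module
  add_smul z w x := by
    change (z + w).re • x + (z + w).im • J x = z.re • x + z.im • J x + (w.re • x + w.im • J x)
    simp only [Complex.add_re, Complex.add_im]; module
  zero_smul x := by change (0 : ℂ).re • x + (0 : ℂ).im • J x = 0; simp

/-- With `J` as multiplication by `i`, `P` is complex bilinear and `P x x` is a complex multiple of
`x`, so `exists_form_of_diagonal` applies over `ℂ`. The form wanted here is the real part of the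
complex one, whose imaginary part at `x` is minus the real part at `J x`. -/
lemma exists_cprojective_form (J : V →ₗ[ℝ] V) (hJ : ∀ x, J (J x) = -x)
    (P : V →ₗ[ℝ] V →ₗ[ℝ] V) (hs : ∀ x y, P x y = P y x) (hPJ : ∀ x y, P x (J y) = J (P x y))
    (h : ∀ x, ∃ a b : ℝ, P x x = a • x + b • J x) :
    ∃ φ : V →ₗ[ℝ] ℝ, ∀ x y,
      P x y = φ x • y + φ y • x - φ (J x) • J y - φ (J y) • J x := by
  let _ := complexModule J hJ
  have hsm (z : ℂ) (x : V) : z • x = z.re • x + z.im • J x := rfl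
  have hPJ' (x y : V) : P (J x) y = J (P x y) := by rw [hs, hPJ, hs]
  obtain ⟨φ, hφ⟩ := exists_form_of_diagonal (K := ℂ)
    (LinearMap.mk₂ ℂ (fun x y ↦ P x y) (by simp) (fun z x y ↦ by simp [hsm, hPJ'])
      (by simp) (fun z x y ↦ by simp [hsm, hPJ]))
    (fun x y ↦ hs x y) (fun x ↦ by
      obtain ⟨a, b, hab⟩ := h x
      exact ⟨⟨a, b⟩, by simpa [hsm] using hab⟩)
  have hr (r : ℝ) (x : V) : r • x = (r : ℂ) • x := by simp [hsm]
  have hJs (x : V) : J x = Complex.I • x := by simp [hsm]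
  have him (x : V) : (φ x).im = -(φ (J x)).re := by
    rw [hJs, map_smul]; simp
  refine ⟨{ toFun := fun x ↦ (φ x).re, map_add' := by simp,
            map_smul' := fun r x ↦ by rw [hr, map_smul]; simp }, fun x y ↦ ?_⟩
  have := hφ x y
  simp only [LinearMap.mk₂_apply, hsm, him] at this
  simp only [this, LinearMap.coe_mk, AddHom.coe_mk]
  module

lemma independent_complex (J : V →ₗ[ℝ] V) (hJ : ∀ x, J (J x) = -x) {x y : V} (hx : x ≠ 0)
    (hy : y ∉ Submodule.span ℝ {x, J x}) {p q r s : ℝ}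
    (h : p • x + q • J x + (r • y + s • J y) = 0) : p = 0 ∧ q = 0 ∧ r = 0 ∧ s = 0 := by
  have h2 := congrArg J h
  simp only [map_add, map_smul, hJ, map_zero] at h2
  -- Multiplication of the relation by the conjugate of `r + i s`.
  have key : (r ^ 2 + s ^ 2) • y = -(r * p + s * q) • x + (s * p - r * q) • J x := by
    have e : (r ^ 2 + s ^ 2) • y - (-(r * p + s * q) • x + (s * p - r * q) • J x) =
      r • (p • x + q • J x + (r • y + s • J y)) -
        s • (p • J x + q • -x + (r • J y + s • -y)) := by module
    rw [h, h2] at e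
    simpa [sub_eq_zero] using e
  have hrs : r ^ 2 + s ^ 2 = 0 := by
    by_contra hne
    apply hy
    rw [Submodule.mem_span_pair]
    refine ⟨(r ^ 2 + s ^ 2)⁻¹ * -(r * p + s * q), (r ^ 2 + s ^ 2)⁻¹ * (s * p - r * q), ?_⟩
    rw [mul_smul, mul_smul, ← smul_add, ← key, smul_smul, inv_mul_cancel₀ hne, one_smul]
  have hr : r = 0 := by nlinarith [sq_nonneg r, sq_nonneg s]
  have hs : s = 0 := by nlinarith [sq_nonneg r, sq_nonneg s]
  subst hr hs
  simp only [zero_smul, add_zero] at h h2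
  have hpq : (p ^ 2 + q ^ 2) • x = 0 := by
    have e : (p ^ 2 + q ^ 2) • x = p • (p • x + q • J x) - q • (p • J x + q • -x) := by module
    rw [e, h, h2]; simp
  have hpq' := (smul_eq_zero.1 hpq).resolve_right hx
  exact ⟨by nlinarith [sq_nonneg p, sq_nonneg q], by nlinarith [sq_nonneg p, sq_nonneg q], rfl, rfl⟩

/-- If every vector is mapped into its own complex line, additivity forces the complex factor to
agree on complex independent vectors. Antilinearity makes the factors at `y` and `J y` opposite,
while both equal the factor at `x`; so it is zero. The dimension bound supplies `y` outside the
complex line of `x`. -/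
lemma eq_zero_of_antilinear [FiniteDimensional ℝ V] (J L : V →ₗ[ℝ] V) (hJ : ∀ x, J (J x) = -x)
    (hL : ∀ x, L (J x) = -J (L x)) (h : ∀ x, ∃ a b : ℝ, L x = a • x + b • J x)
    (hd : 2 < Module.finrank ℝ V) (x : V) : L x = 0 := by
  by_cases hx : x = 0
  · simp [hx]
  have hex : ∃ y, y ∉ Submodule.span ℝ {x, J x} := by
    by_contra hcon
    push Not at hcon
    have htop : Submodule.span ℝ {x, J x} = ⊤ := by
      ext y; simpa using hcon y
    have h1 : Module.finrank ℝ (Submodule.span ℝ ({x, J x} : Set V)) ≤ 2 := by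
      classical
      have := finrank_span_finset_le_card (R := ℝ) ({x, J x} : Finset V)
      have h2 := Finset.card_le_two (a := x) (b := J x)
      simp only [Finset.coe_insert, Finset.coe_singleton] at this
      exact this.trans h2
    rw [htop, finrank_top] at h1
    omega
  have key : ∀ y, y ∉ Submodule.span ℝ {x, J x} → ∀ a b c d : ℝ, L x = a • x + b • J x →
      L y = c • y + d • J y → a = c ∧ b = d := by
    intro y hy a b c d hab hcd
    obtain ⟨e, f, hef⟩ := h (x + y)
    rw [map_add, hab, hcd, map_add] at hef
    have : (a - e) • x + (b - f) • J x + ((c - e) • y + (d - f) • J y) = 0 := by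
      rw [← sub_eq_zero] at hef
      rw [← hef]; module
    obtain ⟨h1, h2, h3, h4⟩ := independent_complex J hJ hx hy this
    exact ⟨by linarith, by linarith⟩
  obtain ⟨y, hy⟩ := hex
  have hJy : J y ∉ Submodule.span ℝ {x, J x} := by
    intro hmem
    apply hy
    rw [Submodule.mem_span_pair] at hmem ⊢
    obtain ⟨a, b, hab⟩ := hmem
    have := congrArg J hab
    simp only [map_add, map_smul, hJ] at this
    exact ⟨b, -a, by rw [← neg_neg y, ← this]; module⟩
  obtain ⟨a, b, hab⟩ := h x
  obtain ⟨c, d, hcd⟩ := h y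
  have h1 := key y hy a b c d hab hcd
  have h2 := key (J y) hJy a b (-c) (-d) hab (by
    rw [hL, hcd]; simp only [map_add, map_smul, hJ]; module)
  have ha : a = 0 := by linarith [h1.1, h2.1]
  have hb : b = 0 := by linarith [h1.2, h2.2]
  rw [hab, ha, hb]; simp

end ComplexLinearAlgebra

/-! ### c-projective vector fields in coordinates -/

section LocalKahler

variable {V : Type*} [NormedAddCommGroup V] [NormedSpace ℝ V]

/-- A Kähler structure on an open subset of a vector space, with its Levi-Civita connection. -/
structure IsLocalKahler (Ω : Set V) (G : V → V →L[ℝ] V →L[ℝ] ℝ) (Γ : V → V →L[ℝ] V →L[ℝ] V)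
    (J : V → V →L[ℝ] V) : Prop where
  isOpen : IsOpen Ω
  smooth_metric : ∀ e ∈ Ω, ContDiffAt ℝ ∞ G e
  smooth_conn : ∀ e ∈ Ω, ContDiffAt ℝ ∞ Γ e
  smooth_J : ∀ e ∈ Ω, ContDiffAt ℝ ∞ J e
  symm : ∀ e ∈ Ω, ∀ a b, G e a b = G e b a
  nondegenerate : ∀ e ∈ Ω, ∀ a, (∀ b, G e a b = 0) → a = 0
  torsionFree : ∀ e ∈ Ω, ∀ a b, Γ e a b = Γ e b a
  metric : ∀ e ∈ Ω, ∀ u a b, fderiv ℝ G e u a b = G e (Γ e u a) b + G e a (Γ e u b)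
  sq : ∀ e ∈ Ω, ∀ a, J e (J e a) = -a
  invariant : ∀ e ∈ Ω, ∀ a b, G e (J e a) (J e b) = G e a b
  parallel : ∀ e ∈ Ω, ∀ u a, covEnd Γ J e u a = 0

variable {Γ : V → V →L[ℝ] V →L[ℝ] V} {G : V → V →L[ℝ] V →L[ℝ] ℝ} {A J : V → V →L[ℝ] V}
  {v l : V → V} {Ω : Set V} {e : V}

namespace IsLocalKahler

variable (h : IsLocalKahler Ω G Γ J)
include h

lemma nhds (he : e ∈ Ω) : ∀ᶠ y in 𝓝 e, y ∈ Ω := h.isOpen.mem_nhds he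

lemma skew (he : e ∈ Ω) (a b : V) : G e (J e a) b = -G e a (J e b) := by
  rw [← h.invariant e he a, h.sq e he]; simp

lemma ext_of_metric (he : e ∈ Ω) {a b : V} (hab : ∀ c, G e a c = G e b c) : a = b := by
  rw [← sub_eq_zero]
  exact h.nondegenerate e he _ fun c ↦ by simp [hab c]

/-- The derivation `L_v` applied to `J² = -1`. -/
lemma lieEnd_anticomm (he : e ∈ Ω) (x : V) :
    lieEnd v J e (J e x) = -J e (lieEnd v J e x) := by
  have hJ := h.smooth_J e he
  have d1 := (hasDerivAt_line hJ.diffAt (v e)).clm_apply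
    ((hasDerivAt_line hJ.diffAt (v e)).clm_apply (hasDerivAt_const _ x))
  have := deriv_line_unique (a := fun y ↦ J y (J y x)) (b := fun _ ↦ -x) d1
    (hasDerivAt_const _ (-x)) ((h.nhds he).mono fun y hy ↦ h.sq y hy x)
  simp only [map_zero, add_zero, zero_smul] at this
  have e1 : fderiv ℝ J e (v e) (J e x) = -J e (fderiv ℝ J e (v e) x) :=
    eq_neg_of_add_eq_zero_left this
  simp only [lieEnd, sub_apply, ContinuousLinearMap.comp_apply, h.sq e he, e1, map_sub, map_neg]
  abel

lemma lieEnd_eq_zero [FiniteDimensional ℝ V] (hd : 2 < Module.finrank ℝ V) (he : e ∈ Ω)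
    (hs : ∀ x, ∃ a b : ℝ, lieEnd v J e x = a • x + b • J e x) (x : V) : lieEnd v J e x = 0 :=
  eq_zero_of_antilinear (J e).toLinearMap (lieEnd v J e).toLinearMap (h.sq e he)
    (h.lieEnd_anticomm he) hs hd x

/-- In the commutation formula `cov_lieEnd` for `A = J`, both `∇J` and `L_v J` vanish, and only the
commutator of `L_v ∇` with `J` is left. -/
lemma lieConn_J (hv : ContDiffAt ℝ ∞ v e) (he : e ∈ Ω)
    (hL : ∀ᶠ y in 𝓝 e, ∀ x, lieEnd v J y x = 0) (x y : V) :
    lieConn v Γ e x (J e y) = J e (lieConn v Γ e x y) := by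
  have h1 := cov_lieEnd (h.smooth_J e he) hv (h.smooth_conn e he) (T := fun _ _ _ ↦ 0)
    ((h.nhds he).mono fun y hy ↦ h.parallel y hy) (u := x) (y := y) (T' := 0)
    (hasDerivAt_const _ _)
  have hL' : lieEnd v J =ᶠ[𝓝 e] 0 := hL.mono fun y hy ↦ by ext x; simpa using hy x
  have h2 : covEnd Γ (lieEnd v J) e x y = 0 := by
    have : lieEnd v J e = 0 := hL'.self_of_nhds
    simp [covEnd, hL'.fderiv_eq, this]
  rw [h2] at h1
  simp only [map_zero, add_zero, sub_zero, zero_sub] at h1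
  exact sub_eq_zero.1 (neg_eq_zero.1 h1.symm)

/-- The variation of the connection along a c-projective vector field. -/
lemma exists_lieConn_form (hv : ContDiffAt ℝ ∞ v e) (he : e ∈ Ω)
    (hL : ∀ᶠ y in 𝓝 e, ∀ x, lieEnd v J y x = 0)
    (hP : ∀ x, ∃ a b : ℝ, lieConn v Γ e x x = a • x + b • J e x) :
    ∃ φ : V →ₗ[ℝ] ℝ, ∀ x y, lieConn v Γ e x y =
      φ x • y + φ y • x - φ (J e x) • J e y - φ (J e y) • J e x := by
  have hc := h.smooth_conn e he
  have hs := lieConn_symm hv hc ((h.nhds he).mono fun y hy ↦ h.torsionFree y hy)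
  have hadd (x y y' : V) : lieConn v Γ e x (y + y') = lieConn v Γ e x y + lieConn v Γ e x y' := by
    simp only [lieConn, map_add]; abel
  have hsmul (r : ℝ) (x y : V) : lieConn v Γ e x (r • y) = r • lieConn v Γ e x y := by
    simp only [lieConn, map_smul]; module
  exact exists_cprojective_form (J e).toLinearMap (h.sq e he)
    (LinearMap.mk₂ ℝ (lieConn v Γ e)
      (fun x x' y ↦ by rw [hs, hadd, hs y x, hs y x']) (fun r x y ↦ by rw [hs, hsmul, hs y x])
      (fun x y y' ↦ hadd x y y') (fun r x y ↦ hsmul r x y))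
    hs (h.lieConn_J hv he hL) hP

variable {B : V → V →L[ℝ] V} {l₀ : V} {c : ℝ}

/-- The covariant derivative of `B`, where `L_v g = g(B ·, ·)`. -/
lemma covEnd_of_lieForm (hv : ContDiffAt ℝ ∞ v e) (he : e ∈ Ω) (hB : ContDiffAt ℝ ∞ B e)
    (hBG : ∀ᶠ e' in 𝓝 e, ∀ a b, G e' (B e' a) b = lieForm v G e' a b)
    (hP : ∀ x y, lieConn v Γ e x y = G e l₀ x • y + G e l₀ y • x
      - G e l₀ (J e x) • J e y - G e l₀ (J e y) • J e x) (u y : V) :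
    covEnd Γ B e u y = (2 * G e l₀ u) • y + mainRHS (G e) (J e) l₀ u y := by
  have hG := h.smooth_metric e he
  refine h.ext_of_metric he fun z ↦ ?_
  have d1 := ((hasDerivAt_line hG.diffAt u).clm_apply ((hasDerivAt_line hB.diffAt u).clm_apply
    (hasDerivAt_const _ y))).clm_apply (hasDerivAt_const _ z)
  have hd : DifferentiableAt ℝ (fun e' ↦ lieForm v G e' y z) e := by
    unfold lieForm
    have := (contDiffAt_fderiv hG).diffAt; have := hv.diffAt; have := hG.diffAt
    have := (contDiffAt_fderiv hv).diffAt
    fun_prop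
  have e1 := deriv_line_unique (a := fun e' ↦ G e' (B e' y) z) d1 (hasDerivAt_line hd u)
    (hBG.mono fun e' h ↦ h y z)
  have e2 := cov_lieForm hG hv (h.smooth_conn e he)
    ((h.nhds he).mono fun y hy ↦ h.metric y hy) u y z
  rw [← e1] at e2
  have hB0 := hBG.self_of_nhds
  have hm := h.metric e he
  simp only [← hB0, hP, hm, map_zero, add_zero, add_apply] at e2
  have hsym := h.symm e he
  have hsk := h.skew he
  have e3 : covEnd Γ B e u y = fderiv ℝ B e u y + (Γ e u (B e y) - B e (Γ e u y)) := rfl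
  rw [e3]
  have s1 := hsym y z
  have s2 := hsym u y
  have s3 := hsym u z
  -- Together with the other rewriting rules this fixes one representative of each scalar, so that
  -- the comparison becomes linear in these scalars.
  have s4 : G e u (J e y) = -G e y (J e u) := by rw [hsym, hsk]
  have s5 : G e u (J e z) = -G e z (J e u) := by rw [hsym, hsk]
  simp only [mainRHS, map_add, map_sub, map_smul, add_apply, sub_apply, smul_apply,
    smul_eq_mul, zero_smul, add_zero, hsk, s1, s2, s3, s4, s5] at e2 ⊢
  linarith

/-- Subtracting a multiple of the identity. -/
lemma covEnd_sub_id {τ : V → ℝ} (hB : DifferentiableAt ℝ B e) (hτ : DifferentiableAt ℝ τ e)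
    (u y : V) : covEnd Γ (fun e ↦ B e - τ e • ContinuousLinearMap.id ℝ V) e u y =
      covEnd Γ B e u y - fderiv ℝ τ e u • y := by
  have d : fderiv ℝ (fun e ↦ B e - τ e • ContinuousLinearMap.id ℝ V) e u =
      fderiv ℝ B e u - fderiv ℝ τ e u • ContinuousLinearMap.id ℝ V := by
    rw [fderiv_fun_sub hB (hτ.smul_const _), fderiv_smul_const hτ]
    rfl
  simp only [covEnd, d, add_apply, sub_apply, smul_apply, ContinuousLinearMap.comp_apply,
    ContinuousLinearMap.id_apply, map_sub, map_smul]
  abel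

/-- The c-projective variation of a solution of the main equation is again a solution. -/
lemma covEnd_lieEnd_sub (hv : ContDiffAt ℝ ∞ v e) (he : e ∈ Ω) (hA : ContDiffAt ℝ ∞ A e)
    (hl : ContDiffAt ℝ ∞ l e) (hL : ∀ x, lieEnd v J e x = 0)
    (hAm : ∀ᶠ e' in 𝓝 e, ∀ u y, covEnd Γ A e' u y = mainRHS (G e') (J e') (l e') u y)
    (hAs : ∀ a b, G e (A e a) b = G e a (A e b)) (hAJ : ∀ a, A e (J e a) = J e (A e a))
    (hB : ContDiffAt ℝ ∞ B e) (hBm : ∀ u y, covEnd Γ B e u y = mainRHS (G e) (J e) l₀ u y)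
    (hBs : ∀ a b, G e (B e a) b = G e a (B e b)) (hBJ : ∀ a, B e (J e a) = J e (B e a))
    (hBG : ∀ a b, lieForm v G e a b = G e (B e a) b + c * G e a b)
    (hP : ∀ x y, lieConn v Γ e x y = G e l₀ x • y + G e l₀ y • x
      - G e l₀ (J e x) • J e y - G e l₀ (J e y) • J e x) (u y : V) :
    covEnd Γ (fun e ↦ lieEnd v A e - A e ∘L B e) e u y =
      mainRHS (G e) (J e) (lieVec v l e + c • l e - A e l₀) u y := by
  have hG := h.smooth_metric e he
  have hJ := h.smooth_J e he
  have e1 := cov_lieEnd hA hv (h.smooth_conn e he) hAm (u := u) (y := y)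
    (hasDerivAt_mainRHS hG hJ hl (v e) u y)
  have hdl : DifferentiableAt ℝ (lieEnd v A) e := by
    unfold lieEnd
    have := (contDiffAt_fderiv hA).diffAt; have := hv.diffAt; have := hA.diffAt
    have := (contDiffAt_fderiv hv).diffAt
    fun_prop
  have hA0 := hAm.self_of_nhds
  have d1 : fderiv ℝ (fun e ↦ lieEnd v A e - A e ∘L B e) e u y = fderiv ℝ (lieEnd v A) e u y
      - (fderiv ℝ A e u (B e y) + A e (fderiv ℝ B e u y)) := by
    have hd : DifferentiableAt ℝ (fun e ↦ lieEnd v A e - A e ∘L B e) e := by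
      have := hA.diffAt; have := hB.diffAt
      fun_prop
    have a1 := (hasDerivAt_line hd u).clm_apply (hasDerivAt_const _ y)
    have a2 := ((hasDerivAt_line hdl u).clm_apply (hasDerivAt_const _ y)).sub
      ((hasDerivAt_line hA.diffAt u).clm_apply ((hasDerivAt_line hB.diffAt u).clm_apply
        (hasDerivAt_const _ y)))
    have := a1.unique a2
    simpa using this
  have e2 : covEnd Γ (fun e ↦ lieEnd v A e - A e ∘L B e) e u y = covEnd Γ (lieEnd v A) e u y
      - (covEnd Γ A e u (B e y) + A e (covEnd Γ B e u y)) := by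
    simp only [covEnd, d1, add_apply, sub_apply, ContinuousLinearMap.comp_apply, map_add, map_sub]
    abel
  have hLJ (x : V) : fderiv ℝ J e (v e) x = fderiv ℝ v e (J e x) - J e (fderiv ℝ v e x) := by
    have := hL x
    simp only [lieEnd, sub_apply, ContinuousLinearMap.comp_apply] at this
    exact sub_eq_zero.1 this
  have hGv (a b : V) : fderiv ℝ G e (v e) a b = G e (B e a) b + c * G e a b
      - G e (fderiv ℝ v e a) b - G e a (fderiv ℝ v e b) := by
    rw [← hBG]; simp only [lieForm]; ring
  have hl' : fderiv ℝ l e (v e) = lieVec v l e + fderiv ℝ v e (l e) := by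
    simp [lieVec]
  -- The factors `G (B ·) ·` coming from `L_v G` cancel against `(∇_u A) B`. The terms with `l₀`
  -- come from `[L_v ∇, A]` and from `A ∇_u B`; they combine into the summand `-A l₀` of the new
  -- vector field, and the scalar `c` yields the summand `c l`.
  rw [e2, e1, hA0, hBm]
  have hsk := h.skew he
  simp only [hP, hLJ, hGv, hl', mainRHS, map_add, map_sub, map_smul, add_apply, sub_apply,
    smul_apply, smul_eq_mul, hAs, hBs, hAJ, hBJ, hsk]
  module

end IsLocalKahler
end LocalKahler

/-! ### The Levi-Civita connection in coordinates -/

section LocalConnection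

variable {V : Type*} [NormedAddCommGroup V] [NormedSpace ℝ V]

/-- The Christoffel symbols of the first kind. -/
def firstKind (D : V →L[ℝ] V →L[ℝ] V →L[ℝ] ℝ) : V →L[ℝ] V →L[ℝ] V →L[ℝ] ℝ :=
  (1 / 2 : ℝ) • (D + D.flip
    - (ContinuousLinearMap.flipₗᵢ ℝ V V ℝ).toContinuousLinearEquiv.toContinuousLinearMap ∘L D.flip)

lemma firstKind_apply (D : V →L[ℝ] V →L[ℝ] V →L[ℝ] ℝ) (u a z : V) :
    firstKind D u a z = 1 / 2 * (D u a z + D a u z - D z u a) := rfl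

/-- The Christoffel symbols of the second kind. -/
def localConn (G : V → V →L[ℝ] V →L[ℝ] ℝ) (e : V) : V →L[ℝ] V →L[ℝ] V :=
  (ContinuousLinearMap.compL ℝ V (V →L[ℝ] ℝ) V (G e).inverse) ∘L firstKind (fderiv ℝ G e)

lemma localConn_apply (G : V → V →L[ℝ] V →L[ℝ] ℝ) (e u a : V) :
    localConn G e u a = (G e).inverse (firstKind (fderiv ℝ G e) u a) := rfl

variable {G : V → V →L[ℝ] V →L[ℝ] ℝ} {e : V}

lemma exists_equiv_of_nondegenerate [FiniteDimensional ℝ V] {b : V →L[ℝ] V →L[ℝ] ℝ}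
    (hn : ∀ a, (∀ c, b a c = 0) → a = 0) :
    ∃ f : V ≃L[ℝ] (V →L[ℝ] ℝ), (f : V →L[ℝ] V →L[ℝ] ℝ) = b := by
  have hinj : Function.Injective b.toLinearMap := by
    rw [← LinearMap.ker_eq_bot, LinearMap.ker_eq_bot']
    intro a ha
    exact hn a fun c ↦ by simpa using congrArg (fun f : V →L[ℝ] ℝ ↦ f c) ha
  have hfr : Module.finrank ℝ V = Module.finrank ℝ (V →L[ℝ] ℝ) := by
    rw [← (LinearMap.toContinuousLinearMap (𝕜 := ℝ) (E := V) (F' := ℝ)).finrank_eq]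
    exact Subspace.dual_finrank_eq.symm
  exact ⟨(LinearMap.linearEquivOfInjective b.toLinearMap hinj hfr).toContinuousLinearEquiv, by
    ext a c; rfl⟩

lemma apply_inverse [FiniteDimensional ℝ V] {b : V →L[ℝ] V →L[ℝ] ℝ}
    (hn : ∀ a, (∀ c, b a c = 0) → a = 0) (f : V →L[ℝ] ℝ) : b (b.inverse f) = f := by
  obtain ⟨E, rfl⟩ := exists_equiv_of_nondegenerate hn
  rw [ContinuousLinearMap.inverse_equiv]
  simp

lemma contDiffAt_inverse_metric [FiniteDimensional ℝ V] {W : Type*} [NormedAddCommGroup W]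
    [NormedSpace ℝ W] {G : W → V →L[ℝ] V →L[ℝ] ℝ} {e : W} (hG : ContDiffAt ℝ ∞ G e)
    (hn : ∀ a, (∀ c, G e a c = 0) → a = 0) :
    ContDiffAt ℝ ∞ (fun y ↦ (G y).inverse) e := by
  obtain ⟨E, hE⟩ := exists_equiv_of_nondegenerate hn
  have : ContDiffAt ℝ ∞ ContinuousLinearMap.inverse (G e) := by
    rw [← hE]; exact contDiffAt_map_inverse E
  exact this.comp e hG

lemma metric_localConn [FiniteDimensional ℝ V] (hn : ∀ a, (∀ c, G e a c = 0) → a = 0)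
    (u a z : V) : G e (localConn G e u a) z = firstKind (fderiv ℝ G e) u a z := by
  rw [localConn_apply, apply_inverse hn]

lemma contDiffAt_localConn [FiniteDimensional ℝ V] (hG : ContDiffAt ℝ ∞ G e)
    (hn : ∀ a, (∀ c, G e a c = 0) → a = 0) : ContDiffAt ℝ ∞ (localConn G) e := by
  have h1 := contDiffAt_inverse_metric hG hn
  have h2 := contDiffAt_fderiv hG
  have h3 : ContDiffAt ℝ ∞ (fun y ↦ firstKind (fderiv ℝ G y)) e := by
    unfold firstKind
    have h4 : ContDiffAt ℝ ∞ (fun y ↦ (fderiv ℝ G y).flip) e :=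
      ((ContinuousLinearMap.flipₗᵢ ℝ V V (V →L[ℝ] ℝ)).toContinuousLinearEquiv.contDiff.contDiffAt).comp
        e h2
    exact ((h2.add h4).sub (contDiffAt_const.clm_comp h4)).const_smul (1 / 2 : ℝ)
  have h5 : ContDiffAt ℝ ∞
      (fun y ↦ ContinuousLinearMap.compL ℝ V (V →L[ℝ] ℝ) V (G y).inverse) e :=
    (ContinuousLinearMap.compL ℝ V (V →L[ℝ] ℝ) V).contDiff.contDiffAt.comp e h1
  exact h5.clm_comp h3

lemma fderiv_metric_symm (hG : DifferentiableAt ℝ G e) (hs : ∀ᶠ y in 𝓝 e, ∀ a b, G y a b = G y b a)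
    (u a b : V) : fderiv ℝ G e u a b = fderiv ℝ G e u b a := by
  have d (a b : V) : HasDerivAt (fun t : ℝ ↦ G (e + t • u) a b) (fderiv ℝ G e u a b) 0 := by
    have := ((hasDerivAt_line hG u).clm_apply (hasDerivAt_const _ a)).clm_apply
      (hasDerivAt_const _ b)
    simpa using this
  exact deriv_line_unique (a := fun z ↦ G z a b) (b := fun z ↦ G z b a) (d a b) (d b a)
    (hs.mono fun z hz ↦ hz a b)

lemma localConn_symm [FiniteDimensional ℝ V] (hG : DifferentiableAt ℝ G e)
    (hs : ∀ᶠ y in 𝓝 e, ∀ a b, G y a b = G y b a) (u a : V) :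
    localConn G e u a = localConn G e a u := by
  rw [localConn_apply, localConn_apply]
  congr 1
  ext z
  rw [firstKind_apply, firstKind_apply, fderiv_metric_symm hG hs z u a]
  ring

lemma localConn_metric [FiniteDimensional ℝ V] (hG : DifferentiableAt ℝ G e)
    (hs : ∀ᶠ y in 𝓝 e, ∀ a b, G y a b = G y b a) (hn : ∀ a, (∀ c, G e a c = 0) → a = 0)
    (u a b : V) :
    fderiv ℝ G e u a b = G e (localConn G e u a) b + G e a (localConn G e u b) := by
  rw [hs.self_of_nhds a, metric_localConn hn, metric_localConn hn, firstKind_apply,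
    firstKind_apply, fderiv_metric_symm hG hs u b a, fderiv_metric_symm hG hs a u b,
    fderiv_metric_symm hG hs b u a]
  ring

/-- Transformation of the Christoffel symbols under a change of coordinates. -/
lemma connection_transform {G₁ G₂ : V → V →L[ℝ] V →L[ℝ] ℝ} {φ : V → V}
    (hφ : ContDiffAt ℝ ∞ φ e) (h₁ : DifferentiableAt ℝ G₁ e) (h₂ : DifferentiableAt ℝ G₂ (φ e))
    (hG : ∀ᶠ y in 𝓝 e, ∀ a b, G₁ y a b = G₂ (φ y) (fderiv ℝ φ y a) (fderiv ℝ φ y b))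
    (hs : ∀ a b, G₂ (φ e) a b = G₂ (φ e) b a)
    (hn : ∀ a, (∀ c, G₂ (φ e) a c = 0) → a = 0)
    (hsurj : Function.Surjective (fderiv ℝ φ e)) {u a c₁ c₂ : V}
    (hc₁ : ∀ z, G₁ e c₁ z = firstKind (fderiv ℝ G₁ e) u a z)
    (hc₂ : ∀ z, G₂ (φ e) c₂ z =
      firstKind (fderiv ℝ G₂ (φ e)) (fderiv ℝ φ e u) (fderiv ℝ φ e a) z) :
    fderiv ℝ φ e c₁ = c₂ + fderiv ℝ (fderiv ℝ φ) e u a := by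
  have hφ1 := contDiffAt_fderiv hφ
  have hD (w a b : V) : fderiv ℝ G₁ e w a b =
      fderiv ℝ G₂ (φ e) (fderiv ℝ φ e w) (fderiv ℝ φ e a) (fderiv ℝ φ e b)
      + G₂ (φ e) (fderiv ℝ (fderiv ℝ φ) e w a) (fderiv ℝ φ e b)
      + G₂ (φ e) (fderiv ℝ φ e a) (fderiv ℝ (fderiv ℝ φ) e w b) := by
    have d1 := ((hasDerivAt_line h₁ w).clm_apply (hasDerivAt_const _ a)).clm_apply
      (hasDerivAt_const _ b)
    have hcomp : DifferentiableAt ℝ (G₂ ∘ φ) e := h₂.comp e hφ.diffAt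
    have d2 := ((hasDerivAt_line hcomp w).clm_apply ((hasDerivAt_line hφ1.diffAt w).clm_apply
      (hasDerivAt_const _ a))).clm_apply ((hasDerivAt_line hφ1.diffAt w).clm_apply
      (hasDerivAt_const _ b))
    have := deriv_line_unique (a := fun y ↦ G₁ y a b)
      (b := fun y ↦ (G₂ ∘ φ) y (fderiv ℝ φ y a) (fderiv ℝ φ y b)) d1 d2
      (hG.mono fun y hy ↦ hy a b)
    rw [fderiv_comp e h₂ hφ.diffAt] at this
    simpa using this
  -- Equality is tested against vectors `dφ z`, which exhaust the space by surjectivity; the rest is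
  -- the Koszul formula for both metrics together with `hD`.
  rw [← sub_eq_zero]
  refine hn _ fun z' ↦ ?_
  obtain ⟨z, rfl⟩ := hsurj z'
  have e1 := hc₁ z
  rw [hG.self_of_nhds, firstKind_apply, hD, hD, hD] at e1
  simp only [map_sub, map_add, sub_apply, add_apply, hc₂, firstKind_apply, e1]
  rw [fderiv_fderiv_comm hφ a u, fderiv_fderiv_comm hφ z u, fderiv_fderiv_comm hφ z a,
    hs (fderiv ℝ (fderiv ℝ φ) e u z)]
  ring

end LocalConnection

/-! ### Tensor fields in a chart -/

section Charts

variable {E : Type*} [NormedAddCommGroup E] [NormedSpace ℝ E] [FiniteDimensional ℝ E]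
  {M : Type*} [TopologicalSpace M] [ChartedSpace E M] [IsManifold 𝓘(ℝ, E) ∞ M]
  {F : Type*} [NormedAddCommGroup F] [NormedSpace ℝ F]

/-- The components of tangent vectors at `x` in the preferred chart around `p`. -/
def coordComp (p x : M) : TangentSpace 𝓘(ℝ, E) x →L[ℝ] E :=
  (trivializationAt E (TangentSpace 𝓘(ℝ, E) : M → Type _) p).continuousLinearMapAt ℝ x

variable (E) in
/-- The inverse of the preferred chart around `p`. -/
def chartInv (p : M) (e : E) : M := (extChartAt 𝓘(ℝ, E) p).symm e

variable (E) in
/-- The image of the preferred chart around `p`. -/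
def chartDom (p : M) : Set E := (extChartAt 𝓘(ℝ, E) p).target

lemma isOpen_chartDom (p : M) : IsOpen (chartDom E p) := isOpen_extChartAt_target p

lemma chartInv_mem {p : M} {e : E} (he : e ∈ chartDom E p) :
    chartInv E p e ∈ (chartAt E p).source := by
  rw [← extChartAt_source 𝓘(ℝ, E)]
  exact (extChartAt 𝓘(ℝ, E) p).map_target he

lemma chart_mem {p x : M} (hx : x ∈ (chartAt E p).source) :
    extChartAt 𝓘(ℝ, E) p x ∈ chartDom E p :=
  (extChartAt 𝓘(ℝ, E) p).map_source (by rwa [extChartAt_source])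

lemma chart_chartInv {p : M} {e : E} (he : e ∈ chartDom E p) :
    extChartAt 𝓘(ℝ, E) p (chartInv E p e) = e :=
  (extChartAt 𝓘(ℝ, E) p).right_inv he

lemma chartInv_chart {p x : M} (hx : x ∈ (chartAt E p).source) :
    chartInv E p (extChartAt 𝓘(ℝ, E) p x) = x :=
  (extChartAt 𝓘(ℝ, E) p).left_inv (by rwa [extChartAt_source])

lemma contMDiffAt_chartInv {p : M} {e : E} (he : e ∈ chartDom E p) :
    ContMDiffAt 𝓘(ℝ, E) 𝓘(ℝ, E) ∞ (chartInv E p) e :=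
  (contMDiffOn_extChartAt_symm p).contMDiffAt ((isOpen_chartDom p).mem_nhds he)

lemma continuousAt_chartInv {p : M} {e : E} (he : e ∈ chartDom E p) :
    ContinuousAt (chartInv E p) e := (contMDiffAt_chartInv he).continuousAt

lemma mem_baseSet {p x : M} (hx : x ∈ (chartAt E p).source) :
    x ∈ (trivializationAt E (TangentSpace 𝓘(ℝ, E) : M → Type _) p).baseSet := by
  rwa [TangentBundle.trivializationAt_baseSet]

lemma coordComp_coordFrame {p x : M} (hx : x ∈ (chartAt E p).source) (a : E) :
    coordComp p x (coordFrame p x a) = a :=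
  Trivialization.continuousLinearMapAt_symmL _ (mem_baseSet hx) a

lemma coordFrame_coordComp {p x : M} (hx : x ∈ (chartAt E p).source)
    (u : TangentSpace 𝓘(ℝ, E) x) : coordFrame p x (coordComp p x u) = u :=
  Trivialization.symmL_continuousLinearMapAt _ (mem_baseSet hx) u

lemma components_eq (Y : (y : M) → TangentSpace 𝓘(ℝ, E) y) {p x : M}
    (hx : x ∈ (chartAt E p).source) : components Y p x = coordComp p x (Y x) := by
  simp [components, coordComp, Trivialization.continuousLinearMapAt_apply,
    Trivialization.coe_linearMapAt_of_mem _ (mem_baseSet hx)]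

lemma coordComp_eq_mfderiv {p x : M} (hx : x ∈ (chartAt E p).source) :
    coordComp p x = mfderiv 𝓘(ℝ, E) 𝓘(ℝ, E) (extChartAt 𝓘(ℝ, E) p) x :=
  TangentBundle.continuousLinearMapAt_trivializationAt hx

/-- The tangent space at `x` is modelled on `E` through the preferred chart at `x`. This lets
objects defined pointwise in the chart centred at the point be compared with their expressions in
one fixed chart. -/
lemma coordComp_self (x : M) (u : TangentSpace 𝓘(ℝ, E) x) : coordComp x x u = u := by
  have h := components_eq (fun y ↦ (show TangentSpace 𝓘(ℝ, E) y from (u : E)))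
    (mem_chart_source E x)
  rw [components_self] at h
  exact h.symm

lemma coordFrame_self (x : M) (a : E) : coordFrame x x a = a := by
  have := coordFrame_coordComp (mem_chart_source E x) (show TangentSpace 𝓘(ℝ, E) x from a)
  rwa [coordComp_self] at this

lemma mdifferentiableAt_chart {p x : M} (hx : x ∈ (chartAt E p).source) :
    MDifferentiableAt 𝓘(ℝ, E) 𝓘(ℝ, E) (extChartAt 𝓘(ℝ, E) p) x :=
  mdifferentiableAt_extChartAt hx

lemma eventually_chartInv_chart {p x : M} (hx : x ∈ (chartAt E p).source) :
    ∀ᶠ y in 𝓝 x, chartInv E p (extChartAt 𝓘(ℝ, E) p y) = y := by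
  filter_upwards [(chartAt E p).open_source.mem_nhds hx] with y hy
  exact chartInv_chart hy

lemma contDiffAt_comp_chartInv {f : M → F} {p : M} {e : E} (he : e ∈ chartDom E p)
    (hf : ContMDiffAt 𝓘(ℝ, E) 𝓘(ℝ, F) ∞ f (chartInv E p e)) :
    ContDiffAt ℝ ∞ (fun y ↦ f (chartInv E p y)) e :=
  (hf.comp e (contMDiffAt_chartInv he)).contDiffAt

lemma contMDiffAt_of_comp_chartInv {f : M → F} {p x : M} (hx : x ∈ (chartAt E p).source)
    (hf : ContDiffAt ℝ ∞ (fun y ↦ f (chartInv E p y)) (extChartAt 𝓘(ℝ, E) p x)) :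
    ContMDiffAt 𝓘(ℝ, E) 𝓘(ℝ, F) ∞ f x := by
  have h := hf.contMDiffAt.comp x (contMDiffAt_extChartAt' (n := ∞) hx)
  refine h.congr_of_eventuallyEq ?_
  filter_upwards [eventually_chartInv_chart hx] with y hy
  simp only [Function.comp_apply, hy]

lemma differentiableAt_comp_chartInv {f : M → F} {p : M} {e : E} (he : e ∈ chartDom E p)
    (hf : MDifferentiableAt 𝓘(ℝ, E) 𝓘(ℝ, F) f (chartInv E p e)) :
    DifferentiableAt ℝ (fun y ↦ f (chartInv E p y)) e :=
  (hf.comp e ((contMDiffAt_chartInv he).mdifferentiableAt (by simp))).differentiableAt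

lemma mvfderiv_eq {f : M → F} {p x : M} (hx : x ∈ (chartAt E p).source)
    (hf : MDifferentiableAt 𝓘(ℝ, E) 𝓘(ℝ, F) f x) (u : TangentSpace 𝓘(ℝ, E) x) :
    mvfderiv 𝓘(ℝ, E) f x u =
      fderiv ℝ (fun y ↦ f (chartInv E p y)) (extChartAt 𝓘(ℝ, E) p x) (coordComp p x u) := by
  have hf' : DifferentiableAt ℝ (fun y ↦ f (chartInv E p y)) (extChartAt 𝓘(ℝ, E) p x) :=
    differentiableAt_comp_chartInv (chart_mem hx) (by rwa [chartInv_chart hx])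
  have h1 : f =ᶠ[𝓝 x] (fun y ↦ f (chartInv E p y)) ∘ extChartAt 𝓘(ℝ, E) p := by
    filter_upwards [eventually_chartInv_chart hx] with y hy
    simp only [Function.comp_apply, hy]
  have h2 : mfderiv 𝓘(ℝ, E) 𝓘(ℝ, F) f x = _ := h1.mfderiv_eq
  rw [mfderiv_comp x hf'.mdifferentiableAt (mdifferentiableAt_chart hx)] at h2
  rw [coordComp_eq_mfderiv hx]
  change mfderiv 𝓘(ℝ, E) 𝓘(ℝ, F) f x u = _
  rw [h2, mfderiv_eq_fderiv]
  rfl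

/-- The change of coordinates from the chart around `x` to the chart around `p`. -/
def transition (x p : M) (e : E) : E := extChartAt 𝓘(ℝ, E) p (chartInv E x e)

lemma contDiffAt_transition {x p : M} {e : E} (he : e ∈ chartDom E x)
    (he' : chartInv E x e ∈ (chartAt E p).source) : ContDiffAt ℝ ∞ (transition x p) e :=
  contDiffAt_comp_chartInv he (contMDiffAt_extChartAt' he')

lemma coordComp_transition {x p y : M} (hy : y ∈ (chartAt E x).source)
    (hy' : y ∈ (chartAt E p).source) (u : TangentSpace 𝓘(ℝ, E) y) :
    coordComp p y u = fderiv ℝ (transition x p) (extChartAt 𝓘(ℝ, E) x y) (coordComp x y u) := by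
  rw [coordComp_eq_mfderiv hy']
  exact mvfderiv_eq hy (mdifferentiableAt_chart hy') u

/-- A vector field in the chart around `p`. -/
def locVec (Y : (y : M) → TangentSpace 𝓘(ℝ, E) y) (p : M) (e : E) : E :=
  components Y p (chartInv E p e)

/-- An endomorphism field in the chart around `p`. -/
def locEnd (A : (y : M) → TangentSpace 𝓘(ℝ, E) y →L[ℝ] TangentSpace 𝓘(ℝ, E) y) (p : M) (e : E) :
    E →L[ℝ] E :=
  coordComp p (chartInv E p e) ∘L A (chartInv E p e) ∘L coordFrame p (chartInv E p e)

lemma locVec_apply (Y : (y : M) → TangentSpace 𝓘(ℝ, E) y) {p : M} {e : E}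
    (he : e ∈ chartDom E p) :
    locVec Y p e = coordComp p (chartInv E p e) (Y (chartInv E p e)) :=
  components_eq Y (chartInv_mem he)

lemma locEnd_apply (A : (y : M) → TangentSpace 𝓘(ℝ, E) y →L[ℝ] TangentSpace 𝓘(ℝ, E) y) (p : M)
    {e : E} (he : e ∈ chartDom E p) (u : TangentSpace 𝓘(ℝ, E) (chartInv E p e)) :
    locEnd A p e (coordComp p _ u) = coordComp p _ (A _ u) := by
  simp [locEnd, coordFrame_coordComp (chartInv_mem he)]

lemma contMDiffAt_iff_locVec {Y : (y : M) → TangentSpace 𝓘(ℝ, E) y} {p x : M}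
    (hx : x ∈ (chartAt E p).source) :
    ContMDiffAt 𝓘(ℝ, E) (𝓘(ℝ, E).prod 𝓘(ℝ, E)) ∞ (fun y ↦ TotalSpace.mk' E y (Y y)) x ↔
      ContDiffAt ℝ ∞ (locVec Y p) (extChartAt 𝓘(ℝ, E) p x) := by
  rw [(trivializationAt E (TangentSpace 𝓘(ℝ, E) : M → Type _) p).contMDiffAt_section_iff
    (mem_baseSet hx)]
  constructor
  · intro h
    exact contDiffAt_comp_chartInv (chart_mem hx) (by rwa [chartInv_chart hx])
  · intro h
    exact contMDiffAt_of_comp_chartInv hx h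

lemma vfDiffAt_locVec {Y : (y : M) → TangentSpace 𝓘(ℝ, E) y} {p x : M}
    (hx : x ∈ (chartAt E p).source) (h : VFDiffAt Y x) :
    DifferentiableAt ℝ (locVec Y p) (extChartAt 𝓘(ℝ, E) p x) := by
  unfold VFDiffAt at h
  rw [(trivializationAt E (TangentSpace 𝓘(ℝ, E) : M → Type _) p).mdifferentiableAt_section_iff
    𝓘(ℝ, E) _ (mem_baseSet hx)] at h
  exact differentiableAt_comp_chartInv (chart_mem hx) (by rwa [chartInv_chart hx])

lemma vfDiffAt_of_locVec {Y : (y : M) → TangentSpace 𝓘(ℝ, E) y} {p x : M}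
    (hx : x ∈ (chartAt E p).source)
    (h : DifferentiableAt ℝ (locVec Y p) (extChartAt 𝓘(ℝ, E) p x)) : VFDiffAt Y x := by
  unfold VFDiffAt
  rw [(trivializationAt E (TangentSpace 𝓘(ℝ, E) : M → Type _) p).mdifferentiableAt_section_iff
    𝓘(ℝ, E) _ (mem_baseSet hx)]
  refine (h.mdifferentiableAt.comp x (mdifferentiableAt_chart hx)).congr_of_eventuallyEq ?_
  filter_upwards [eventually_chartInv_chart hx] with y hy
  rw [Function.comp_apply, locVec, hy]
  rfl

lemma contMDiffAt_iff_locEnd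
    {A : (y : M) → TangentSpace 𝓘(ℝ, E) y →L[ℝ] TangentSpace 𝓘(ℝ, E) y} {p x : M}
    (hx : x ∈ (chartAt E p).source) :
    ContMDiffAt 𝓘(ℝ, E) (𝓘(ℝ, E).prod 𝓘(ℝ, E →L[ℝ] E)) ∞
      (fun y ↦ TotalSpace.mk' (E →L[ℝ] E) y (A y)) x ↔
      ContDiffAt ℝ ∞ (locEnd A p) (extChartAt 𝓘(ℝ, E) p x) := by
  have hb : x ∈ (trivializationAt (E →L[ℝ] E)
      (fun x : M ↦ TangentSpace 𝓘(ℝ, E) x →L[ℝ] TangentSpace 𝓘(ℝ, E) x) p).baseSet := by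
    rw [hom_trivializationAt_baseSet]
    exact ⟨mem_baseSet hx, mem_baseSet hx⟩
  rw [(trivializationAt (E →L[ℝ] E)
    (fun x : M ↦ TangentSpace 𝓘(ℝ, E) x →L[ℝ] TangentSpace 𝓘(ℝ, E) x) p).contMDiffAt_section_iff hb]
  constructor
  · intro h
    exact contDiffAt_comp_chartInv (chart_mem hx) (by rwa [chartInv_chart hx])
  · intro h
    exact contMDiffAt_of_comp_chartInv hx h

/-- A metric in the chart around `p`. -/
def locMet (g : PseudoRiemannianMetric E M) (p : M) (e : E) : E →L[ℝ] E →L[ℝ] ℝ :=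
  g.inChart p (chartInv E p e)

lemma locMet_coordComp (g : PseudoRiemannianMetric E M) {p : M} {e : E} (he : e ∈ chartDom E p)
    (u w : TangentSpace 𝓘(ℝ, E) (chartInv E p e)) :
    locMet g p e (coordComp p _ u) (coordComp p _ w) = g.val _ u w := by
  simp [locMet, g.inChart_apply, coordFrame_coordComp (chartInv_mem he)]

/-- Over the chart domain, the components of `g` coincide with its expression in the trivialization
of the bundle of bilinear forms, where smoothness is part of the definition of a metric. -/
lemma contMDiffAt_inChart (g : PseudoRiemannianMetric E M) {p x : M}
    (hx : x ∈ (chartAt E p).source) :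
    ContMDiffAt 𝓘(ℝ, E) 𝓘(ℝ, E →L[ℝ] E →L[ℝ] ℝ) ∞ (g.inChart p) x := by
  have hb : x ∈ (trivializationAt (E →L[ℝ] E →L[ℝ] ℝ)
      (fun x : M ↦ TangentSpace 𝓘(ℝ, E) x →L[ℝ] TangentSpace 𝓘(ℝ, E) x →L[ℝ] ℝ) p).baseSet := by
    rw [hom_trivializationAt_baseSet]
    refine ⟨mem_baseSet hx, ?_⟩
    rw [hom_trivializationAt_baseSet]
    exact ⟨mem_baseSet hx, by simp⟩
  have h := ((trivializationAt (E →L[ℝ] E →L[ℝ] ℝ)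
    (fun x : M ↦ TangentSpace 𝓘(ℝ, E) x →L[ℝ] TangentSpace 𝓘(ℝ, E) x →L[ℝ] ℝ)
      p).contMDiffAt_section_iff hb).1 g.contMDiff.contMDiffAt
  refine h.congr_of_eventuallyEq ?_
  filter_upwards [(chartAt E p).open_source.mem_nhds hx] with y hy
  have hb' : y ∈ (trivializationAt (E →L[ℝ] ℝ)
      (fun x : M ↦ TangentSpace 𝓘(ℝ, E) x →L[ℝ] ℝ) p).baseSet := by
    rw [hom_trivializationAt_baseSet]
    exact ⟨mem_baseSet hy, by simp⟩
  ext a b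
  rw [g.inChart_apply, hom_trivializationAt_apply]
  simp [ContinuousLinearMap.inCoordinates, Trivialization.continuousLinearMapAt_apply,
    Trivialization.coe_linearMapAt_of_mem _ hb', hom_trivializationAt_apply, coordFrame]

end Charts

/-! ### The Levi-Civita connection in an arbitrary chart -/

section ChartConnection

variable {E : Type*} [NormedAddCommGroup E] [NormedSpace ℝ E] [FiniteDimensional ℝ E]
  {M : Type*} [TopologicalSpace M] [ChartedSpace E M] [IsManifold 𝓘(ℝ, E) ∞ M]
  (g : PseudoRiemannianMetric E M)

lemma smooth_locMet {p : M} {e : E} (he : e ∈ chartDom E p) : ContDiffAt ℝ ∞ (locMet g p) e :=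
  contDiffAt_comp_chartInv he (contMDiffAt_inChart g (chartInv_mem he))

lemma locMet_symm {p : M} {e : E} (a b : E) : locMet g p e a b = locMet g p e b a :=
  g.symm _ _ _

lemma locMet_nondegenerate {p : M} {e : E} (he : e ∈ chartDom E p) (a : E)
    (h : ∀ c, locMet g p e a c = 0) : a = 0 := by
  have h1 : coordFrame p (chartInv E p e) a = 0 := by
    refine g.nondegenerate _ _ fun w ↦ ?_
    rw [← locMet_coordComp g he, coordComp_coordFrame (chartInv_mem he)]
    exact h _
  rw [← coordComp_coordFrame (chartInv_mem he) a, h1, map_zero]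

/-- The Christoffel symbols of the metric in the chart around `p`. -/
def locConn (p : M) : E → E →L[ℝ] E →L[ℝ] E := localConn (locMet g p)

lemma smooth_locConn {p : M} {e : E} (he : e ∈ chartDom E p) : ContDiffAt ℝ ∞ (locConn g p) e :=
  contDiffAt_localConn (smooth_locMet g he) (locMet_nondegenerate g he)

lemma coordComp_surjective {p x : M} (hx : x ∈ (chartAt E p).source) :
    Function.Surjective (coordComp p x : TangentSpace 𝓘(ℝ, E) x → E) := fun a ↦ ⟨_, coordComp_coordFrame hx a⟩

lemma eventually_chartDom {p : M} {e : E} (he : e ∈ chartDom E p) :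
    ∀ᶠ y in 𝓝 e, y ∈ chartDom E p := (isOpen_chartDom p).mem_nhds he

/-- Points of the chart around `x` which are close to `x` lie in the chart around `p`. -/
lemma eventually_overlap {x p : M} {e : E} (he : e ∈ chartDom E x)
    (he' : chartInv E x e ∈ (chartAt E p).source) :
    ∀ᶠ y in 𝓝 e, y ∈ chartDom E x ∧ chartInv E x y ∈ (chartAt E p).source :=
  (eventually_chartDom he).and
    ((continuousAt_chartInv he).preimage_mem_nhds ((chartAt E p).open_source.mem_nhds he'))

lemma chartInv_transition {x p : M} {e : E} (he' : chartInv E x e ∈ (chartAt E p).source) :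
    chartInv E p (transition x p e) = chartInv E x e := chartInv_chart he'

lemma transition_mem {x p : M} {e : E} (he' : chartInv E x e ∈ (chartAt E p).source) :
    transition x p e ∈ chartDom E p := chart_mem he'

lemma coordComp_transition' {x p : M} {e : E} (he : e ∈ chartDom E x)
    (he' : chartInv E x e ∈ (chartAt E p).source) (u : TangentSpace 𝓘(ℝ, E) (chartInv E x e)) :
    coordComp p (chartInv E x e) u = fderiv ℝ (transition x p) e (coordComp x _ u) := by
  rw [coordComp_transition (chartInv_mem he) he', chart_chartInv he]

lemma locMet_transition {x p : M} {e : E} (he : e ∈ chartDom E x)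
    (he' : chartInv E x e ∈ (chartAt E p).source) (a b : E) :
    locMet g x e a b = locMet g p (transition x p e) (fderiv ℝ (transition x p) e a)
      (fderiv ℝ (transition x p) e b) := by
  obtain ⟨u, rfl⟩ := coordComp_surjective (chartInv_mem he) a
  obtain ⟨w, rfl⟩ := coordComp_surjective (chartInv_mem he) b
  rw [← coordComp_transition' he he', ← coordComp_transition' he he', locMet_coordComp g he]
  have h := locMet_coordComp g (p := p) (transition_mem he')
  rw [chartInv_transition he'] at h
  rw [h]

lemma locVec_transition (Y : (y : M) → TangentSpace 𝓘(ℝ, E) y) {x p : M} {e : E}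
    (he : e ∈ chartDom E x) (he' : chartInv E x e ∈ (chartAt E p).source) :
    locVec Y p (transition x p e) = fderiv ℝ (transition x p) e (locVec Y x e) := by
  rw [locVec_apply Y he, ← coordComp_transition' he he', locVec, chartInv_transition he',
    components_eq Y he']

lemma fderiv_locVec_transition {Y : (y : M) → TangentSpace 𝓘(ℝ, E) y} {x p : M} {e : E}
    (he : e ∈ chartDom E x) (he' : chartInv E x e ∈ (chartAt E p).source)
    (hYx : DifferentiableAt ℝ (locVec Y x) e)
    (hYp : DifferentiableAt ℝ (locVec Y p) (transition x p e)) (u : E) :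
    fderiv ℝ (locVec Y p) (transition x p e) (fderiv ℝ (transition x p) e u) =
      fderiv ℝ (fderiv ℝ (transition x p)) e u (locVec Y x e)
      + fderiv ℝ (transition x p) e (fderiv ℝ (locVec Y x) e u) := by
  have hτs := contDiffAt_transition he he'
  have d1 := hasDerivAt_line (hYp.comp e hτs.diffAt) u
  have d2 := (hasDerivAt_line (contDiffAt_fderiv hτs).diffAt u).clm_apply (hasDerivAt_line hYx u)
  have h2 := deriv_line_unique (a := locVec Y p ∘ transition x p)
    (b := fun y ↦ fderiv ℝ (transition x p) y (locVec Y x y)) d1 d2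
    ((eventually_overlap he he').mono fun y hy ↦ locVec_transition Y hy.1 hy.2)
  rw [fderiv_comp e hYp hτs.diffAt] at h2
  simpa using h2

/-- The Christoffel symbols in two charts. -/
lemma christoffel_transition {p x : M} (hx : x ∈ (chartAt E p).source)
    (u a : TangentSpace 𝓘(ℝ, E) x) :
    coordComp p x (g.christoffel x u a) =
      locConn g p (extChartAt 𝓘(ℝ, E) p x) (coordComp p x u) (coordComp p x a)
      + fderiv ℝ (fderiv ℝ (transition x p)) (extChartAt 𝓘(ℝ, E) x x) u a := by
  set e := extChartAt 𝓘(ℝ, E) x x with he_def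
  have he : e ∈ chartDom E x := chart_mem (mem_chart_source E x)
  have hex : chartInv E x e = x := chartInv_chart (mem_chart_source E x)
  have he' : chartInv E x e ∈ (chartAt E p).source := by rwa [hex]
  have hτ : transition x p e = extChartAt 𝓘(ℝ, E) p x := by rw [transition, hex]
  have hT (w : TangentSpace 𝓘(ℝ, E) x) :
      coordComp p x w = fderiv ℝ (transition x p) e w := by
    rw [coordComp_transition (mem_chart_source E x) hx, coordComp_self]
  -- In the chart centred at `x` the pointwise definition of the Christoffel symbols is the Koszul
  -- formula for `locMet g x`, so the transformation rule can be applied to the transition to the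
  -- chart around `p`.
  have hD : g.partialDeriv x = fderiv ℝ (locMet g x) e := by
    ext w : 1
    have := mvfderiv_eq (mem_chart_source E x)
      ((contMDiffAt_inChart g (mem_chart_source E x)).mdifferentiableAt (by simp)) w
    exact this.trans (congrArg _ (coordComp_self x w))
  have hdom := transition_mem he'
  have hloc (b z : E) : locMet g x e b z = g.val x b z := by
    rw [locMet, hex, g.inChart_apply, coordFrame_self, coordFrame_self]
  have key := connection_transform (G₁ := locMet g x) (G₂ := locMet g p)
    (contDiffAt_transition he he') (smooth_locMet g he).diffAt
    (smooth_locMet g hdom).diffAt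
    ((eventually_overlap he he').mono fun y hy a b ↦ locMet_transition g hy.1 hy.2 a b)
    (locMet_symm g) (locMet_nondegenerate g hdom)
    (fun b ↦ by
      obtain ⟨w, hw⟩ := coordComp_surjective hx b
      exact ⟨w, by rw [← hT, hw]⟩)
    (u := u) (a := a) (c₁ := g.christoffel x u a)
    (c₂ := locConn g p (transition x p e) (fderiv ℝ (transition x p) e u)
      (fderiv ℝ (transition x p) e a))
    (fun z ↦ by
      have h1 := g.val_christoffel x u a z
      rw [hD] at h1
      exact (hloc _ z).trans (h1.trans (firstKind_apply _ _ _ _).symm))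
    (fun z ↦ metric_localConn (locMet_nondegenerate g hdom) _ _ z)
  rw [hT, hT, hT, key, hτ]

/-- The Levi-Civita connection in the chart around `p`. -/
lemma coordComp_leviCivita {p x : M} (hx : x ∈ (chartAt E p).source)
    {Y : (y : M) → TangentSpace 𝓘(ℝ, E) y} (hY : VFDiffAt Y x) (u : TangentSpace 𝓘(ℝ, E) x) :
    coordComp p x (g.leviCivita Y x u) =
      fderiv ℝ (locVec Y p) (extChartAt 𝓘(ℝ, E) p x) (coordComp p x u)
      + locConn g p (extChartAt 𝓘(ℝ, E) p x) (coordComp p x u) (coordComp p x (Y x)) := by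
  set e := extChartAt 𝓘(ℝ, E) x x with he_def
  have he : e ∈ chartDom E x := chart_mem (mem_chart_source E x)
  have hex : chartInv E x e = x := chartInv_chart (mem_chart_source E x)
  have he' : chartInv E x e ∈ (chartAt E p).source := by rwa [hex]
  have hτ : transition x p e = extChartAt 𝓘(ℝ, E) p x := by rw [transition, hex]
  have hT (w : TangentSpace 𝓘(ℝ, E) x) :
      coordComp p x w = fderiv ℝ (transition x p) e w := by
    rw [coordComp_transition (mem_chart_source E x) hx, coordComp_self]
  have h0 : g.leviCivita Y x u = coordDeriv Y x u + g.christoffel x u (Y x) := rfl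
  have hYx := vfDiffAt_locVec (mem_chart_source E x) hY
  have h1 : coordDeriv Y x u = fderiv ℝ (locVec Y x) e u := by
    have := mvfderiv_eq (mem_chart_source E x) ((mdifferentiableAt_section _ Y).1 hY) u
    exact this.trans (congrArg _ (coordComp_self x u))
  have h2 := fderiv_locVec_transition he he' hYx (by rw [hτ]; exact vfDiffAt_locVec hx hY) u
  have h3 : locVec Y x e = Y x := by rw [locVec, hex, components_self]
  rw [h3, hτ] at h2
  rw [h0, map_add, christoffel_transition g hx, h1, hT (fderiv ℝ (locVec Y x) e u), hT u, h2]
  abel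

end ChartConnection

lemma eventually_differentiableAt {V W : Type*} [NormedAddCommGroup V] [NormedSpace ℝ V]
    [NormedAddCommGroup W] [NormedSpace ℝ W] {f : V → W} {e : V} (hf : ContDiffAt ℝ ∞ f e) :
    ∀ᶠ y in 𝓝 e, DifferentiableAt ℝ f y :=
  ((hf.of_le (m := 1) (by exact_mod_cast le_top)).eventually (by simp)).mono
    fun _ h ↦ h.differentiableAt one_ne_zero

/-! ### Traces and the main equation -/

section Trace

variable {V : Type*} [NormedAddCommGroup V] [NormedSpace ℝ V] [FiniteDimensional ℝ V]

variable (V) in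
/-- The trace as a continuous linear map. -/
def traceL : (V →L[ℝ] V) →L[ℝ] ℝ :=
  LinearMap.toContinuousLinearMap (LinearMap.trace ℝ V ∘ₗ ContinuousLinearMap.coeLM ℝ)

lemma traceL_apply (A : V →L[ℝ] V) : traceL V A = LinearMap.trace ℝ V A.toLinearMap := rfl

lemma traceL_comp_comm (A B : V →L[ℝ] V) : traceL V (A ∘L B) = traceL V (B ∘L A) :=
  LinearMap.trace_mul_comm ℝ A.toLinearMap B.toLinearMap

lemma traceL_smulRight (f : V →L[ℝ] ℝ) (a : V) : traceL V (f.smulRight a) = f a := by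
  rw [traceL_apply]
  exact LinearMap.trace_smulRight f.toLinearMap a

lemma traceL_id : traceL V (ContinuousLinearMap.id ℝ V) = Module.finrank ℝ V :=
  LinearMap.trace_id ℝ V

/-- The trace of `C` composed with the right hand side of the main equation. -/
lemma traceL_comp_mainRHS {g : V →L[ℝ] V →L[ℝ] ℝ} {J C T : V →L[ℝ] V} {l u : V}
    (hs : ∀ a b, g a b = g b a) (hJ : ∀ a b, g (J a) (J b) = g a b)
    (hC : ∀ a b, g (C a) b = g a (C b)) (hCJ : ∀ a, C (J a) = J (C a))
    (hT : ∀ y, T y = mainRHS g J l u y) : traceL V (C ∘L T) = 4 * g (C l) u := by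
  have e : C ∘L T = (g u).smulRight (C l) + (g l).smulRight (C u)
      + (g (J u)).smulRight (C (J l)) + (g (J l)).smulRight (C (J u)) := by
    ext y
    simp [hT, mainRHS]
  rw [e]
  simp only [map_add, traceL_smulRight, hCJ, hJ, hs u, ← hC]
  ring

/-- Covariant and ordinary derivatives of `A` differ by a commutator, which has trace zero. -/
lemma fderiv_trace {Γ : V → V →L[ℝ] V →L[ℝ] V} {A : V → V →L[ℝ] V} {e : V}
    (hA : DifferentiableAt ℝ A e) (u : V) :
    fderiv ℝ (fun y ↦ traceL V (A y)) e u = traceL V (covEnd Γ A e u) := by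
  rw [covEnd, map_add, map_sub, traceL_comp_comm (A e), sub_self, add_zero]
  have := (traceL V).hasFDerivAt.comp e hA.hasFDerivAt
  exact congrArg (fun L : V →L[ℝ] ℝ ↦ L u) this.fderiv

/-- The vector field in the main equation is determined by the trace. -/
lemma fderiv_trace_of_mainRHS {G : V → V →L[ℝ] V →L[ℝ] ℝ} {Γ : V → V →L[ℝ] V →L[ℝ] V}
    {J A : V → V →L[ℝ] V} {Ω : Set V} {e l : V} (h : IsLocalKahler Ω G Γ J) (he : e ∈ Ω)
    (hA : DifferentiableAt ℝ A e) (u : V)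
    (hm : ∀ y, covEnd Γ A e u y = mainRHS (G e) (J e) l u y) :
    fderiv ℝ (fun y ↦ traceL V (A y)) e u = 4 * G e l u := by
  rw [fderiv_trace (Γ := Γ) hA]
  exact traceL_comp_mainRHS (C := ContinuousLinearMap.id ℝ V) (h.symm e he) (h.invariant e he)
    (fun _ _ ↦ rfl) (fun _ ↦ rfl) hm

end Trace

/-! ### Kähler structures and solutions of the main equation in charts -/

section ChartTensors

variable {E : Type*} [NormedAddCommGroup E] [NormedSpace ℝ E] [FiniteDimensional ℝ E]
  {M : Type*} [TopologicalSpace M] [ChartedSpace E M] [IsManifold 𝓘(ℝ, E) ∞ M]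

lemma smooth_locVec (Y : SmoothVectorField E M) {p : M} {e : E} (he : e ∈ chartDom E p) :
    ContDiffAt ℝ ∞ (locVec (fun y ↦ Y y) p) e := by
  have := (contMDiffAt_iff_locVec (chartInv_mem he)).1 (Y.contMDiff (chartInv E p e))
  rwa [chart_chartInv he] at this

lemma smooth_locEnd (A : EndField E M) {p : M} {e : E} (he : e ∈ chartDom E p) :
    ContDiffAt ℝ ∞ (locEnd (fun y ↦ A y) p) e := by
  have := (contMDiffAt_iff_locEnd (chartInv_mem he)).1 (A.contMDiff (chartInv E p e))
  rwa [chart_chartInv he] at this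

/-- The vector field with constant components in the chart around `p`. -/
def constVec (p : M) (a : E) (y : M) : TangentSpace 𝓘(ℝ, E) y := coordFrame p y a

lemma locVec_constVec {p : M} (a : E) {e : E} (he : e ∈ chartDom E p) :
    locVec (constVec p a) p e = a := by
  rw [locVec_apply _ he, constVec, coordComp_coordFrame (chartInv_mem he)]

lemma vfDiffAt_constVec {p x : M} (hx : x ∈ (chartAt E p).source) (a : E) :
    VFDiffAt (constVec p a) x := by
  apply vfDiffAt_of_locVec hx
  refine (differentiableAt_const a).congr_of_eventuallyEq ?_
  filter_upwards [eventually_chartDom (chart_mem hx)] with y hy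
  exact locVec_constVec a hy

lemma locVec_endField_apply (A : (y : M) → TangentSpace 𝓘(ℝ, E) y →L[ℝ] TangentSpace 𝓘(ℝ, E) y)
    (Y : (y : M) → TangentSpace 𝓘(ℝ, E) y) {p : M} {e : E} (he : e ∈ chartDom E p) :
    locVec (fun y ↦ A y (Y y)) p e = locEnd A p e (locVec Y p e) := by
  rw [locVec_apply _ he, locVec_apply _ he, locEnd_apply _ _ he]

variable (g : PseudoRiemannianMetric E M)

/-- The covariant derivative of an endomorphism field in the chart around `p`. -/
lemma coordComp_covEnd (A : EndField E M) {p x : M} (hx : x ∈ (chartAt E p).source)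
    {Y : (y : M) → TangentSpace 𝓘(ℝ, E) y} (hY : VFDiffAt Y x) (u : TangentSpace 𝓘(ℝ, E) x) :
    coordComp p x (g.leviCivita (fun y ↦ A y (Y y)) x u - A x (g.leviCivita Y x u)) =
      covEnd (locConn g p) (locEnd (fun y ↦ A y) p) (extChartAt 𝓘(ℝ, E) p x) (coordComp p x u)
        (coordComp p x (Y x)) := by
  have hl (w : TangentSpace 𝓘(ℝ, E) x) : coordComp p x (A x w) =
      locEnd (fun y ↦ A y) p (extChartAt 𝓘(ℝ, E) p x) (coordComp p x w) := by
    have := locEnd_apply (fun y ↦ A y) p (chart_mem hx)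
    rw [chartInv_chart hx] at this
    exact (this w).symm
  have hd := chart_mem hx
  have hA := smooth_locEnd A hd
  have hYp := vfDiffAt_locVec hx hY
  have hlY : locVec Y p (extChartAt 𝓘(ℝ, E) p x) = coordComp p x (Y x) := by
    have := locVec_apply Y (chart_mem hx)
    rwa [chartInv_chart hx] at this
  have h1 : fderiv ℝ (locVec (fun y ↦ A y (Y y)) p) (extChartAt 𝓘(ℝ, E) p x) (coordComp p x u) =
      fderiv ℝ (locEnd (fun y ↦ A y) p) (extChartAt 𝓘(ℝ, E) p x) (coordComp p x u)
        (coordComp p x (Y x)) + locEnd (fun y ↦ A y) p (extChartAt 𝓘(ℝ, E) p x)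
        (fderiv ℝ (locVec Y p) (extChartAt 𝓘(ℝ, E) p x) (coordComp p x u)) := by
    have e1 : locVec (fun y ↦ A y (Y y)) p =ᶠ[𝓝 (extChartAt 𝓘(ℝ, E) p x)]
        fun e ↦ locEnd (fun y ↦ A y) p e (locVec Y p e) := by
      filter_upwards [eventually_chartDom hd] with y hy
      exact locVec_endField_apply _ _ hy
    rw [e1.fderiv_eq, fderiv_clm_apply hA.diffAt hYp, hlY]
    simp [add_comm]
  rw [map_sub, hl, coordComp_leviCivita g hx (hY.endField_apply A), coordComp_leviCivita g hx hY,
    h1, hl]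
  simp only [covEnd, add_apply, sub_apply, ContinuousLinearMap.comp_apply, map_add]
  abel

variable {g} {J : EndField E M}

/-- A Kähler structure in the chart around `p`. -/
lemma IsKahler.isLocalKahler (h : IsKahler g J) (p : M) :
    IsLocalKahler (chartDom E p) (locMet g p) (locConn g p) (locEnd (fun y ↦ J y) p) where
  isOpen := isOpen_chartDom p
  smooth_metric _ he := smooth_locMet g he
  smooth_conn _ he := smooth_locConn g he
  smooth_J _ he := smooth_locEnd J he
  symm _ _ := locMet_symm g
  nondegenerate _ he := locMet_nondegenerate g he
  torsionFree _ he := localConn_symm (smooth_locMet g he).diffAt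
    (Filter.Eventually.of_forall fun _ ↦ locMet_symm g)
  metric _ he := localConn_metric (smooth_locMet g he).diffAt
    (Filter.Eventually.of_forall fun _ ↦ locMet_symm g) (locMet_nondegenerate g he)
  sq e he a := by
    obtain ⟨w, rfl⟩ := coordComp_surjective (chartInv_mem he) a
    rw [locEnd_apply _ _ he, locEnd_apply _ _ he, h.sq, map_neg]
  invariant e he a b := by
    obtain ⟨w, rfl⟩ := coordComp_surjective (chartInv_mem he) a
    obtain ⟨w', rfl⟩ := coordComp_surjective (chartInv_mem he) b
    rw [locEnd_apply _ _ he, locEnd_apply _ _ he, locMet_coordComp g he, locMet_coordComp g he,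
      h.invariant]
  parallel e he u a := by
    have hx := chartInv_mem he
    obtain ⟨w, rfl⟩ := coordComp_surjective hx u
    have h1 := coordComp_covEnd g J hx (vfDiffAt_constVec hx a) w
    rw [h.parallel _ _ (vfDiffAt_constVec hx a), sub_self, map_zero, chart_chartInv he, constVec,
      coordComp_coordFrame hx] at h1
    exact h1.symm

lemma traceField_eq (A : EndField E M) {p : M} {e : E} (he : e ∈ chartDom E p) :
    traceField A (chartInv E p e) = traceL E (locEnd (fun y ↦ A y) p e) := by
  let f : TangentSpace 𝓘(ℝ, E) (chartInv E p e) ≃ₗ[ℝ] E :=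
    LinearEquiv.ofLinearMap (coordComp p (chartInv E p e)).toLinearMap
      (coordFrame p (chartInv E p e)).toLinearMap
      (LinearMap.ext fun a ↦ coordComp_coordFrame (chartInv_mem he) a)
      (LinearMap.ext fun a ↦ coordFrame_coordComp (chartInv_mem he) a)
  exact (LinearMap.trace_conj' (A (chartInv E p e)).toLinearMap f).symm

lemma locMet_lambda (A : EndField E M) {p : M} {e : E} (he : e ∈ chartDom E p) (w : E) :
    locMet g p e (locVec (lambdaField g A) p e) w =
      1 / 4 * fderiv ℝ (fun y ↦ traceL E (locEnd (fun y ↦ A y) p y)) e w := by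
  have hx := chartInv_mem he
  obtain ⟨u, rfl⟩ := coordComp_surjective hx w
  rw [locVec_apply _ he, locMet_coordComp g he, lambdaField, map_smul, smul_apply,
    PseudoRiemannianMetric.grad, g.val_flat_symm]
  have h1 : mvfderiv 𝓘(ℝ, E) (traceField A) (chartInv E p e) u = _ :=
    mvfderiv_eq hx (traceField_mdifferentiableAt A _) u
  rw [chart_chartInv he] at h1
  have h2 : (fun y ↦ traceField A (chartInv E p y)) =ᶠ[𝓝 e]
      fun y ↦ traceL E (locEnd (fun y ↦ A y) p y) := by
    filter_upwards [eventually_chartDom he] with y hy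
    exact traceField_eq A hy
  rw [h2.fderiv_eq] at h1
  rw [← h1]
  rfl

lemma inverse_apply {V : Type*} [NormedAddCommGroup V] [NormedSpace ℝ V] [FiniteDimensional ℝ V]
    {b : V →L[ℝ] V →L[ℝ] ℝ} (hn : ∀ a, (∀ c, b a c = 0) → a = 0) (a : V) :
    b.inverse (b a) = a := by
  obtain ⟨E, rfl⟩ := exists_equiv_of_nondegenerate hn
  rw [ContinuousLinearMap.inverse_equiv]
  simp

/-- In a chart, `Λ` is the inverse metric applied to a quarter of the differential of the smooth
function `tr A`. -/
lemma smooth_lambda (A : EndField E M) {p : M} {e : E} (he : e ∈ chartDom E p) :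
    ContDiffAt ℝ ∞ (locVec (lambdaField g A) p) e := by
  have h1 : ContDiffAt ℝ ∞ (fun y ↦ traceL E (locEnd (fun y ↦ A y) p y)) e :=
    (traceL E).contDiff.contDiffAt.comp e (smooth_locEnd A he)
  have h2 := (contDiffAt_inverse_metric (smooth_locMet g he) (locMet_nondegenerate g he)).clm_apply
    ((contDiffAt_fderiv h1).const_smul (1 / 4 : ℝ))
  refine h2.congr_of_eventuallyEq ?_
  filter_upwards [eventually_chartDom he] with y hy
  rw [← inverse_apply (locMet_nondegenerate g hy) (locVec (lambdaField g A) p y)]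
  congr 1
  ext w
  rw [locMet_lambda A hy]
  rfl

/-- Solutions of the main equation in the chart around `p`. -/
lemma covEnd_of_mainEquation {A : EndField E M} (hA : MainEquation g J A) {p : M} {e : E}
    (he : e ∈ chartDom E p) (u a : E) :
    covEnd (locConn g p) (locEnd (fun y ↦ A y) p) e u a =
      mainRHS (locMet g p e) (locEnd (fun y ↦ J y) p e) (locVec (lambdaField g A) p e) u a := by
  have hx := chartInv_mem he
  obtain ⟨w, rfl⟩ := coordComp_surjective hx u
  have h1 := coordComp_covEnd g A hx (vfDiffAt_constVec hx a) w
  rw [hA _ _ (vfDiffAt_constVec hx a), chart_chartInv he, constVec, coordComp_coordFrame hx] at h1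
  have ha : a = coordComp p (chartInv E p e) (coordFrame p (chartInv E p e) a) :=
    (coordComp_coordFrame hx a).symm
  rw [← h1]
  conv_rhs => rw [ha]
  simp only [mainRHS, locVec_apply _ he, locEnd_apply _ _ he, locMet_coordComp g he, map_add,
    map_smul]

/-- A solution of the main equation in charts, for any vector field, is a solution. -/
lemma mainEquation_of_covEnd (hK : IsKahler g J) {A : EndField E M}
    (hA : ∀ x : M, ∃ l : E, ∀ u a : E,
      covEnd (locConn g x) (locEnd (fun y ↦ A y) x) (extChartAt 𝓘(ℝ, E) x x) u a =
      mainRHS (locMet g x (extChartAt 𝓘(ℝ, E) x x))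
        (locEnd (fun y ↦ J y) x (extChartAt 𝓘(ℝ, E) x x)) l u a) :
    MainEquation g J A := by
  intro x Y hY u
  obtain ⟨l, hl⟩ := hA x
  have hx := mem_chart_source E x
  have he : extChartAt 𝓘(ℝ, E) x x ∈ chartDom E x := chart_mem hx
  -- Taking the trace of the equation shows that `l` can only be a quarter of the gradient of `tr
  -- A`.
  have hll : l = locVec (lambdaField g A) x (extChartAt 𝓘(ℝ, E) x x) := by
    refine (hK.isLocalKahler x).ext_of_metric he fun c ↦ ?_
    have := fderiv_trace_of_mainRHS (hK.isLocalKahler x) he (smooth_locEnd A he).diffAt c (hl c)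
    rw [locMet_lambda A he, this]; ring
  have h1 := coordComp_covEnd g A hx hY u
  rw [hl, hll] at h1
  have hcx := chartInv_chart (E := E) hx
  have hinj : Function.Injective (coordComp x x : TangentSpace 𝓘(ℝ, E) x → E) := fun a b hab ↦ by
    rwa [coordComp_self, coordComp_self] at hab
  apply hinj
  rw [h1]
  have e1 := locVec_apply (lambdaField g A) he
  have e2 := locEnd_apply (fun y ↦ J y) x he
  have e3 := locMet_coordComp g he
  rw [hcx] at e1 e2 e3
  simp only [mainRHS, e1, e2, e3, map_add, map_smul]

end ChartTensors

/-! ### Velocity and acceleration of curves in charts -/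

section Curves

variable {E : Type*} [NormedAddCommGroup E] [NormedSpace ℝ E] [FiniteDimensional ℝ E]
  {M : Type*} [TopologicalSpace M] [ChartedSpace E M] [IsManifold 𝓘(ℝ, E) ∞ M]
  (g : PseudoRiemannianMetric E M)

lemma smooth_chart_curve {γ : ℝ → M} {t : ℝ} {p : M} (hγ : ContMDiffAt 𝓘(ℝ, ℝ) 𝓘(ℝ, E) ∞ γ t)
    (hp : γ t ∈ (chartAt E p).source) :
    ContDiffAt ℝ ∞ (fun s ↦ extChartAt 𝓘(ℝ, E) p (γ s)) t :=
  ((contMDiffAt_extChartAt' hp).comp t hγ).contDiffAt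

lemma coordComp_velocity {γ : ℝ → M} {t : ℝ} {p : M} (hγ : ContMDiffAt 𝓘(ℝ, ℝ) 𝓘(ℝ, E) ∞ γ t)
    (hp : γ t ∈ (chartAt E p).source) :
    coordComp p (γ t) (velocity γ t) = deriv (fun s ↦ extChartAt 𝓘(ℝ, E) p (γ s)) t := by
  have h := mfderiv_comp t (mdifferentiableAt_chart hp) (hγ.mdifferentiableAt (by simp))
  rw [mfderiv_eq_fderiv] at h
  rw [coordComp_eq_mfderiv hp, velocity]
  exact (congrArg (fun L : ℝ →L[ℝ] E ↦ L 1) h).symm.trans fderiv_apply_one_eq_deriv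

/-- The acceleration of a curve in the chart around `p`. -/
lemma coordComp_acceleration {γ : ℝ → M} {t : ℝ} {p : M}
    (hγ : ContMDiffAt 𝓘(ℝ, ℝ) 𝓘(ℝ, E) ∞ γ t) (hp : γ t ∈ (chartAt E p).source) :
    coordComp p (γ t) (acceleration g γ t) =
      deriv (deriv fun s ↦ extChartAt 𝓘(ℝ, E) p (γ s)) t
      + locConn g p (extChartAt 𝓘(ℝ, E) p (γ t)) (deriv (fun s ↦ extChartAt 𝓘(ℝ, E) p (γ s)) t)
        (deriv (fun s ↦ extChartAt 𝓘(ℝ, E) p (γ s)) t) := by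
  set x := γ t with hx_def
  have hx := mem_chart_source E x
  set e := extChartAt 𝓘(ℝ, E) x x with he_def
  have he : e ∈ chartDom E x := chart_mem hx
  have hex : chartInv E x e = x := chartInv_chart hx
  have he' : chartInv E x e ∈ (chartAt E p).source := by rwa [hex]
  have hT (w : TangentSpace 𝓘(ℝ, E) x) :
      coordComp p x w = fderiv ℝ (transition x p) e w := by
    rw [coordComp_transition hx hp, coordComp_self]
  set c := fun s ↦ extChartAt 𝓘(ℝ, E) p (γ s) with hc
  set d := fun s ↦ extChartAt 𝓘(ℝ, E) x (γ s) with hd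
  have hde : d t = e := rfl
  have hds : ContDiffAt ℝ ∞ d t := smooth_chart_curve hγ hx
  have hd1 : ContDiffAt ℝ ∞ (deriv d) t := by
    have := (contDiffAt_fderiv hds).clm_apply (contDiffAt_const (c := (1 : ℝ)))
    exact this
  have hcd : c =ᶠ[𝓝 t] transition x p ∘ d := by
    have := hγ.continuousAt.eventually (eventually_chartInv_chart (E := E) hx)
    filter_upwards [this] with s hs
    simp only [hc, hd, Function.comp_apply, transition, hs]
  have hτ := contDiffAt_transition he he'
  have hc1 : deriv c =ᶠ[𝓝 t] fun s ↦ fderiv ℝ (transition x p) (d s) (deriv d s) := by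
    have h1 : ∀ᶠ s in 𝓝 t, DifferentiableAt ℝ d s :=
      eventually_differentiableAt hds
    have h2 : ∀ᶠ s in 𝓝 t, DifferentiableAt ℝ (transition x p) (d s) :=
      hds.continuousAt.eventually (eventually_differentiableAt hτ)
    filter_upwards [hcd.eventuallyEq_nhds, h1, h2] with s hs h1 h2
    rw [hs.deriv_eq]
    exact (h2.hasFDerivAt.comp_hasDerivAt s h1.hasDerivAt).deriv
  have hc2 : deriv (deriv c) t = fderiv ℝ (fderiv ℝ (transition x p)) e (deriv d t) (deriv d t)
      + fderiv ℝ (transition x p) e (deriv (deriv d) t) := by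
    rw [hc1.deriv_eq]
    have hf : HasFDerivAt (fderiv ℝ (transition x p)) (fderiv ℝ (fderiv ℝ (transition x p)) e)
      (d t) := (contDiffAt_fderiv hτ).diffAt.hasFDerivAt
    exact ((hf.comp_hasDerivAt t hds.diffAt.hasDerivAt).clm_apply hd1.diffAt.hasDerivAt).deriv
  have hv : velocity γ t = deriv d t := by
    have := coordComp_velocity hγ hx
    rwa [coordComp_self] at this
  have hvp : coordComp p x (velocity γ t) = deriv c t := coordComp_velocity hγ hp
  have h0 : coordSecondDeriv (E := E) γ t = deriv (deriv d) t := by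
    rw [coordSecondDeriv, iteratedDeriv_succ, iteratedDeriv_one]
  have ha : acceleration g γ t = (show TangentSpace 𝓘(ℝ, E) x from coordSecondDeriv (E := E) γ t)
    + g.christoffel x (velocity γ t) (velocity γ t) := rfl
  rw [ha, map_add, christoffel_transition g hp, hvp, hT, hc2]
  have h3 : (fderiv ℝ (transition x p) e) (show TangentSpace 𝓘(ℝ, E) x from
    coordSecondDeriv (E := E) γ t) = fderiv ℝ (transition x p) e (deriv (deriv d) t) := by
    rw [← h0]
  have h4 : fderiv ℝ (fderiv ℝ (transition x p)) e (velocity γ t) (velocity γ t) =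
      fderiv ℝ (fderiv ℝ (transition x p)) e (deriv d t) (deriv d t) := by rw [← hv]
  rw [h3, h4]
  abel

end Curves

/-! ### Differentiating along a flow -/

section FlowCalculus

variable {V W : Type*} [NormedAddCommGroup V] [NormedSpace ℝ V]
  [NormedAddCommGroup W] [NormedSpace ℝ W]

/-- If `w t` lies in the span of `a t` and `b t`, then so does its derivative, up to the
derivatives of `a` and `b`. -/
lemma deriv_mem_span [FiniteDimensional ℝ V] {w a b : ℝ → V} {w' a' b' : V}
    (hw : HasDerivAt w w' 0) (ha : HasDerivAt a a' 0) (hb : HasDerivAt b b' 0)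
    (h : ∀ᶠ t in 𝓝 0, ∃ r s : ℝ, w t = r • a t + s • b t)
    (hab : LinearIndependent ℝ ![a 0, b 0]) {r s : ℝ} (h0 : w 0 = r • a 0 + s • b 0) :
    ∃ p q : ℝ, w' - r • a' - s • b' = p • a 0 + q • b 0 := by
  by_contra hcon
  have hmem : w' - r • a' - s • b' ∉ Submodule.span ℝ {a 0, b 0} := by
    rw [Submodule.mem_span_pair]
    rintro ⟨p, q, hpq⟩
    exact hcon ⟨p, q, hpq.symm⟩
  obtain ⟨f, hf, hfk⟩ := Submodule.exists_le_ker_of_notMem hmem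
  have hfa : f (a 0) = 0 := hfk (Submodule.subset_span (by simp))
  have hfb : f (b 0) = 0 := hfk (Submodule.subset_span (by simp))
  have hex : ∀ x y : V, LinearIndependent ℝ ![x, y] → ∃ k : V →ₗ[ℝ] ℝ, k x ≠ 0 ∧ k y = 0 := by
    intro x y hxy
    have hx : x ∉ Submodule.span ℝ {y} := by
      rw [Submodule.mem_span_singleton]
      rintro ⟨c, hc⟩
      have := LinearIndependent.pair_iff.1 hxy 1 (-c) (by rw [← hc]; module)
      exact one_ne_zero this.1
    obtain ⟨k, hk, hk'⟩ := Submodule.exists_le_ker_of_notMem hx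
    exact ⟨k, hk, hk' (Submodule.subset_span rfl)⟩
  obtain ⟨k₁, h1a, h1b⟩ := hex _ _ hab
  obtain ⟨k₂, h2b, h2a⟩ := hex (b 0) (a 0) (LinearIndependent.pair_symm_iff.1 hab)
  have hd (k : V →ₗ[ℝ] ℝ) {c : ℝ → V} {c' : V} (hc : HasDerivAt c c' 0) :
      HasDerivAt (fun t ↦ k (c t)) (k c') 0 :=
    (LinearMap.toContinuousLinearMap k).hasFDerivAt.comp_hasDerivAt 0 hc
  -- The part of `w` beyond its initial combination: it vanishes at time zero and stays in the span
  -- of `a t` and `b t`.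
  set u : ℝ → V := fun t ↦ w t - r • a t - s • b t with hu
  have hud : HasDerivAt u (w' - r • a' - s • b') 0 :=
    (hw.sub (ha.const_smul r)).sub (hb.const_smul s)
  have hu0 : u 0 = 0 := by simp [hu, h0]
  -- The derivative of the `3 × 3` determinant of `k₁, k₂, f` on `a, b, u`. The determinant vanishes
  -- for small `t` because of the linear dependence, whereas its derivative at zero is `k₁ (a 0) *
  -- k₂ (b 0) * f (u' 0)`, a product of nonzero numbers.
  have hdet := (((hd k₁ ha).mul (((hd k₂ hb).mul (hd f hud)).sub ((hd k₂ hud).mul (hd f hb)))).sub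
    ((hd k₁ hb).mul (((hd k₂ ha).mul (hd f hud)).sub ((hd k₂ hud).mul (hd f ha))))).add
    ((hd k₁ hud).mul (((hd k₂ ha).mul (hd f hb)).sub ((hd k₂ hb).mul (hd f ha))))
  have hz := hdet.unique ((hasDerivAt_const (0 : ℝ) (0 : ℝ)).congr_of_eventuallyEq (by
    filter_upwards [h] with t ht
    obtain ⟨r', s', hrs⟩ := ht
    have : u t = (r' - r) • a t + (s' - s) • b t := by simp only [hu, hrs]; module
    simp only [Pi.add_apply, Pi.sub_apply, Pi.mul_apply, this, map_add, map_smul, smul_eq_mul]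
    ring))
  simp only [Pi.sub_apply, Pi.mul_apply, hu0, map_zero, hfa, hfb, h1b, h2a, zero_mul, mul_zero,
    add_zero, sub_zero, zero_add] at hz
  exact mul_ne_zero h1a (mul_ne_zero h2b hf) hz

/-- The directional derivative along a constant vector. -/
def dirD (w : V) (f : V → W) (z : V) : W := fderiv ℝ f z w

lemma smooth_dirD {f : V → W} {z : V} (hf : ContDiffAt ℝ ∞ f z) (w : V) :
    ContDiffAt ℝ ∞ (dirD w f) z := (contDiffAt_fderiv hf).clm_apply contDiffAt_const

lemma dirD_dirD {f : V → W} {z : V} (hf : ContDiffAt ℝ ∞ f z) (u w : V) :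
    dirD u (dirD w f) z = fderiv ℝ (fderiv ℝ f) z u w := by
  have := fderiv_clm_apply (contDiffAt_fderiv hf).diffAt (differentiableAt_const (x := z) w)
  unfold dirD
  rw [this]
  simp

lemma dirD_comm {f : V → W} {z : V} (hf : ContDiffAt ℝ ∞ f z) (u w : V) :
    dirD u (dirD w f) z = dirD w (dirD u f) z := by
  rw [dirD_dirD hf, dirD_dirD hf, fderiv_fderiv_comm hf]

lemma dirD_congr {f k : V → W} {z : V} (h : f =ᶠ[𝓝 z] k) (w : V) :
    dirD w f =ᶠ[𝓝 z] dirD w k :=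
  (h.fderiv (𝕜 := ℝ)).mono fun y hy ↦ by simp only [dirD, hy]

/-- The difference tensor of the connection and its pull back under `F (t, ·)`, composed with the
derivative of `F (t, ·)`. -/
def flowTensor (Γ : V → V →L[ℝ] V →L[ℝ] V) (F : ℝ × V → V) (x y : V) (z : ℝ × V) : V :=
  dirD (0, x) (dirD (0, y) F) z + Γ (F z) (dirD (0, x) F z) (dirD (0, y) F z)
    - fderiv ℝ F z (0, Γ z.2 x y)

variable {Γ : V → V →L[ℝ] V →L[ℝ] V} {v : V → V} {F : ℝ × V → V} {z : ℝ × V}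

/-- The variational equation: space and time derivatives are interchanged and the flow equation is
differentiated in space. -/
lemma dirD_flow (hF : ContDiffAt ℝ ∞ F z) (hv : ContDiffAt ℝ ∞ v (F z))
    (hflow : ∀ᶠ y in 𝓝 z, dirD (1, 0) F y = v (F y)) (w : V) :
    dirD (1, 0) (dirD (0, w) F) z = fderiv ℝ v (F z) (dirD (0, w) F z) := by
  rw [dirD_comm hF, (dirD_congr (k := v ∘ F) hflow _).self_of_nhds, dirD,
    fderiv_comp z hv.diffAt hF.diffAt]
  rfl

lemma dirD_dirD_flow (hF : ∀ᶠ y in 𝓝 z, ContDiffAt ℝ ∞ F y)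
    (hv : ∀ᶠ y in 𝓝 z, ContDiffAt ℝ ∞ v (F y))
    (hflow : ∀ᶠ y in 𝓝 z, dirD (1, 0) F y = v (F y)) (x y : V) :
    dirD (1, 0) (dirD (0, x) (dirD (0, y) F)) z =
      fderiv ℝ (fderiv ℝ v) (F z) (dirD (0, x) F z) (dirD (0, y) F z)
      + fderiv ℝ v (F z) (dirD (0, x) (dirD (0, y) F) z) := by
  have hFz := hF.self_of_nhds
  have hvz := hv.self_of_nhds
  rw [dirD_comm (smooth_dirD hFz _)]
  have h1 : dirD (1, 0) (dirD (0, y) F) =ᶠ[𝓝 z]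
      fun z' ↦ fderiv ℝ v (F z') (dirD (0, y) F z') := by
    filter_upwards [hF, hv, hflow.eventually_nhds] with z' a b c
    exact dirD_flow a b c y
  rw [(dirD_congr h1 _).self_of_nhds]
  have h2 := (((contDiffAt_fderiv hvz).diffAt.hasFDerivAt.comp z hFz.diffAt.hasFDerivAt).clm_apply
    (smooth_dirD hFz (0, y)).diffAt.hasFDerivAt).fderiv
  simp only [Function.comp_apply] at h2
  rw [dirD, h2]
  simp only [add_apply, ContinuousLinearMap.comp_apply, ContinuousLinearMap.flip_apply, dirD]
  abel

/-- The evolution of `flowTensor` along the flow. -/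
lemma hasDerivAt_flowTensor (hF : ∀ᶠ y in 𝓝 z, ContDiffAt ℝ ∞ F y)
    (hv : ∀ᶠ y in 𝓝 z, ContDiffAt ℝ ∞ v (F y)) (hΓ : ContDiffAt ℝ ∞ Γ (F z))
    (hflow : ∀ᶠ y in 𝓝 z, dirD (1, 0) F y = v (F y)) (x y : V) :
    HasDerivAt (fun t : ℝ ↦ flowTensor Γ F x y (z + t • (1, 0)))
      (lieConn v Γ (F z) (dirD (0, x) F z) (dirD (0, y) F z)
        + fderiv ℝ v (F z) (flowTensor Γ F x y z)) 0 := by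
  have hFz := hF.self_of_nhds
  have hvz := hv.self_of_nhds
  have hw : (1, 0) = ((1 : ℝ), (0 : V)) := rfl
  have d1 := hasDerivAt_line (smooth_dirD (smooth_dirD hFz (0, y)) (0, x)).diffAt (1, 0)
  have d2 := hasDerivAt_line (hΓ.comp z hFz).diffAt ((1 : ℝ), (0 : V))
  have dx := hasDerivAt_line (smooth_dirD hFz (0, x)).diffAt (1, 0)
  have dy := hasDerivAt_line (smooth_dirD hFz (0, y)).diffAt (1, 0)
  have d3 := hasDerivAt_line (smooth_dirD hFz (0, Γ z.2 x y)).diffAt (1, 0)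
  have hd := (d1.add ((d2.clm_apply dx).clm_apply dy)).sub d3
  have e1 (w : V) : fderiv ℝ (dirD (0, w) F) z (1, 0) = _ := dirD_flow hFz hvz hflow w
  have e2 : fderiv ℝ (dirD (0, x) (dirD (0, y) F)) z (1, 0) = _ := dirD_dirD_flow hF hv hflow x y
  have e3 : fderiv ℝ (Γ ∘ F) z (1, 0) = fderiv ℝ Γ (F z) (v (F z)) := by
    rw [fderiv_comp z hΓ.diffAt hFz.diffAt, ← hflow.self_of_nhds]
    rfl
  refine (hd.congr_deriv ?_).congr_of_eventuallyEq (Filter.Eventually.of_forall fun t ↦ ?_)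
  · rw [e1, e1, e1, e2, e3]
    simp only [zero_smul, add_zero, Function.comp_apply, lieConn, flowTensor, map_add, map_sub,
      add_apply]
    simp only [dirD]
    abel
  · simp [flowTensor, dirD]

end FlowCalculus

/-! ### Smooth solutions of ordinary differential equations -/

section ODE

variable {V : Type*} [NormedAddCommGroup V] [NormedSpace ℝ V] [CompleteSpace V]

/-- Bootstrapping: if `α` is of class `C^n`, so is its derivative `f ∘ α`, and `α` is of class
`C^(n+1)`. -/
lemma contDiffOn_of_ode {f : V → V} {Ω : Set V} {I : Set ℝ} {α : ℝ → V} (hI : IsOpen I)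
    (hf : ∀ y ∈ Ω, ContDiffAt ℝ ∞ f y) (hα : ∀ t ∈ I, α t ∈ Ω ∧ HasDerivAt α (f (α t)) t) :
    ContDiffOn ℝ ∞ α I := by
  rw [contDiffOn_infty]
  intro n
  induction n with
  | zero => exact contDiffOn_zero.2 fun t ht ↦ (hα t ht).2.continuousAt.continuousWithinAt
  | succ n ih =>
    push_cast
    rw [contDiffOn_succ_iff_deriv_of_isOpen hI]
    refine ⟨fun t ht ↦ (hα t ht).2.differentiableAt.differentiableWithinAt, by simp, ?_⟩
    have : ContDiffOn ℝ n (f ∘ α) I := fun t ht ↦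
      ((hf _ (hα t ht).1).of_le (by exact_mod_cast le_top)).comp_contDiffWithinAt t (ih t ht)
    exact this.congr fun t ht ↦ (hα t ht).2.deriv

/-- Local solutions of smooth autonomous ordinary differential equations of second order. -/
lemma exists_second_order_solution {f : V × V → V} {Ω : Set (V × V)} (hΩ : IsOpen Ω)
    (hf : ∀ y ∈ Ω, ContDiffAt ℝ ∞ f y) {e x : V} (he : (e, x) ∈ Ω) :
    ∃ δ > 0, ∃ c : ℝ → V, ContDiffOn ℝ ∞ c (Ioo (-δ) δ) ∧ c 0 = e ∧ deriv c 0 = x ∧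
      ∀ t ∈ Ioo (-δ) δ, (c t, deriv c t) ∈ Ω ∧ deriv (deriv c) t = f (c t, deriv c t) := by
  set k : V × V → V × V := fun y ↦ (y.2, f y) with hk
  have hks : ∀ y ∈ Ω, ContDiffAt ℝ ∞ k y := fun y hy ↦ contDiffAt_snd.prodMk (hf y hy)
  obtain ⟨α, hα0, ε, hε, hα⟩ := ((hks _ he).of_le
    (m := 1) (by exact_mod_cast le_top)).exists_forall_mem_closedBall_exists_eq_forall_mem_Ioo_hasDerivAt₀ 0
  simp only [zero_sub, zero_add] at hα
  have hc : ContinuousAt α 0 := (hα 0 ⟨by linarith, hε⟩).continuousAt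
  have hnb : ∀ᶠ t in 𝓝 (0 : ℝ), α t ∈ Ω := hc.eventually (by rw [hα0]; exact hΩ.mem_nhds he)
  obtain ⟨δ', hδ', hδ⟩ := Metric.eventually_nhds_iff.1 hnb
  have hmem : ∀ t ∈ Ioo (-min ε δ') (min ε δ'), α t ∈ Ω ∧ HasDerivAt α (k (α t)) t := by
    intro t ht
    have h1 := (min_le_left ε δ')
    have h2 := (min_le_right ε δ')
    refine ⟨hδ ?_, hα t ⟨by linarith [ht.1], by linarith [ht.2]⟩⟩
    rw [Real.dist_eq, sub_zero, abs_lt]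
    exact ⟨by linarith [ht.1], by linarith [ht.2]⟩
  have hs := contDiffOn_of_ode isOpen_Ioo hks hmem
  have h1 : ∀ t ∈ Ioo (-min ε δ') (min ε δ'), HasDerivAt (fun t ↦ (α t).1) (α t).2 t :=
    fun t ht ↦ (ContinuousLinearMap.fst ℝ V V).hasFDerivAt.comp_hasDerivAt t (hmem t ht).2
  have h2 : ∀ t ∈ Ioo (-min ε δ') (min ε δ'), HasDerivAt (fun t ↦ (α t).2) (f (α t)) t :=
    fun t ht ↦ (ContinuousLinearMap.snd ℝ V V).hasFDerivAt.comp_hasDerivAt t (hmem t ht).2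
  have h0 : (0 : ℝ) ∈ Ioo (-min ε δ') (min ε δ') := by
    have := lt_min hε hδ'
    exact ⟨by linarith, this⟩
  refine ⟨min ε δ', lt_min hε hδ', fun t ↦ (α t).1, contDiff_fst.comp_contDiffOn hs, by simp [hα0],
    by rw [(h1 0 h0).deriv, hα0], fun t ht ↦ ?_⟩
  rw [(h1 t ht).deriv]
  refine ⟨(hmem t ht).1, ?_⟩
  have : deriv (fun t ↦ (α t).1) =ᶠ[𝓝 t] fun t ↦ (α t).2 := by
    filter_upwards [isOpen_Ioo.mem_nhds ht] with s hs
    exact (h1 s hs).deriv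
  rw [this.deriv_eq, (h2 t ht).deriv]

end ODE

/-! ### First-order consequences of a flow at time zero -/

section FlowAtTimeZero

variable {V : Type*} [NormedAddCommGroup V] [NormedSpace ℝ V]
  {Γ : V → V →L[ℝ] V →L[ℝ] V} {J : V → V →L[ℝ] V} {v : V → V} {F : ℝ × V → V} {e : V}

lemma dirD_of_time_zero (hF : DifferentiableAt ℝ F (0, e)) (h0 : ∀ᶠ y in 𝓝 e, F (0, y) = y)
    (x : V) : dirD (0, x) F (0, e) = x := by
  have h1 := hasDerivAt_line hF (0, x)
  have h2 : HasDerivAt (fun t : ℝ ↦ e + t • x) x 0 := by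
    simpa using ((hasDerivAt_id (0 : ℝ)).smul_const x).const_add e
  refine h1.unique (h2.congr_of_eventuallyEq ?_)
  filter_upwards [eventually_line h0 x] with t ht
  simpa using ht

/-- At time zero the map is the identity: its second derivative is zero and it pulls `Γ` back to
itself. -/
lemma flowTensor_time_zero (hF : ∀ᶠ y in 𝓝 ((0 : ℝ), e), ContDiffAt ℝ ∞ F y)
    (h0 : ∀ᶠ y in 𝓝 e, F (0, y) = y) (x y : V) : flowTensor Γ F x y (0, e) = 0 := by
  have hFe := hF.self_of_nhds
  have hc : Filter.Tendsto (fun y : V ↦ ((0 : ℝ), y)) (𝓝 e) (𝓝 (0, e)) :=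
    (Continuous.prodMk_right (0 : ℝ)).tendsto e
  have h1 : dirD (0, x) (dirD (0, y) F) (0, e) = 0 := by
    refine (hasDerivAt_line (smooth_dirD hFe (0, y)).diffAt ((0 : ℝ), x)).unique
      ((hasDerivAt_const (0 : ℝ) y).congr_of_eventuallyEq ?_)
    filter_upwards [eventually_line (hc.eventually hF) x, eventually_line h0.eventually_nhds x]
      with t h1 h2
    have := dirD_of_time_zero h1.diffAt h2 y
    simpa using this
  have h2 := dirD_of_time_zero hFe.diffAt h0
  have h3 : fderiv ℝ F (0, e) (0, Γ e x y) = Γ e x y := h2 _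
  rw [flowTensor, h1, h2, h2, h0.self_of_nhds, h3]
  abel

/-- The second derivative of the image of a curve. -/
lemma deriv_deriv_image {F : ℝ × V → V} {t s : ℝ} {c : ℝ → V}
    (hF : ∀ᶠ y in 𝓝 (t, c s), ContDiffAt ℝ ∞ F y) (hc : ∀ᶠ r in 𝓝 s, ContDiffAt ℝ ∞ c r) :
    deriv (fun r ↦ F (t, c r)) s = dirD (0, deriv c s) F (t, c s) ∧
    deriv (deriv fun r ↦ F (t, c r)) s =
      dirD (0, deriv c s) (dirD (0, deriv c s) F) (t, c s)
      + fderiv ℝ F (t, c s) (0, deriv (deriv c) s) := by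
  have hp (r : ℝ) (hr : ContDiffAt ℝ ∞ c r) : HasDerivAt (fun r ↦ (t, c r)) (0, deriv c r) r :=
    (hasDerivAt_const r t).prodMk hr.diffAt.hasDerivAt
  have h1 (r : ℝ) (hr : ContDiffAt ℝ ∞ c r) (hFr : ContDiffAt ℝ ∞ F (t, c r)) :
      HasDerivAt (fun r ↦ F (t, c r)) (fderiv ℝ F (t, c r) (0, deriv c r)) r :=
    hFr.diffAt.hasFDerivAt.comp_hasDerivAt r (hp r hr)
  have hcs := hc.self_of_nhds
  have hFs := hF.self_of_nhds
  refine ⟨(h1 s hcs hFs).deriv, ?_⟩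
  have h2 : deriv (fun r ↦ F (t, c r)) =ᶠ[𝓝 s] fun r ↦ fderiv ℝ F (t, c r) (0, deriv c r) := by
    filter_upwards [hc, (hp s hcs).continuousAt.eventually hF] with r a b
    exact (h1 r a b).deriv
  rw [h2.deriv_eq]
  have hc1 : ContDiffAt ℝ ∞ (deriv c) s := (contDiffAt_fderiv hcs).clm_apply contDiffAt_const
  have h3 := (contDiffAt_fderiv hFs).diffAt.hasFDerivAt.comp_hasDerivAt s (hp s hcs)
  have h4 : HasDerivAt (fun r ↦ ((0 : ℝ), deriv c r)) (0, deriv (deriv c) s) s :=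
    (hasDerivAt_const s (0 : ℝ)).prodMk hc1.diffAt.hasDerivAt
  rw [dirD_dirD hFs]
  exact (h3.clm_apply h4).deriv

lemma independent_pair {J : V →L[ℝ] V} (hJ : ∀ a, J (J a) = -a) {x : V} (hx : x ≠ 0) :
    LinearIndependent ℝ ![x, J x] := by
  rw [LinearIndependent.pair_iff]
  intro p q h
  have h2 := congrArg J h
  simp only [map_add, map_smul, hJ, map_zero] at h2
  have e : (p ^ 2 + q ^ 2) • x = 0 := by
    have : (p ^ 2 + q ^ 2) • x = p • (p • x + q • J x) - q • (p • J x + q • -x) := by module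
    rw [this, h, h2]; simp
  have := (smul_eq_zero.1 e).resolve_right hx
  exact ⟨by nlinarith [sq_nonneg p, sq_nonneg q], by nlinarith [sq_nonneg p, sq_nonneg q]⟩

/-- Infinitesimal consequence of the invariance of `J`-planar curves. -/
lemma infinitesimal_planar [FiniteDimensional ℝ V]
    (hF : ∀ᶠ y in 𝓝 ((0 : ℝ), e), ContDiffAt ℝ ∞ F y)
    (hv : ∀ᶠ y in 𝓝 ((0 : ℝ), e), ContDiffAt ℝ ∞ v (F y)) (hΓ : ContDiffAt ℝ ∞ Γ e)
    (hJ : ContDiffAt ℝ ∞ J e) (hJ2 : ∀ a, J e (J e a) = -a)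
    (hflow : ∀ᶠ y in 𝓝 ((0 : ℝ), e), dirD (1, 0) F y = v (F y))
    (h0 : ∀ᶠ y in 𝓝 e, F (0, y) = y) {x : V} (hx : x ≠ 0) (β : ℝ)
    (hpl : ∀ᶠ t : ℝ in 𝓝 0, ∃ r s : ℝ, flowTensor Γ F x x (t, e)
      + β • dirD (0, J e x) F (t, e) = r • dirD (0, x) F (t, e)
        + s • J (F (t, e)) (dirD (0, x) F (t, e))) :
    ∃ p q : ℝ, lieConn v Γ e x x - β • lieEnd v J e x = p • x + q • J e x := by
  have hFe := hF.self_of_nhds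
  have hF0 : F (0, e) = e := h0.self_of_nhds
  have hve : ContDiffAt ℝ ∞ v e := by simpa [hF0] using hv.self_of_nhds
  have hline (t : ℝ) : ((0 : ℝ), e) + t • ((1 : ℝ), (0 : V)) = (t, e) := by simp
  have hD := dirD_of_time_zero hFe.diffAt h0
  have hd (w : V) : HasDerivAt (fun t : ℝ ↦ dirD (0, w) F (t, e)) (fderiv ℝ v e w) 0 := by
    have h1 := hasDerivAt_line (smooth_dirD hFe (0, w)).diffAt ((1 : ℝ), (0 : V))
    have h2 := dirD_flow hFe hv.self_of_nhds hflow w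
    rw [hF0, hD] at h2
    simp only [hline] at h1
    exact h1.congr_deriv h2
  have hdT : HasDerivAt (fun t : ℝ ↦ flowTensor Γ F x x (t, e)) (lieConn v Γ e x x) 0 := by
    have h1 := hasDerivAt_flowTensor (Γ := Γ) hF hv (by rwa [hF0]) hflow x x
    simp only [hline] at h1
    refine h1.congr_deriv ?_
    rw [flowTensor_time_zero hF h0, map_zero, add_zero, hF0, hD]
  have hdJ : HasDerivAt (fun t : ℝ ↦ J (F (t, e))) (fderiv ℝ J e (v e)) 0 := by
    have hJF : ContDiffAt ℝ ∞ J (F (0, e)) := by rwa [hF0]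
    have h1 := hasDerivAt_line (hJF.comp (0, e) hFe).diffAt ((1 : ℝ), (0 : V))
    simp only [hline] at h1
    refine h1.congr_deriv ?_
    rw [fderiv_comp _ hJF.diffAt hFe.diffAt, hF0]
    have := hflow.self_of_nhds
    rw [hF0] at this
    exact congrArg _ this
  have hab : LinearIndependent ℝ ![dirD (0, x) F (0, e),
      J (F (0, e)) (dirD (0, x) F (0, e))] := by
    rw [hF0, hD]; exact independent_pair hJ2 hx
  -- The coefficients at time zero are `0` and `β`, since the flow tensor vanishes there and the
  -- remaining term is `β J x`.
  obtain ⟨p, q, hpq⟩ := deriv_mem_span (hdT.add ((hd (J e x)).const_smul β)) (hd x)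
    (hdJ.clm_apply (hd x)) hpl hab (r := 0) (s := β) (by
      simp [flowTensor_time_zero hF h0, hF0, hD])
  refine ⟨p, q, ?_⟩
  simp only [hF0, hD] at hpq
  rw [← hpq]
  simp only [lieEnd, sub_apply, ContinuousLinearMap.comp_apply, zero_smul, smul_sub, smul_add]
  abel

end FlowAtTimeZero

/-! ### Local flows in a chart -/

section FlowInChart

variable {E : Type*} [NormedAddCommGroup E] [NormedSpace ℝ E] [FiniteDimensional ℝ E]
  {M : Type*} [TopologicalSpace M] [ChartedSpace E M] [IsManifold 𝓘(ℝ, E) ∞ M]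

/-- A local flow in the chart around `p`. -/
def flowChart (Φ : ℝ → M → M) (p : M) (z : ℝ × E) : E :=
  extChartAt 𝓘(ℝ, E) p (Φ z.1 (chartInv E p z.2))

/-- The domain of a local flow in the chart around `p`. -/
def flowDom (Φ : ℝ → M → M) (U : Set M) (ε : ℝ) (p : M) : Set (ℝ × E) :=
  {z | (z.1 ∈ Ioo (-ε) ε ∧ z.2 ∈ chartDom E p ∧ chartInv E p z.2 ∈ U) ∧
    Φ z.1 (chartInv E p z.2) ∈ (chartAt E p).source}

variable {v : SmoothVectorField E M} {U : Set M} {ε : ℝ} {Φ : ℝ → M → M} {p : M}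

namespace IsLocalFlow

variable (h : IsLocalFlow v U ε Φ)
include h

lemma contMDiffAt_map {z : ℝ × E} (hz : z.1 ∈ Ioo (-ε) ε ∧ z.2 ∈ chartDom E p ∧
    chartInv E p z.2 ∈ U) : ContMDiffAt 𝓘(ℝ, ℝ × E) 𝓘(ℝ, E) ∞
      (fun y : ℝ × E ↦ Φ y.1 (chartInv E p y.2)) z := by
  have h1 := h.smooth.contMDiffAt (x := (z.1, chartInv E p z.2))
    ((isOpen_Ioo.prod h.isOpen).mem_nhds ⟨hz.1, hz.2.2⟩)
  have h2 : ContMDiffAt 𝓘(ℝ, ℝ × E) 𝓘(ℝ, ℝ) ∞ (fun y : ℝ × E ↦ y.1) z :=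
    contDiff_fst.contMDiff.contMDiffAt
  have h3 : ContMDiffAt 𝓘(ℝ, ℝ × E) 𝓘(ℝ, E) ∞ (fun y : ℝ × E ↦ chartInv E p y.2) z :=
    (contMDiffAt_chartInv hz.2.1).comp z (f := fun y : ℝ × E ↦ y.2)
      contDiff_snd.contMDiff.contMDiffAt
  exact h1.comp z (h2.prodMk h3)

lemma isOpen_flowDom : IsOpen (flowDom (E := E) Φ U ε p) := by
  have hD : IsOpen {z : ℝ × E | z.1 ∈ Ioo (-ε) ε ∧ z.2 ∈ chartDom E p ∧ chartInv E p z.2 ∈ U} := by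
    rw [isOpen_iff_mem_nhds]
    rintro z ⟨h1, h2, h3⟩
    exact (continuousAt_fst.eventually (isOpen_Ioo.mem_nhds h1)).and
      ((continuousAt_snd.eventually ((isOpen_chartDom p).mem_nhds h2)).and
        (continuousAt_snd.eventually ((continuousAt_chartInv h2).eventually
          (h.isOpen.mem_nhds h3))))
  rw [isOpen_iff_mem_nhds]
  rintro z ⟨h1, h2⟩
  exact Filter.inter_mem (hD.mem_nhds h1) ((h.contMDiffAt_map h1).continuousAt.eventually
    ((chartAt E p).open_source.mem_nhds h2))

lemma smooth_flowChart {z : ℝ × E} (hz : z ∈ flowDom Φ U ε p) :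
    ContDiffAt ℝ ∞ (flowChart Φ p) z :=
  ((contMDiffAt_extChartAt' hz.2).comp z (h.contMDiffAt_map hz.1)).contDiffAt

omit h in
lemma flowChart_mem {z : ℝ × E} (hz : z ∈ flowDom Φ U ε p) : flowChart Φ p z ∈ chartDom E p :=
  chart_mem hz.2

omit h in
lemma chartInv_flowChart {z : ℝ × E} (hz : z ∈ flowDom Φ U ε p) :
    chartInv E p (flowChart Φ p z) = Φ z.1 (chartInv E p z.2) :=
  chartInv_chart hz.2

lemma zero_mem_flowDom {e : E} (he : e ∈ chartDom E p) (heU : chartInv E p e ∈ U) :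
    ((0 : ℝ), e) ∈ flowDom Φ U ε p := by
  refine ⟨⟨⟨by simpa using h.pos, h.pos⟩, he, heU⟩, ?_⟩
  rw [h.zero _ heU]
  exact chartInv_mem he

lemma flowChart_zero {e : E} (he : e ∈ chartDom E p) (heU : chartInv E p e ∈ U) :
    flowChart Φ p (0, e) = e := by
  rw [flowChart, h.zero _ heU, chart_chartInv he]

lemma eventually_flowChart_zero {e : E} (he : e ∈ chartDom E p) (heU : chartInv E p e ∈ U) :
    ∀ᶠ y in 𝓝 e, flowChart Φ p (0, y) = y := by
  filter_upwards [eventually_chartDom he, (continuousAt_chartInv he).eventually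
    (h.isOpen.mem_nhds heU)] with y h1 h2
  exact h.flowChart_zero h1 h2

lemma dirD_flowChart {z : ℝ × E} (hz : z ∈ flowDom Φ U ε p) :
    dirD (1, 0) (flowChart Φ p) z = locVec (fun y ↦ v y) p (flowChart Φ p z) := by
  have h1 := (h.integralCurve _ hz.1.2.2 z.1 hz.1.1).hasMFDerivAt (Ioo_mem_nhds hz.1.1.1 hz.1.1.2)
  have h2 := (mdifferentiableAt_chart hz.2).hasMFDerivAt.comp z.1 h1
  have h3 := HasFDerivAt.hasDerivAt (𝕜 := ℝ) (F := E) (f := fun t ↦ flowChart Φ p (t, z.2))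
    h2.hasFDerivAt
  have h4 : HasDerivAt (fun t : ℝ ↦ (t, z.2)) (1, 0) z.1 :=
    (hasDerivAt_id z.1).prodMk (hasDerivAt_const _ _)
  have h5 := (h.smooth_flowChart hz).diffAt.hasFDerivAt.comp_hasDerivAt z.1 h4
  rw [dirD, h5.unique h3, locVec, chartInv_flowChart hz, components_eq _ hz.2,
    coordComp_eq_mfderiv hz.2]
  exact congrArg (mfderiv 𝓘(ℝ, E) 𝓘(ℝ, E) (extChartAt 𝓘(ℝ, E) p) (Φ z.1 (chartInv E p z.2)))
    (one_smul ℝ (v (Φ z.1 (chartInv E p z.2)) : TangentSpace 𝓘(ℝ, E) _))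

end IsLocalFlow

end FlowInChart

/-! ### Infinitesimal form of c-projectivity -/

section CProjectiveFields

variable {E : Type*} [NormedAddCommGroup E] [NormedSpace ℝ E] [FiniteDimensional ℝ E]
  {M : Type*} [TopologicalSpace M] [ChartedSpace E M] [IsManifold 𝓘(ℝ, E) ∞ M]
  {g : PseudoRiemannianMetric E M} {J : EndField E M} {v : SmoothVectorField E M} {U : Set M}
  {ε : ℝ} {Φ : ℝ → M → M} {p : M}

lemma coordComp_endField (A : (y : M) → TangentSpace 𝓘(ℝ, E) y →L[ℝ] TangentSpace 𝓘(ℝ, E) y)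
    {p x : M} (hx : x ∈ (chartAt E p).source) (w : TangentSpace 𝓘(ℝ, E) x) :
    coordComp p x (A x w) = locEnd A p (extChartAt 𝓘(ℝ, E) p x) (coordComp p x w) := by
  have := locEnd_apply A p (chart_mem hx)
  rw [chartInv_chart hx] at this
  exact (this w).symm

/-- The equation of `J`-planar curves in a chart. -/
lemma IsJPlanar.chart_equation {γ : ℝ → M} {I : Set ℝ} (h : IsJPlanar g J γ I) {t : ℝ}
    (ht : t ∈ I) (hp : γ t ∈ (chartAt E p).source) {c : ℝ → E}
    (hc : c = fun s ↦ extChartAt 𝓘(ℝ, E) p (γ s)) : ∃ r s : ℝ,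
      deriv (deriv c) t + locConn g p (c t) (deriv c t) (deriv c t) =
        r • deriv c t + s • locEnd (fun y ↦ J y) p (c t) (deriv c t) := by
  obtain ⟨α, β, hαβ⟩ := h.planar
  have hγ := h.smooth.contMDiffAt (h.isOpen.mem_nhds ht)
  refine ⟨α t, β t, ?_⟩
  subst hc
  rw [← coordComp_acceleration g hγ hp, hαβ t ht, map_add, map_smul, map_smul,
    coordComp_endField (fun y ↦ J y) hp, coordComp_velocity hγ hp]

/-- This provides the test curves: `J`-planar curves with first coefficient zero and second
coefficient a constant `β`, obtained from a second order equation in the chart. -/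
lemma isJPlanar_chartInv {c : ℝ → E} {δ β : ℝ} (hc : ContDiffOn ℝ ∞ c (Ioo (-δ) δ))
    (hmem : ∀ t ∈ Ioo (-δ) δ, c t ∈ chartDom E p) (hne : ∀ t ∈ Ioo (-δ) δ, deriv c t ≠ 0)
    (heq : ∀ t ∈ Ioo (-δ) δ, deriv (deriv c) t = -locConn g p (c t) (deriv c t) (deriv c t)
      + β • locEnd (fun y ↦ J y) p (c t) (deriv c t)) :
    IsJPlanar g J (fun s ↦ chartInv E p (c s)) (Ioo (-δ) δ) := by
  have hs (t : ℝ) (ht : t ∈ Ioo (-δ) δ) :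
      ContMDiffAt 𝓘(ℝ, ℝ) 𝓘(ℝ, E) ∞ (fun s ↦ chartInv E p (c s)) t :=
    (contMDiffAt_chartInv (hmem t ht)).comp t
      ((hc.contDiffAt (Ioo_mem_nhds ht.1 ht.2)).contMDiffAt)
  have hd (t : ℝ) (ht : t ∈ Ioo (-δ) δ) :
      (fun s ↦ extChartAt 𝓘(ℝ, E) p (chartInv E p (c s))) =ᶠ[𝓝 t] c := by
    filter_upwards [Ioo_mem_nhds ht.1 ht.2] with s hs
    exact chart_chartInv (hmem s hs)
  have hvel (t : ℝ) (ht : t ∈ Ioo (-δ) δ) :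
      coordComp p _ (velocity (fun s ↦ chartInv E p (c s)) t) = deriv c t := by
    rw [coordComp_velocity (hs t ht) (chartInv_mem (hmem t ht)), (hd t ht).deriv_eq]
  refine ⟨isOpen_Ioo, ordConnected_Ioo, fun t ht ↦ (hs t ht).contMDiffWithinAt, ?_,
    fun _ ↦ 0, fun _ ↦ β, ?_⟩
  · intro t ht h0
    apply hne t ht
    rw [← hvel t ht, h0, map_zero]
  · intro t ht
    have hx := chartInv_mem (hmem t ht)
    have inj : ∀ a b : TangentSpace 𝓘(ℝ, E) (chartInv E p (c t)),
        coordComp p _ a = coordComp p _ b → a = b := fun a b hab ↦ by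
      rw [← coordFrame_coordComp hx a, hab, coordFrame_coordComp hx]
    apply inj
    rw [coordComp_acceleration g (hs t ht) hx, (hd t ht).deriv.deriv_eq, (hd t ht).deriv_eq,
      map_add, map_smul, map_smul, coordComp_endField (fun y ↦ J y) hx, hvel t ht,
      chart_chartInv (hmem t ht), heq t ht]
    simp

/-- The images of `J`-planar curves under the flow of a c-projective vector field. -/
lemma IsLocalFlow.eventually_planar (h : IsLocalFlow v U ε Φ)
    (hpl : ∀ t ∈ Ioo (-ε) ε, ∀ (γ : ℝ → M) (I : Set ℝ), IsJPlanar g J γ I → MapsTo γ I U →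
      IsJPlanar g J (fun s ↦ Φ t (γ s)) I)
    {e : E} (he : e ∈ chartDom E p) (heU : chartInv E p e ∈ U) {x : E} (hx : x ≠ 0) (β : ℝ) :
    ∀ᶠ t : ℝ in 𝓝 0, ∃ r s : ℝ, flowTensor (locConn g p) (flowChart Φ p) x x (t, e)
      + β • dirD (0, locEnd (fun y ↦ J y) p e x) (flowChart Φ p) (t, e) =
        r • dirD (0, x) (flowChart Φ p) (t, e)
        + s • locEnd (fun y ↦ J y) p (flowChart Φ p (t, e))
          (dirD (0, x) (flowChart Φ p) (t, e)) := by
  -- The admissible positions and velocities: nonzero velocity makes the solution regular, and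
  -- positions in `U` allow the flow to act on it.
  set Ω : Set (E × E) := {y | y.1 ∈ chartDom E p ∧ chartInv E p y.1 ∈ U ∧ y.2 ≠ 0} with hΩ
  have hΩo : IsOpen Ω := by
    rw [isOpen_iff_mem_nhds]
    rintro y ⟨h1, h2, h3⟩
    exact Filter.inter_mem (continuousAt_fst.eventually ((isOpen_chartDom p).mem_nhds h1))
      (Filter.inter_mem (continuousAt_fst.eventually ((continuousAt_chartInv h1).eventually
          (h.isOpen.mem_nhds h2))) (continuousAt_snd.eventually (isOpen_ne.mem_nhds h3)))
  set f : E × E → E := fun y ↦ -locConn g p y.1 y.2 y.2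
    + β • locEnd (fun y ↦ J y) p y.1 y.2 with hf
  have hfs : ∀ y ∈ Ω, ContDiffAt ℝ ∞ f y := by
    rintro y ⟨h1, -, -⟩
    have hΓ : ContDiffAt ℝ ∞ (fun y : E × E ↦ locConn g p y.1) y :=
      (smooth_locConn g h1).comp y contDiffAt_fst
    have hJ : ContDiffAt ℝ ∞ (fun y : E × E ↦ locEnd (fun y ↦ J y) p y.1) y :=
      (smooth_locEnd J h1).comp y contDiffAt_fst
    exact ((hΓ.clm_apply contDiffAt_snd).clm_apply contDiffAt_snd).neg.add
      ((hJ.clm_apply contDiffAt_snd).const_smul β)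
  obtain ⟨δ, hδ, c, hc, hc0, hc1, hode⟩ := exists_second_order_solution hΩo hfs
    (e := e) (x := x) ⟨he, heU, hx⟩
  have h0mem : (0 : ℝ) ∈ Ioo (-δ) δ := ⟨by simpa using hδ, hδ⟩
  have hplanar := isJPlanar_chartInv (g := g) (J := J) (p := p) (β := β) hc
    (fun t ht ↦ (hode t ht).1.1) (fun t ht ↦ (hode t ht).1.2.2) (fun t ht ↦ (hode t ht).2)
  have hdom : ∀ᶠ t : ℝ in 𝓝 0, (t, e) ∈ flowDom Φ U ε p :=
    (Continuous.prodMk_left e).continuousAt.eventually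
      (h.isOpen_flowDom.mem_nhds (h.zero_mem_flowDom he heU))
  filter_upwards [hdom] with t ht
  have him := hpl t ht.1.1 _ _ hplanar fun s hs ↦ (hode s hs).1.2.1
  have hdomt : ∀ᶠ y in 𝓝 (t, c 0), ContDiffAt ℝ ∞ (flowChart Φ p) y := by
    rw [hc0]
    filter_upwards [h.isOpen_flowDom.mem_nhds ht] with y hy
    exact h.smooth_flowChart hy
  have hcs : ∀ᶠ r in 𝓝 (0 : ℝ), ContDiffAt ℝ ∞ c r := by
    filter_upwards [Ioo_mem_nhds h0mem.1 h0mem.2] with r hr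
    exact hc.contDiffAt (Ioo_mem_nhds hr.1 hr.2)
  obtain ⟨e1, e2⟩ := deriv_deriv_image hdomt hcs
  obtain ⟨r, s, hrs⟩ := him.chart_equation h0mem (p := p) (by simpa only [hc0] using ht.2)
    (c := fun r ↦ flowChart Φ p (t, c r)) rfl
  have e3 := (hode 0 h0mem).2
  -- The equation of the image curve at parameter zero. Its acceleration is the flow tensor plus the
  -- image of the acceleration `β J x` of the original curve.
  rw [e1, e2, e3] at hrs
  simp only [hf, hc0, hc1] at hrs
  refine ⟨r, s, hrs ▸ ?_⟩
  have e4 : ((0 : ℝ), -locConn g p e x x + β • locEnd (fun y ↦ J y) p e x) =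
      -((0 : ℝ), locConn g p e x x) + β • ((0 : ℝ), locEnd (fun y ↦ J y) p e x) := by simp
  rw [e4, map_add, map_neg, map_smul, flowTensor, dirD]
  simp only [dirD]
  abel

/-- For the `J`-planar curve through `e` with velocity `x` and coefficient `β`, the planarity of its
images under the flow is differentiated at time zero. The free constant `β` is what later separates
`L_v J` from `L_v ∇`. -/
lemma IsCProjective.infinitesimal (hgJ : IsKahler g J) (hv : IsCProjective g J v) {e : E}
    (he : e ∈ chartDom E p) {x : E} (hx : x ≠ 0) (β : ℝ) :
    ∃ r s : ℝ, lieConn (locVec (fun y ↦ v y) p) (locConn g p) e x x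
      - β • lieEnd (locVec (fun y ↦ v y) p) (locEnd (fun y ↦ J y) p) e x
      = r • x + s • locEnd (fun y ↦ J y) p e x := by
  obtain ⟨U, ε, Φ, hU, h, hpl⟩ := hv (chartInv E p e)
  have hdom := h.isOpen_flowDom.mem_nhds (h.zero_mem_flowDom he hU)
  refine infinitesimal_planar (F := flowChart Φ p) ?_ ?_ (smooth_locConn g he)
    (smooth_locEnd J he) ((hgJ.isLocalKahler p).sq e he) ?_ (h.eventually_flowChart_zero he hU) hx β
    (h.eventually_planar hpl he hU hx β)
  all_goals filter_upwards [hdom] with y hy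
  · exact h.smooth_flowChart hy
  · exact smooth_locVec v (IsLocalFlow.flowChart_mem hy)
  · exact h.dirD_flowChart hy

/-- A c-projective vector field is holomorphic. -/
lemma IsCProjective.lieEnd_eq_zero (hgJ : IsKahler g J) (hv : IsCProjective g J v)
    (hd : 2 < Module.finrank ℝ E) {e : E} (he : e ∈ chartDom E p) (x : E) :
    lieEnd (locVec (fun y ↦ v y) p) (locEnd (fun y ↦ J y) p) e x = 0 := by
  refine (hgJ.isLocalKahler p).lieEnd_eq_zero hd he (fun x ↦ ?_) x
  obtain rfl | hx := eq_or_ne x 0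
  · exact ⟨0, 0, by simp⟩
  -- The difference of the cases `β = 0` and `β = 1` puts `(L_v J) x` in the complex line of `x`;
  -- antilinearity then forces it to vanish.
  obtain ⟨r, s, h1⟩ := hv.infinitesimal hgJ he hx 0
  obtain ⟨r', s', h2⟩ := hv.infinitesimal hgJ he hx 1
  refine ⟨r - r', s - s', ?_⟩
  rw [zero_smul, sub_zero] at h1
  rw [one_smul, sub_eq_iff_eq_add, h1, ← sub_eq_iff_eq_add'] at h2
  rw [← h2]; module

/-- The Lie derivative of the Levi-Civita connection along a c-projective vector field. -/
lemma IsCProjective.exists_lieConn_form (hgJ : IsKahler g J) (hv : IsCProjective g J v)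
    (hd : 2 < Module.finrank ℝ E) {e : E} (he : e ∈ chartDom E p) :
    ∃ φ : E →ₗ[ℝ] ℝ, ∀ x y, lieConn (locVec (fun y ↦ v y) p) (locConn g p) e x y =
      φ x • y + φ y • x - φ (locEnd (fun y ↦ J y) p e x) • locEnd (fun y ↦ J y) p e y
      - φ (locEnd (fun y ↦ J y) p e y) • locEnd (fun y ↦ J y) p e x := by
  refine (hgJ.isLocalKahler p).exists_lieConn_form (smooth_locVec v he) he ?_ fun x ↦ ?_
  · filter_upwards [eventually_chartDom he] with y hy
    exact hv.lieEnd_eq_zero hgJ hd hy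
  · obtain rfl | hx := eq_or_ne x 0
    · exact ⟨0, 0, by simp [lieConn]⟩
    · simpa using hv.infinitesimal hgJ he hx 0

end CProjectiveFields

/-- The Lie derivative of a bilinear form, as a continuous bilinear map. -/
def lieFormL {V : Type*} [NormedAddCommGroup V] [NormedSpace ℝ V] (v : V → V)
    (G : V → V →L[ℝ] V →L[ℝ] ℝ) (e : V) : V →L[ℝ] V →L[ℝ] ℝ :=
  fderiv ℝ G e (v e) + G e ∘L fderiv ℝ v e
    + (ContinuousLinearMap.compL ℝ V V ℝ).flip (fderiv ℝ v e) ∘L G e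

lemma smooth_lieFormL {V : Type*} [NormedAddCommGroup V] [NormedSpace ℝ V] {v : V → V}
    {G : V → V →L[ℝ] V →L[ℝ] ℝ} {e : V} (hv : ContDiffAt ℝ ∞ v e) (hG : ContDiffAt ℝ ∞ G e) :
    ContDiffAt ℝ ∞ (lieFormL v G) e :=
  (((contDiffAt_fderiv hG).clm_apply hv).add (hG.clm_comp (contDiffAt_fderiv hv))).add
    ((((ContinuousLinearMap.compL ℝ V V ℝ).flip.contDiff.contDiffAt).comp e
      (contDiffAt_fderiv hv)).clm_comp hG)

/-! ### Global endomorphism fields and the Lie derivative of the metric -/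

section GlobalFields

variable {E : Type*} [NormedAddCommGroup E] [NormedSpace ℝ E] [FiniteDimensional ℝ E]
  {M : Type*} [TopologicalSpace M] [ChartedSpace E M] [IsManifold 𝓘(ℝ, E) ∞ M]

/-- A field of endomorphisms which is smooth in charts. -/
def endFieldOfLocal (T : (y : M) → TangentSpace 𝓘(ℝ, E) y →L[ℝ] TangentSpace 𝓘(ℝ, E) y)
    (hT : ∀ p e, e ∈ chartDom E p → ContDiffAt ℝ ∞ (locEnd T p) e) : EndField E M :=
  ⟨T, fun x ↦ (contMDiffAt_iff_locEnd (mem_chart_source E x)).2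
    (hT x _ (chart_mem (mem_chart_source E x)))⟩

variable (g : PseudoRiemannianMetric E M) {J : EndField E M} {v : SmoothVectorField E M}

lemma coordComp_injective {p x : M} (hx : x ∈ (chartAt E p).source) :
    Function.Injective (coordComp p x : TangentSpace 𝓘(ℝ, E) x → E) := fun a b hab ↦ by
  rw [← coordFrame_coordComp hx a, hab, coordFrame_coordComp hx]

/-- The metric adjoint of an endomorphism. -/
def metricAdjoint (x : M) (T : TangentSpace 𝓘(ℝ, E) x →L[ℝ] TangentSpace 𝓘(ℝ, E) x) :
    TangentSpace 𝓘(ℝ, E) x →L[ℝ] TangentSpace 𝓘(ℝ, E) x :=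
  LinearMap.toContinuousLinearMap
    ((g.flat x).symm.toLinearMap ∘ₗ T.toLinearMap.dualMap ∘ₗ (g.flat x).toLinearMap)

lemma val_metricAdjoint (x : M) (T : TangentSpace 𝓘(ℝ, E) x →L[ℝ] TangentSpace 𝓘(ℝ, E) x)
    (u w : TangentSpace 𝓘(ℝ, E) x) : g.val x (metricAdjoint g x T u) w = g.val x u (T w) :=
  g.val_flat_symm x _ w

lemma val_metricAdjoint_right (x : M)
    (T : TangentSpace 𝓘(ℝ, E) x →L[ℝ] TangentSpace 𝓘(ℝ, E) x)
    (u w : TangentSpace 𝓘(ℝ, E) x) : g.val x u (metricAdjoint g x T w) = g.val x (T u) w := by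
  rw [g.symm, val_metricAdjoint, g.symm]

lemma PseudoRiemannianMetric.ext_left {x : M} {u w : TangentSpace 𝓘(ℝ, E) x}
    (h : ∀ z, g.val x u z = g.val x w z) : u = w := by
  rw [← sub_eq_zero]
  exact g.nondegenerate x _ fun z ↦ by rw [map_sub, sub_apply, h, sub_self]

variable {g}

lemma IsKahler.val_J (hgJ : IsKahler g J) (x : M) (u w : TangentSpace 𝓘(ℝ, E) x) :
    g.val x u (J x w) = -g.val x (J x u) w := by
  have := hgJ.invariant x u (J x w)
  rw [hgJ.sq, map_neg] at this
  exact this.symm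

lemma metricAdjoint_commutes (hgJ : IsKahler g J) {x : M}
    {T : TangentSpace 𝓘(ℝ, E) x →L[ℝ] TangentSpace 𝓘(ℝ, E) x} (hT : ∀ u, T (J x u) = J x (T u))
    (u : TangentSpace 𝓘(ℝ, E) x) :
    metricAdjoint g x T (J x u) = J x (metricAdjoint g x T u) := by
  refine g.ext_left fun z ↦ ?_
  rw [val_metricAdjoint, ← neg_eq_iff_eq_neg.2 (hgJ.val_J x _ z), val_metricAdjoint, hT,
    ← neg_eq_iff_eq_neg.2 (hgJ.val_J x _ (T z))]

variable (g) in
/-- The covariant derivative of a vector field in a chart. -/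
lemma locEnd_leviCivita (v : SmoothVectorField E M) {p : M} {e : E} (he : e ∈ chartDom E p)
    (a : E) : locEnd (fun y ↦ g.leviCivita v y) p e a =
      fderiv ℝ (locVec (fun y ↦ v y) p) e a + locConn g p e a (locVec (fun y ↦ v y) p e) := by
  have hx := chartInv_mem he
  obtain ⟨w, rfl⟩ := coordComp_surjective hx a
  rw [locEnd_apply _ _ he, coordComp_leviCivita g hx ((v.contMDiff _).mdifferentiableAt (by simp)),
    chart_chartInv he, locVec_apply _ he]

/-- For a torsion-free connection, `L_v J = ∇_v J - [∇v, J]`, and both `L_v J` and `∇J` vanish. -/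
lemma leviCivita_commutes (hgJ : IsKahler g J)
    (hL : ∀ p e, e ∈ chartDom E p → ∀ x,
      lieEnd (locVec (fun y ↦ v y) p) (locEnd (fun y ↦ J y) p) e x = 0)
    (x : M) (u : TangentSpace 𝓘(ℝ, E) x) :
    g.leviCivita v x (J x u) = J x (g.leviCivita v x u) := by
  have hx := mem_chart_source E x
  have he : extChartAt 𝓘(ℝ, E) x x ∈ chartDom E x := chart_mem hx
  apply coordComp_injective hx
  have hK := hgJ.isLocalKahler x
  rw [coordComp_endField (fun y ↦ g.leviCivita v y) hx, coordComp_endField (fun y ↦ J y) hx,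
    coordComp_endField (fun y ↦ J y) hx, coordComp_endField (fun y ↦ g.leviCivita v y) hx,
    locEnd_leviCivita g v he, locEnd_leviCivita g v he]
  have h1 := hL x _ he (coordComp x x u)
  have h2 := hK.parallel _ he (locVec (fun y ↦ v y) x (extChartAt 𝓘(ℝ, E) x x)) (coordComp x x u)
  simp only [lieEnd, sub_apply, ContinuousLinearMap.comp_apply] at h1
  rw [map_add, hK.torsionFree _ he _ (locVec (fun y ↦ v y) x _),
    hK.torsionFree _ he (coordComp x x u) (locVec (fun y ↦ v y) x _)]
  simp only [covEnd, add_apply, sub_apply, ContinuousLinearMap.comp_apply] at h2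
  rw [sub_eq_zero] at h1
  rw [h1] at h2
  rw [← sub_eq_zero, ← h2]
  abel

variable (g v) in
/-- The Lie derivative of the metric as an endomorphism. -/
def lieMetricAt (x : M) : TangentSpace 𝓘(ℝ, E) x →L[ℝ] TangentSpace 𝓘(ℝ, E) x :=
  g.leviCivita v x + metricAdjoint g x (g.leviCivita v x)

/-- Because `∇` is metric and torsion-free, `(L_v g)(a, b) = g(∇_a v, b) + g(a, ∇_b v)`. -/
lemma locMet_lieMetricAt (hgJ : IsKahler g J) {p : M} {e : E} (he : e ∈ chartDom E p) (a b : E) :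
    locMet g p e (locEnd (fun y ↦ lieMetricAt g v y) p e a) b =
      lieForm (locVec (fun y ↦ v y) p) (locMet g p) e a b := by
  have hx := chartInv_mem he
  have hK := hgJ.isLocalKahler p
  have hm := hK.metric e he (locVec (fun y ↦ v y) p e) a b
  have h1 := locEnd_leviCivita g v he a
  have h2 := locEnd_leviCivita g v he b
  rw [hK.torsionFree e he] at h1 h2
  rw [lieForm, hm]
  obtain ⟨u, rfl⟩ := coordComp_surjective hx a
  obtain ⟨w, rfl⟩ := coordComp_surjective hx b
  have e1 : locMet g p e (locEnd (fun y ↦ lieMetricAt g v y) p e (coordComp p _ u))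
      (coordComp p _ w) = locMet g p e (locEnd (fun y ↦ g.leviCivita v y) p e (coordComp p _ u))
      (coordComp p _ w) + locMet g p e (coordComp p _ u)
        (locEnd (fun y ↦ g.leviCivita v y) p e (coordComp p _ w)) := by
    simp only [locEnd_apply _ _ he, locMet_coordComp g he, lieMetricAt, add_apply, map_add,
      val_metricAdjoint]
  rw [e1, h1, h2]
  simp only [map_add, add_apply]
  ring

variable (v) in
/-- The Lie derivative of the metric as an endomorphism field. -/
def lieMetric (hgJ : IsKahler g J) : EndField E M :=
  endFieldOfLocal (fun y ↦ lieMetricAt g v y) fun p e he ↦ by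
    have h1 := (contDiffAt_inverse_metric (smooth_locMet g he)
      (locMet_nondegenerate g he)).clm_comp
        (smooth_lieFormL (smooth_locVec v he) (smooth_locMet g he))
    refine h1.congr_of_eventuallyEq ?_
    filter_upwards [eventually_chartDom he] with y hy
    ext a
    rw [← inverse_apply (locMet_nondegenerate g hy)
      (locEnd (fun y ↦ lieMetricAt g v y) p y a), ContinuousLinearMap.comp_apply]
    congr 1
    ext b
    rw [locMet_lieMetricAt hgJ hy]
    rfl

end GlobalFields

/-! ### The solution attached to a c-projective vector field -/

section Solutions

variable {E : Type*} [NormedAddCommGroup E] [NormedSpace ℝ E] [FiniteDimensional ℝ E]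
  {M : Type*} [TopologicalSpace M] [ChartedSpace E M] [IsManifold 𝓘(ℝ, E) ∞ M]
  {g : PseudoRiemannianMetric E M} {J : EndField E M} {v : SmoothVectorField E M}

variable (v) in
/-- The normalized trace of the Lie derivative of the metric. -/
def lieTrace (hgJ : IsKahler g J) (x : M) : ℝ :=
  (Module.finrank ℝ E + 2 : ℝ)⁻¹ * traceField (lieMetric v hgJ) x

lemma lieTrace_chartInv (hgJ : IsKahler g J) {p : M} {e : E} (he : e ∈ chartDom E p) :
    lieTrace v hgJ (chartInv E p e) = (Module.finrank ℝ E + 2 : ℝ)⁻¹ *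
      traceL E (locEnd (fun y ↦ lieMetric v hgJ y) p e) := by
  rw [lieTrace, traceField_eq _ he]

variable (v) in
/-- The trace-adjusted Lie derivative of the metric. -/
def lieSolutionAt (hgJ : IsKahler g J) (x : M) :
    TangentSpace 𝓘(ℝ, E) x →L[ℝ] TangentSpace 𝓘(ℝ, E) x :=
  lieMetricAt g v x - lieTrace v hgJ x • ContinuousLinearMap.id ℝ (TangentSpace 𝓘(ℝ, E) x)

lemma eventually_locEnd_lieSolution (hgJ : IsKahler g J) {p : M} {e : E}
    (he : e ∈ chartDom E p) : locEnd (fun y ↦ lieSolutionAt v hgJ y) p =ᶠ[𝓝 e]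
      fun e ↦ locEnd (fun y ↦ lieMetric v hgJ y) p e - ((Module.finrank ℝ E + 2 : ℝ)⁻¹ *
        traceL E (locEnd (fun y ↦ lieMetric v hgJ y) p e)) • ContinuousLinearMap.id ℝ E := by
  filter_upwards [eventually_chartDom he] with y hy
  ext a
  obtain ⟨u, rfl⟩ := coordComp_surjective (chartInv_mem hy) a
  rw [sub_apply, smul_apply, ← lieTrace_chartInv hgJ hy, locEnd_apply _ _ hy, locEnd_apply _ _ hy]
  simp only [lieSolutionAt, sub_apply, map_sub, smul_apply, map_smul,
    ContinuousLinearMap.id_apply]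
  rfl

variable (v) in
/-- The trace-adjusted Lie derivative of the metric, as an endomorphism field. -/
def lieSolution (hgJ : IsKahler g J) : EndField E M :=
  endFieldOfLocal (fun y ↦ lieSolutionAt v hgJ y) fun p e he ↦ by
    have hB := smooth_locEnd (lieMetric v hgJ) he
    have ht : ContDiffAt ℝ ∞ (fun e ↦ traceL E (locEnd (fun y ↦ lieMetric v hgJ y) p e)) e :=
      (traceL E).contDiff.contDiffAt.comp e hB
    exact (hB.sub ((contDiffAt_const.mul ht).smul contDiffAt_const)).congr_of_eventuallyEq
      (eventually_locEnd_lieSolution hgJ he)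

/-- The splitting of `L_v g` that feeds `covEnd_lieEnd_sub`, where the scalar part need not be
constant on `M`. -/
lemma lieForm_lieSolution (hgJ : IsKahler g J) {p : M} {e : E} (he : e ∈ chartDom E p) (a b : E) :
    lieForm (locVec (fun y ↦ v y) p) (locMet g p) e a b =
      locMet g p e (locEnd (fun y ↦ lieSolution v hgJ y) p e a) b
        + lieTrace v hgJ (chartInv E p e) * locMet g p e a b := by
  have h1 := (eventually_locEnd_lieSolution (v := v) hgJ he).self_of_nhds
  rw [← locMet_lieMetricAt hgJ he]
  change _ = locMet g p e (locEnd (fun y ↦ lieSolutionAt v hgJ y) p e a) b + _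
  rw [h1, lieTrace_chartInv hgJ he]
  simp only [sub_apply, smul_apply, map_sub, map_smul, ContinuousLinearMap.id_apply, smul_eq_mul]
  exact (sub_add_cancel _ _).symm

lemma metricAdjoint_self (x : M) (T : TangentSpace 𝓘(ℝ, E) x →L[ℝ] TangentSpace 𝓘(ℝ, E) x)
    (u w : TangentSpace 𝓘(ℝ, E) x) :
    g.val x ((T + metricAdjoint g x T) u) w = g.val x u ((T + metricAdjoint g x T) w) := by
  simp only [add_apply, map_add, val_metricAdjoint, val_metricAdjoint_right]
  ring

variable (hgJ : IsKahler g J) (hv : IsCProjective g J v) (hd : 2 < Module.finrank ℝ E)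
include hv hd

lemma isHermitian_lieSolution : IsHermitian g J (lieSolution v hgJ) where
  selfadjoint x u w := by
    have := metricAdjoint_self (g := g) x (g.leviCivita v x) u w
    change g.val x (lieMetricAt g v x u - lieTrace v hgJ x • u) w =
      g.val x u (lieMetricAt g v x w - lieTrace v hgJ x • w)
    rw [map_sub, map_sub, sub_apply, map_smul, map_smul]
    exact congrArg (· - _) this
  commutes x u := by
    have h1 := leviCivita_commutes hgJ (fun p e he ↦ hv.lieEnd_eq_zero hgJ hd he) x
    change lieMetricAt g v x (J x u) - lieTrace v hgJ x • J x u =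
      J x (lieMetricAt g v x u - lieTrace v hgJ x • u)
    simp only [lieMetricAt, add_apply, map_add, map_sub, map_smul, h1, metricAdjoint_commutes hgJ h1]

/-- In charts, the Lie derivative of the connection is given by the solution `lieSolution`. -/
lemma lieConn_lieSolution {p : M} {e : E} (he : e ∈ chartDom E p) :
    ∃ l : E, (∀ u y, covEnd (locConn g p) (locEnd (fun y ↦ lieSolution v hgJ y) p) e u y =
      mainRHS (locMet g p e) (locEnd (fun y ↦ J y) p e) l u y) ∧
    ∀ x y, lieConn (locVec (fun y ↦ v y) p) (locConn g p) e x y =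
      locMet g p e l x • y + locMet g p e l y • x
      - locMet g p e l (locEnd (fun y ↦ J y) p e x) • locEnd (fun y ↦ J y) p e y
      - locMet g p e l (locEnd (fun y ↦ J y) p e y) • locEnd (fun y ↦ J y) p e x := by
  obtain ⟨φ, hφ⟩ := hv.exists_lieConn_form hgJ hd he
  have hK := hgJ.isLocalKahler p
  obtain ⟨l, hl⟩ : ∃ l, ∀ x, locMet g p e l x = φ x := by
    obtain ⟨f, hf⟩ := exists_equiv_of_nondegenerate (locMet_nondegenerate g he)
    refine ⟨f.symm (LinearMap.toContinuousLinearMap φ), fun x ↦ ?_⟩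
    have : locMet g p e (f.symm (LinearMap.toContinuousLinearMap φ)) =
        f (f.symm (LinearMap.toContinuousLinearMap φ)) := by rw [← hf]; rfl
    rw [this, f.apply_symm_apply]
    rfl
  simp only [← hl] at hφ
  refine ⟨l, fun u y ↦ ?_, hφ⟩
  have hB := smooth_locEnd (lieMetric v hgJ) he
  have hBm := hK.covEnd_of_lieForm (smooth_locVec v he) he hB (by
    filter_upwards [eventually_chartDom he] with e' he' a b
    exact locMet_lieMetricAt hgJ he' a b) hφ
  have ht : DifferentiableAt ℝ (fun e ↦ traceL E (locEnd (fun y ↦ lieMetric v hgJ y) p e)) e :=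
    (traceL E).differentiableAt.comp e hB.diffAt
  have h1 : covEnd (locConn g p) (locEnd (fun y ↦ lieSolution v hgJ y) p) e u y =
      covEnd (locConn g p) (locEnd (fun y ↦ lieMetric v hgJ y) p) e u y
      - fderiv ℝ (fun e ↦ (Module.finrank ℝ E + 2 : ℝ)⁻¹ *
        traceL E (locEnd (fun y ↦ lieMetric v hgJ y) p e)) e u • y := by
    have := eventually_locEnd_lieSolution (v := v) hgJ he
    have h2 : covEnd (locConn g p) (locEnd (fun y ↦ lieSolution v hgJ y) p) e = covEnd (locConn g p)
        (fun e ↦ locEnd (fun y ↦ lieMetric v hgJ y) p e - ((Module.finrank ℝ E + 2 : ℝ)⁻¹ *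
        traceL E (locEnd (fun y ↦ lieMetric v hgJ y) p e)) • ContinuousLinearMap.id ℝ E) e := by
      ext u y
      have h3 : locEnd (fun y ↦ lieSolution v hgJ y) p =ᶠ[𝓝 e] _ := this
      simp only [covEnd, h3.fderiv_eq, h3.self_of_nhds]
    rw [h2]
    exact hK.covEnd_sub_id hB.diffAt (ht.const_mul _) u y
  -- The trace is `2 (dim + 2) g(l, u)`: the multiple of the identity contributes `2 dim` and the
  -- main-equation part contributes `4`. This explains the normalization of `lieTrace`, whose
  -- differential `2 g(l, ·)` cancels the multiple of the identity.
  have h4 : traceL E (covEnd (locConn g p) (locEnd (fun y ↦ lieMetric v hgJ y) p) e u) =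
      2 * locMet g p e l u * Module.finrank ℝ E + 4 * locMet g p e l u := by
    have hT := traceL_comp_mainRHS (C := ContinuousLinearMap.id ℝ E)
      (T := covEnd (locConn g p) (locEnd (fun y ↦ lieMetric v hgJ y) p) e u
        - (2 * locMet g p e l u) • ContinuousLinearMap.id ℝ E)
      (hK.symm e he) (hK.invariant e he) (fun _ _ ↦ rfl) (fun _ ↦ rfl) (l := l) (u := u)
      (fun y ↦ by simp [hBm])
    rw [ContinuousLinearMap.id_comp, map_sub, map_smul, traceL_id, smul_eq_mul,
      sub_eq_iff_eq_add] at hT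
    rw [hT, ContinuousLinearMap.id_apply]; ring
  have hpos : (Module.finrank ℝ E + 2 : ℝ) ≠ 0 := by positivity
  have h5 : fderiv ℝ (fun e ↦ (Module.finrank ℝ E + 2 : ℝ)⁻¹ *
      traceL E (locEnd (fun y ↦ lieMetric v hgJ y) p e)) e u = 2 * locMet g p e l u := by
    rw [fderiv_const_mul ht, smul_apply, fderiv_trace (Γ := locConn g p) hB.diffAt, h4, smul_eq_mul]
    field_simp
    ring
  rw [h1, h5, hBm]
  abel

lemma lieSolution_mem : lieSolution v hgJ ∈ cCompatible g J := by
  refine ⟨isHermitian_lieSolution hgJ hv hd, mainEquation_of_covEnd hgJ fun x ↦ ?_⟩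
  obtain ⟨l, hl, -⟩ := lieConn_lieSolution hgJ hv hd (chart_mem (mem_chart_source E x))
  exact ⟨l, hl⟩

/-- The vector dual to the one-form in `L_v ∇` is the vector in the main equation for `lieSolution`,
and the trace identifies the latter with its field `Λ`. -/
lemma lieConn_eq {p : M} {e : E} (he : e ∈ chartDom E p) (x y : E) :
    lieConn (locVec (fun y ↦ v y) p) (locConn g p) e x y =
      locMet g p e (locVec (lambdaField g (lieSolution v hgJ)) p e) x • y
      + locMet g p e (locVec (lambdaField g (lieSolution v hgJ)) p e) y • x
      - locMet g p e (locVec (lambdaField g (lieSolution v hgJ)) p e)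
        (locEnd (fun y ↦ J y) p e x) • locEnd (fun y ↦ J y) p e y
      - locMet g p e (locVec (lambdaField g (lieSolution v hgJ)) p e)
        (locEnd (fun y ↦ J y) p e y) • locEnd (fun y ↦ J y) p e x := by
  obtain ⟨l, hl, hφ⟩ := lieConn_lieSolution hgJ hv hd he
  have hll : l = locVec (lambdaField g (lieSolution v hgJ)) p e := by
    refine (hgJ.isLocalKahler p).ext_of_metric he fun c ↦ ?_
    have := fderiv_trace_of_mainRHS (hgJ.isLocalKahler p) he
      (smooth_locEnd (lieSolution v hgJ) he).diffAt c (hl c)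
    rw [locMet_lambda _ he, this]; ring
  rw [← hll]
  exact hφ x y

end Solutions

/-! ### The action of a c-projective vector field on solutions -/

section Variation

variable {E : Type*} [NormedAddCommGroup E] [NormedSpace ℝ E] [FiniteDimensional ℝ E]
  {M : Type*} [TopologicalSpace M] [ChartedSpace E M] [IsManifold 𝓘(ℝ, E) ∞ M]
  {g : PseudoRiemannianMetric E M} {J : EndField E M} {v : SmoothVectorField E M}

lemma IsHermitian.locMet_locEnd {C : EndField E M} (hC : IsHermitian g J C) {p : M} {e : E}
    (he : e ∈ chartDom E p) (a b : E) : locMet g p e (locEnd (fun y ↦ C y) p e a) b =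
      locMet g p e a (locEnd (fun y ↦ C y) p e b) := by
  obtain ⟨u, rfl⟩ := coordComp_surjective (chartInv_mem he) a
  obtain ⟨w, rfl⟩ := coordComp_surjective (chartInv_mem he) b
  simp only [locEnd_apply _ _ he, locMet_coordComp g he, hC.selfadjoint]

lemma IsHermitian.locEnd_commutes {C : EndField E M} (hC : IsHermitian g J C) {p : M} {e : E}
    (he : e ∈ chartDom E p) (a : E) :
    locEnd (fun y ↦ C y) p e (locEnd (fun y ↦ J y) p e a) =
      locEnd (fun y ↦ J y) p e (locEnd (fun y ↦ C y) p e a) := by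
  obtain ⟨u, rfl⟩ := coordComp_surjective (chartInv_mem he) a
  simp only [locEnd_apply _ _ he, hC.commutes]

variable (v) in
/-- The c-projective variation of a solution of the main equation along `v`. -/
def variationAt (hgJ : IsKahler g J) (A : EndField E M) (x : M) :
    TangentSpace 𝓘(ℝ, E) x →L[ℝ] TangentSpace 𝓘(ℝ, E) x :=
  (g.val x (v x)).smulRight (lambdaField g A x) + (g.val x (lambdaField g A x)).smulRight (v x)
    + (g.val x (J x (v x))).smulRight (J x (lambdaField g A x))
    + (g.val x (J x (lambdaField g A x))).smulRight (J x (v x))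
    - (g.leviCivita v x ∘L A x + A x ∘L metricAdjoint g x (g.leviCivita v x))
    + lieTrace v hgJ x • A x

variable (hgJ : IsKahler g J) {A : EndField E M}

/-- Let `N = ∇v`, with metric adjoint `N*` and normalized trace `τ`. Then `L_v A = ∇_v A - N A + A
N` and `lieSolution` is `N + N* - τ`, so `A N` cancels. With `∇_v A` taken from the main equation,
what remains is the chart-free expression in `variationAt`. -/
lemma locEnd_variationAt (hA : MainEquation g J A) {p : M} {e : E} (he : e ∈ chartDom E p) :
    locEnd (fun y ↦ variationAt v hgJ A y) p e =
      lieEnd (locVec (fun y ↦ v y) p) (locEnd (fun y ↦ A y) p) e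
        - locEnd (fun y ↦ A y) p e ∘L locEnd (fun y ↦ lieSolution v hgJ y) p e := by
  ext a
  have hK := hgJ.isLocalKahler p
  have h1 := covEnd_of_mainEquation hA he (locVec (fun y ↦ v y) p e) a
  have hN := locEnd_leviCivita g v he
  have e1 : lieEnd (locVec (fun y ↦ v y) p) (locEnd (fun y ↦ A y) p) e a =
      covEnd (locConn g p) (locEnd (fun y ↦ A y) p) e (locVec (fun y ↦ v y) p e) a
      - locEnd (fun y ↦ g.leviCivita v y) p e (locEnd (fun y ↦ A y) p e a)
      + locEnd (fun y ↦ A y) p e (locEnd (fun y ↦ g.leviCivita v y) p e a) := by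
    rw [hN, hN, hK.torsionFree e he _ (locVec (fun y ↦ v y) p e),
      hK.torsionFree e he a (locVec (fun y ↦ v y) p e)]
    simp only [lieEnd, covEnd, sub_apply, add_apply, ContinuousLinearMap.comp_apply, map_add]
    abel
  rw [sub_apply, e1, h1]
  obtain ⟨u, rfl⟩ := coordComp_surjective (chartInv_mem he) a
  have e2 : lieSolution v hgJ (chartInv E p e) u = g.leviCivita v (chartInv E p e) u
      + metricAdjoint g _ (g.leviCivita v (chartInv E p e)) u
      - lieTrace v hgJ (chartInv E p e) • u := rfl
  simp only [mainRHS, locEnd_apply _ _ he, locVec_apply _ he, locMet_coordComp g he, variationAt,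
    ContinuousLinearMap.comp_apply, add_apply, sub_apply, smul_apply, map_add, map_sub,
    map_smul, ContinuousLinearMap.smulRight_apply, e2]
  abel

variable (v) in
/-- The c-projective variation of a solution, as an endomorphism field. -/
def variation (hA : MainEquation g J A) : EndField E M :=
  endFieldOfLocal (fun y ↦ variationAt v hgJ A y) fun p e he ↦ by
    have hAs := smooth_locEnd A he
    have hvs := smooth_locVec v he
    have hB := smooth_locEnd (lieSolution v hgJ) he
    have h1 : ContDiffAt ℝ ∞ (fun e ↦
        lieEnd (locVec (fun y ↦ v y) p) (locEnd (fun y ↦ A y) p) e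
        - locEnd (fun y ↦ A y) p e ∘L locEnd (fun y ↦ lieSolution v hgJ y) p e) e :=
      (((contDiffAt_fderiv hAs).clm_apply hvs).sub
        (((contDiffAt_fderiv hvs).clm_comp hAs).sub (hAs.clm_comp (contDiffAt_fderiv hvs)))).sub
        (hAs.clm_comp hB)
    refine h1.congr_of_eventuallyEq ?_
    filter_upwards [eventually_chartDom he] with y hy
    exact locEnd_variationAt hgJ hA hy

lemma locEnd_variation (hA : MainEquation g J A) {p : M} {e : E} (he : e ∈ chartDom E p) :
    locEnd (fun y ↦ variation v hgJ hA y) p e =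
      lieEnd (locVec (fun y ↦ v y) p) (locEnd (fun y ↦ A y) p) e
        - locEnd (fun y ↦ A y) p e ∘L locEnd (fun y ↦ lieSolution v hgJ y) p e :=
  locEnd_variationAt hgJ hA he

variable (hv : IsCProjective g J v) (hd : 2 < Module.finrank ℝ E)
include hv hd

/-- The terms `(∇v) A` and `A (∇v)*` are adjoint to each other, and the rank-one terms occur in
adjoint pairs. Commutation with `J` holds because `∇v`, and with it its adjoint, commutes with `J`.
-/
lemma isHermitian_variation (hA : MainEquation g J A) (hAh : IsHermitian g J A) :
    IsHermitian g J (variation v hgJ hA) where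
  selfadjoint x u w := by
    change g.val x (variationAt v hgJ A x u) w = g.val x u (variationAt v hgJ A x w)
    simp only [variationAt, add_apply, sub_apply, smul_apply, map_add, map_sub, map_smul,
      ContinuousLinearMap.smulRight_apply, ContinuousLinearMap.comp_apply, hAh.selfadjoint,
      val_metricAdjoint, smul_eq_mul]
    have hk : g.val x u (A x (metricAdjoint g x (g.leviCivita v x) w)) =
        g.val x (g.leviCivita v x (A x u)) w := by
      rw [← hAh.selfadjoint, val_metricAdjoint_right]
    rw [hk, g.symm x (v x) w, g.symm x (lambdaField g A x) w, g.symm x (J x (v x)) w,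
      g.symm x (J x (lambdaField g A x)) w, g.symm x (v x) u, g.symm x (lambdaField g A x) u,
      g.symm x (J x (v x)) u, g.symm x (J x (lambdaField g A x)) u]
    ring
  commutes x u := by
    have h1 := leviCivita_commutes hgJ (fun p e he ↦ hv.lieEnd_eq_zero hgJ hd he) x
    change variationAt v hgJ A x (J x u) = J x (variationAt v hgJ A x u)
    have hs (a : TangentSpace 𝓘(ℝ, E) x) : g.val x (J x a) (J x u) = g.val x a u :=
      hgJ.invariant x a u
    simp only [variationAt, add_apply, sub_apply, smul_apply, map_add, map_sub, map_smul,
      ContinuousLinearMap.smulRight_apply, ContinuousLinearMap.comp_apply, hAh.commutes,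
      h1, metricAdjoint_commutes hgJ h1, hs, hgJ.sq, hgJ.val_J]
    module

lemma variation_mem (hA : A ∈ cCompatible g J) : variation v hgJ hA.2 ∈ cCompatible g J := by
  refine ⟨isHermitian_variation hgJ hv hd hA.2 hA.1, mainEquation_of_covEnd hgJ fun x ↦ ?_⟩
  have he := chart_mem (mem_chart_source E x)
  have hK := hgJ.isLocalKahler x
  have hB := lieSolution_mem hgJ hv hd
  have h1 := hK.covEnd_lieEnd_sub (smooth_locVec v he) he (smooth_locEnd A he)
    (smooth_lambda (g := g) A he) (hv.lieEnd_eq_zero hgJ hd he) (by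
      filter_upwards [eventually_chartDom he] with y hy u a
      exact covEnd_of_mainEquation hA.2 hy u a)
    (hA.1.locMet_locEnd he) (hA.1.locEnd_commutes he)
    (smooth_locEnd (lieSolution v hgJ) he) (covEnd_of_mainEquation hB.2 he)
    (hB.1.locMet_locEnd he) (hB.1.locEnd_commutes he)
    (lieForm_lieSolution hgJ he) (lieConn_eq hgJ hv hd he)
  refine ⟨_, fun u a ↦ Eq.trans ?_ (h1 u a)⟩
  have h2 : locEnd (fun y ↦ variation v hgJ hA.2 y) x =ᶠ[𝓝 (extChartAt 𝓘(ℝ, E) x x)] fun e ↦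
      lieEnd (locVec (fun y ↦ v y) x) (locEnd (fun y ↦ A y) x) e
        - locEnd (fun y ↦ A y) x e ∘L locEnd (fun y ↦ lieSolution v hgJ y) x e := by
    filter_upwards [eventually_chartDom he] with y hy
    exact locEnd_variation hgJ hA.2 hy
  simp only [covEnd, h2.fderiv_eq, h2.self_of_nhds]

end Variation

/-! ### Fields leaving the connection invariant are affine -/

section Affine

variable {E : Type*} [NormedAddCommGroup E] [NormedSpace ℝ E] [FiniteDimensional ℝ E]
  {M : Type*} [TopologicalSpace M] [ChartedSpace E M] [IsManifold 𝓘(ℝ, E) ∞ M]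
  {g : PseudoRiemannianMetric E M} {v : SmoothVectorField E M} {U : Set M}
  {ε : ℝ} {Φ : ℝ → M → M} {p : M}

lemma IsLocalFlow.mono (h : IsLocalFlow v U ε Φ) {U' : Set M} {ε' : ℝ} (hU' : IsOpen U')
    (hε' : 0 < ε') (hU : U' ⊆ U) (hε : Ioo (-ε') ε' ⊆ Ioo (-ε) ε) : IsLocalFlow v U' ε' Φ where
  isOpen := hU'
  pos := hε'
  smooth := h.smooth.mono (prod_mono hε hU)
  zero x hx := h.zero x (hU hx)
  integralCurve x hx := (h.integralCurve x (hU hx)).mono hε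

/-- If the connection is invariant, then it is preserved by the flow, in a chart. -/
lemma IsLocalFlow.flowTensor_eq_zero (h : IsLocalFlow v U ε Φ)
    (hP : ∀ e ∈ chartDom E p, ∀ x y, lieConn (locVec (fun y ↦ v y) p) (locConn g p) e x y = 0)
    {δ K : ℝ} {e : E} (hdom : ∀ t ∈ Ioo (-δ) δ, (t, e) ∈ flowDom Φ U ε p ∧
      ‖fderiv ℝ (locVec (fun y ↦ v y) p) (flowChart Φ p (t, e))‖ ≤ K)
    {t : ℝ} (ht : t ∈ Ioo (-δ) δ) (x y : E) :
    flowTensor (locConn g p) (flowChart Φ p) x y (t, e) = 0 := by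
  have hδ : 0 < δ := by linarith [ht.1, ht.2]
  have h0 : (0 : ℝ) ∈ Ioo (-δ) δ := ⟨by linarith, hδ⟩
  have hev (s : ℝ) (hs : s ∈ Ioo (-δ) δ) : ∀ᶠ z in 𝓝 (s, e), z ∈ flowDom Φ U ε p :=
    h.isOpen_flowDom.mem_nhds (hdom s hs).1
  have hd (s : ℝ) (hs : s ∈ Ioo (-δ) δ) :
      HasDerivAt (fun s ↦ flowTensor (locConn g p) (flowChart Φ p) x y (s, e))
        (fderiv ℝ (locVec (fun y ↦ v y) p) (flowChart Φ p (s, e))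
          (flowTensor (locConn g p) (flowChart Φ p) x y (s, e))) s := by
    have h1 := hasDerivAt_flowTensor (Γ := locConn g p) ((hev s hs).mono fun z ↦ h.smooth_flowChart)
      ((hev s hs).mono fun z hz ↦ smooth_locVec v (IsLocalFlow.flowChart_mem hz))
      (smooth_locConn g (IsLocalFlow.flowChart_mem (hdom s hs).1))
      ((hev s hs).mono fun z hz ↦ h.dirD_flowChart hz) x y
    rw [hP _ (IsLocalFlow.flowChart_mem (hdom s hs).1), zero_add] at h1
    have e1 (t : ℝ) : ((s, e) : ℝ × E) + t • ((1 : ℝ), (0 : E)) = (s + t, e) := by simp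
    simp only [e1] at h1
    have h2 := HasDerivAt.scomp_of_eq (h := fun r : ℝ ↦ r - s) (h' := 1) s h1
      ((hasDerivAt_id s).sub_const s) (by simp)
    simpa [Function.comp_def] using h2
  -- With `L_v ∇ = 0` the flow tensor solves a homogeneous linear equation with coefficients bounded
  -- by `K` and starts at zero, so it coincides with the zero solution.
  have hu := ODE_solution_unique_of_mem_Ioo (s := fun _ ↦ univ) (K := K.toNNReal)
    (v := fun s w ↦ fderiv ℝ (locVec (fun y ↦ v y) p) (flowChart Φ p (s, e)) w)
    (f := fun s ↦ flowTensor (locConn g p) (flowChart Φ p) x y (s, e)) (g := fun _ ↦ 0)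
    (fun s hs ↦ ((ContinuousLinearMap.lipschitz _).weaken
      (by rw [← NNReal.coe_le_coe]; exact (hdom s hs).2.trans (Real.le_coe_toNNReal K))).lipschitzOnWith)
    h0 (fun s hs ↦ ⟨hd s hs, mem_univ _⟩)
    (fun s hs ↦ ⟨by simpa using hasDerivAt_const s (0 : E), mem_univ _⟩) (by
      have hz := hdom 0 h0
      refine flowTensor_time_zero ((hev 0 h0).mono fun z ↦ h.smooth_flowChart)
        (h.eventually_flowChart_zero hz.1.1.2.1 hz.1.1.2.2) x y)
  exact hu ht

lemma IsLocalFlow.mdifferentiableAt (h : IsLocalFlow v U ε Φ) {t : ℝ} (ht : t ∈ Ioo (-ε) ε)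
    {x : M} (hx : x ∈ U) : MDifferentiableAt 𝓘(ℝ, E) 𝓘(ℝ, E) (Φ t) x := by
  have h1 := h.smooth.contMDiffAt (x := (t, x)) ((isOpen_Ioo.prod h.isOpen).mem_nhds ⟨ht, hx⟩)
  have h2 : ContMDiffAt 𝓘(ℝ, E) (𝓘(ℝ, ℝ).prod 𝓘(ℝ, E)) ∞ (fun y : M ↦ (t, y)) x :=
    contMDiffAt_const.prodMk contMDiffAt_id
  exact (h1.comp x h2).mdifferentiableAt (by simp)

lemma hasFDerivAt_slice {F : ℝ × E → E} {t : ℝ} {e : E} (hF : DifferentiableAt ℝ F (t, e)) :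
    HasFDerivAt (fun e ↦ F (t, e)) (fderiv ℝ F (t, e) ∘L ContinuousLinearMap.inr ℝ ℝ E) e :=
  hF.hasFDerivAt.comp e (hasFDerivAt_prodMk_right t e)

/-- The differential of a local flow in a chart. -/
lemma IsLocalFlow.coordComp_mfderiv (h : IsLocalFlow v U ε Φ) {t : ℝ} {x : M}
    (hx : x ∈ (chartAt E p).source) (ht : (t, extChartAt 𝓘(ℝ, E) p x) ∈ flowDom Φ U ε p)
    (u : TangentSpace 𝓘(ℝ, E) x) :
    coordComp p (Φ t x) (mfderiv 𝓘(ℝ, E) 𝓘(ℝ, E) (Φ t) x u) =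
      dirD (0, coordComp p x u) (flowChart Φ p) (t, extChartAt 𝓘(ℝ, E) p x) := by
  have hxU : x ∈ U := by have := ht.1.2.2; rwa [chartInv_chart hx] at this
  have hΦx : Φ t x ∈ (chartAt E p).source := by have := ht.2; rwa [chartInv_chart hx] at this
  rw [coordComp_eq_mfderiv hΦx, coordComp_eq_mfderiv hx]
  have h1 := mfderiv_comp x (mdifferentiableAt_chart hΦx) (h.mdifferentiableAt ht.1.1 hxU)
  have hs := hasFDerivAt_slice (h.smooth_flowChart ht).diffAt
  have h2 := mfderiv_comp x hs.differentiableAt.mdifferentiableAt (mdifferentiableAt_chart hx)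
  have he : (extChartAt 𝓘(ℝ, E) p ∘ Φ t) =ᶠ[𝓝 x]
      ((fun e ↦ flowChart Φ p (t, e)) ∘ extChartAt 𝓘(ℝ, E) p) := by
    filter_upwards [eventually_chartInv_chart (E := E) hx] with y hy
    simp only [Function.comp_apply, flowChart, hy]
  rw [he.mfderiv_eq, h2, mfderiv_eq_fderiv, hs.fderiv] at h1
  exact (congrArg (fun L : TangentSpace 𝓘(ℝ, E) x →L[ℝ] E ↦ L u) h1).symm

/-- In the chart, the relation between the fields reads `W ∘ F = dF (Y)`. Differentiating it in
space, the failure of `F` to intertwine the covariant derivatives is the flow tensor evaluated on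
`u` and `Y`. -/
lemma IsLocalFlow.preserves (h : IsLocalFlow v U ε Φ) {t : ℝ} {U' : Set M} (hU' : IsOpen U')
    (hmem : ∀ x ∈ U', x ∈ (chartAt E p).source ∧ (t, extChartAt 𝓘(ℝ, E) p x) ∈ flowDom Φ U ε p)
    (h0 : ∀ x ∈ U', ∀ a b,
      flowTensor (locConn g p) (flowChart Φ p) a b (t, extChartAt 𝓘(ℝ, E) p x) = 0) :
    PreservesConnectionOn g (Φ t) U' := by
  intro Y W hYW x hxU hY hW u
  obtain ⟨hx, hdom⟩ := hmem x hxU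
  have hΦ (y : M) (hy : y ∈ U') : Φ t y ∈ (chartAt E p).source := by
    obtain ⟨h1, h2⟩ := hmem y hy
    have := h2.2
    rwa [chartInv_chart h1] at this
  have hf (y : M) (hy : y ∈ U') : flowChart Φ p (t, extChartAt 𝓘(ℝ, E) p y) =
      extChartAt 𝓘(ℝ, E) p (Φ t y) := by
    rw [flowChart, chartInv_chart (hmem y hy).1]
  have hloc (Z : (y : M) → TangentSpace 𝓘(ℝ, E) y) {y : M} (hy : y ∈ (chartAt E p).source) :
      locVec Z p (extChartAt 𝓘(ℝ, E) p y) = coordComp p y (Z y) := by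
    have := locVec_apply Z (chart_mem hy)
    rwa [chartInv_chart hy] at this
  have hrel (y : M) (hy : y ∈ U') : locVec W p (flowChart Φ p (t, extChartAt 𝓘(ℝ, E) p y)) =
      dirD (0, locVec Y p (extChartAt 𝓘(ℝ, E) p y)) (flowChart Φ p)
        (t, extChartAt 𝓘(ℝ, E) p y) := by
    rw [hf y hy, hloc W (hΦ y hy), hYW y hy, h.coordComp_mfderiv (hmem y hy).1 (hmem y hy).2,
      hloc Y (hmem y hy).1]
  set e := extChartAt 𝓘(ℝ, E) p x with he
  have heD : e ∈ chartDom E p := chart_mem hx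
  have hev : ∀ᶠ e' in 𝓝 e, locVec W p (flowChart Φ p (t, e')) =
      fderiv ℝ (flowChart Φ p) (t, e') (0, locVec Y p e') := by
    have h1 : ∀ᶠ e' in 𝓝 e, chartInv E p e' ∈ U' := by
      apply (continuousAt_chartInv heD).eventually
      rw [he, chartInv_chart hx]
      exact hU'.mem_nhds hxU
    filter_upwards [h1, eventually_chartDom heD] with e' h1 h2
    have := hrel _ h1
    rwa [chart_chartInv h2] at this
  have hF := h.smooth_flowChart hdom
  have hYd := vfDiffAt_locVec hx hY
  have hWd : DifferentiableAt ℝ (locVec W p) (flowChart Φ p (t, e)) := by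
    rw [hf x hxU]; exact vfDiffAt_locVec (hΦ x hxU) hW
  set w := coordComp p x u with hw
  have d1 := hasDerivAt_line (hWd.hasFDerivAt.comp e
    (hasFDerivAt_slice hF.diffAt)).differentiableAt w
  rw [(hWd.hasFDerivAt.comp e (hasFDerivAt_slice hF.diffAt)).fderiv] at d1
  have d2 : HasDerivAt (fun s : ℝ ↦ fderiv ℝ (flowChart Φ p) (t, e + s • w)
      (0, locVec Y p (e + s • w))) (fderiv ℝ (fderiv ℝ (flowChart Φ p)) (t, e) (0, w)
        (0, locVec Y p e) + fderiv ℝ (flowChart Φ p) (t, e) (0, fderiv ℝ (locVec Y p) e w)) 0 := by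
    have a1 := hasDerivAt_line (contDiffAt_fderiv hF).diffAt ((0 : ℝ), w)
    have e1 (s : ℝ) : ((t, e) : ℝ × E) + s • ((0 : ℝ), w) = (t, e + s • w) := by simp
    simp only [e1] at a1
    have a2 := (hasDerivAt_const (0 : ℝ) (0 : ℝ)).prodMk (hasDerivAt_line hYd w)
    have a3 := a1.clm_apply a2
    rw [zero_smul, add_zero] at a3
    exact a3
  have key := deriv_line_unique (a := fun e' ↦ locVec W p (flowChart Φ p (t, e')))
    (b := fun e' ↦ fderiv ℝ (flowChart Φ p) (t, e') (0, locVec Y p e')) d1 d2 hev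
  have hT := h0 x hxU w (locVec Y p e)
  apply coordComp_injective (hΦ x hxU)
  rw [h.coordComp_mfderiv hx hdom, coordComp_leviCivita g hx hY,
    coordComp_leviCivita g (hΦ x hxU) hW, h.coordComp_mfderiv hx hdom, ← hf x hxU, ← hloc W (hΦ x hxU),
    ← hf x hxU, hrel x hxU, ← hloc Y hx]
  have e2 : dirD (0, w) (flowChart Φ p) (t, e) =
      (fderiv ℝ (flowChart Φ p) (t, e) ∘L ContinuousLinearMap.inr ℝ ℝ E) w := rfl
  have e3 : fderiv ℝ (locVec W p) (flowChart Φ p (t, e)) (dirD (0, w) (flowChart Φ p) (t, e)) =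
      _ := key
  rw [flowTensor, dirD_dirD hF] at hT
  rw [e3]
  have e4 : ((0 : ℝ), fderiv ℝ (locVec Y p) e w + locConn g p e w (locVec Y p e)) =
      (0, fderiv ℝ (locVec Y p) e w) + (0, locConn g p e w (locVec Y p e)) := by simp
  rw [dirD, e4, map_add, ← sub_eq_zero, ← neg_eq_zero, ← hT]
  abel

/-- A vector field leaving the Levi-Civita connection invariant is affine. -/
lemma isAffine_of_lieConn (hflow : ∀ p : M, ∃ U ε Φ, p ∈ U ∧ IsLocalFlow v U ε Φ)
    (hP : ∀ p e, e ∈ chartDom E p → ∀ x y,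
      lieConn (locVec (fun y ↦ v y) p) (locConn g p) e x y = 0) : IsAffine g v := by
  intro p
  obtain ⟨U, ε, Φ, hp, h⟩ := hflow p
  have hx := mem_chart_source E p
  set e₀ := extChartAt 𝓘(ℝ, E) p p with he₀
  have heD : e₀ ∈ chartDom E p := chart_mem hx
  have hz := h.zero_mem_flowDom heD (by rwa [he₀, chartInv_chart hx])
  -- One more than the value at `(0, e₀)`: by continuity it bounds the coefficient of the linear
  -- equation on a whole product neighbourhood, which yields one time interval for all nearby
  -- points.
  set K := ‖fderiv ℝ (locVec (fun y ↦ v y) p) (flowChart Φ p (0, e₀))‖ + 1 with hK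
  have hc : ContinuousAt (fun z ↦ ‖fderiv ℝ (locVec (fun y ↦ v y) p) (flowChart Φ p z)‖) (0, e₀) :=
    ((contDiffAt_fderiv (smooth_locVec v (IsLocalFlow.flowChart_mem hz))).continuousAt.comp
      (h.smooth_flowChart hz).continuousAt).norm
  have hev : ∀ᶠ z in 𝓝 ((0 : ℝ), e₀), z ∈ flowDom Φ U ε p ∧
      ‖fderiv ℝ (locVec (fun y ↦ v y) p) (flowChart Φ p z)‖ ≤ K := by
    filter_upwards [h.isOpen_flowDom.mem_nhds hz, hc.eventually (gt_mem_nhds (lt_add_one _))]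
      with z h1 h2 using ⟨h1, h2.le⟩
  obtain ⟨δ, hδ, hδb⟩ := Metric.eventually_nhds_iff.1 hev
  have hball (t : ℝ) (ht : t ∈ Ioo (-δ) δ) (e : E) (he : e ∈ Metric.ball e₀ δ) :=
    hδb (y := (t, e)) (by
      rw [Prod.dist_eq, max_lt_iff]
      exact ⟨by simpa [Real.dist_eq, abs_lt] using ht, he⟩)
  have h0 : (0 : ℝ) ∈ Ioo (-δ) δ := ⟨by simpa using hδ, hδ⟩
  set U' := (chartAt E p).source ∩ extChartAt 𝓘(ℝ, E) p ⁻¹' Metric.ball e₀ δ with hU'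
  have hU'o : IsOpen U' := by
    have := (continuousOn_extChartAt (I := 𝓘(ℝ, E)) p).isOpen_inter_preimage
      (isOpen_extChartAt_source p) (Metric.isOpen_ball (x := e₀) (ε := δ))
    rwa [extChartAt_source] at this
  refine ⟨U', δ, Φ, ⟨hx, Metric.mem_ball_self hδ⟩, h.mono hU'o hδ ?_ ?_, ?_⟩
  · rintro x ⟨h1, h2⟩
    have := (hball 0 h0 _ h2).1.1.2.2
    rwa [chartInv_chart h1] at this
  · intro t ht
    exact (hball t ht e₀ (Metric.mem_ball_self hδ)).1.1.1
  · intro t ht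
    refine h.preserves (p := p) hU'o (fun x hx ↦ ⟨hx.1, (hball t ht _ hx.2).1⟩) fun x hx a b ↦ ?_
    exact h.flowTensor_eq_zero (hP p) (fun s hs ↦ hball s hs _ hx.2) ht a b

end Affine

/-! ### Degree of mobility two: the quadratic evolution equation -/

section DegreeTwo

variable {E : Type*} [NormedAddCommGroup E] [NormedSpace ℝ E] [FiniteDimensional ℝ E]
  {M : Type*} [TopologicalSpace M] [ChartedSpace E M] [IsManifold 𝓘(ℝ, E) ∞ M]
  {g : PseudoRiemannianMetric E M} {J : EndField E M} {v : SmoothVectorField E M}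

lemma locEnd_id {p : M} {e : E} (he : e ∈ chartDom E p) :
    locEnd (fun y : M ↦ ContinuousLinearMap.id ℝ (TangentSpace 𝓘(ℝ, E) y)) p e =
      ContinuousLinearMap.id ℝ E := by
  ext a
  obtain ⟨u, rfl⟩ := coordComp_surjective (chartInv_mem he) a
  rw [locEnd_apply _ _ he]
  rfl

lemma eventually_locEnd_id {p : M} {e : E} (he : e ∈ chartDom E p) :
    locEnd (fun y : M ↦ ContinuousLinearMap.id ℝ (TangentSpace 𝓘(ℝ, E) y)) p =ᶠ[𝓝 e]
      fun _ ↦ ContinuousLinearMap.id ℝ E := by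
  filter_upwards [eventually_chartDom he] with y hy using locEnd_id hy

variable (E M) in
/-- The identity as an endomorphism field. -/
def idField : EndField E M :=
  endFieldOfLocal (fun y ↦ ContinuousLinearMap.id ℝ (TangentSpace 𝓘(ℝ, E) y)) fun _ _ he ↦
    contDiffAt_const.congr_of_eventuallyEq (eventually_locEnd_id he)

lemma idField_mem (hgJ : IsKahler g J) : idField E M ∈ cCompatible g J := by
  refine ⟨⟨fun x u w ↦ rfl, fun x u ↦ rfl⟩, mainEquation_of_covEnd hgJ fun x ↦ ⟨0, fun u a ↦ ?_⟩⟩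
  have h : locEnd (fun y ↦ idField E M y) x =ᶠ[𝓝 (extChartAt 𝓘(ℝ, E) x x)] _ :=
    eventually_locEnd_id (chart_mem (mem_chart_source E x))
  simp only [covEnd, h.fderiv_eq, h.self_of_nhds]
  simp [mainRHS]

/-- If the solution attached to `v` is trivial, then `v` is affine. -/
lemma isAffine_of_lieSolution (hgJ : IsKahler g J) (hv : IsCProjective g J v)
    (hd : 2 < Module.finrank ℝ E) {c : ℝ} (hc : lieSolution v hgJ = c • idField E M) :
    IsAffine g v := by
  refine isAffine_of_lieConn (fun p ↦ ?_) fun p e he x y ↦ ?_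
  · obtain ⟨U, ε, Φ, hp, h, -⟩ := hv p
    exact ⟨U, ε, Φ, hp, h⟩
  · have hl : locVec (lambdaField g (lieSolution v hgJ)) p e = 0 := by
      refine locMet_nondegenerate g he _ fun w ↦ ?_
      have h1 : (fun y ↦ traceL E (locEnd (fun y ↦ lieSolution v hgJ y) p y)) =ᶠ[𝓝 e]
          fun _ ↦ traceL E (c • ContinuousLinearMap.id ℝ E) := by
        filter_upwards [eventually_chartDom he] with y hy
        congr 1
        ext a
        obtain ⟨u, rfl⟩ := coordComp_surjective (chartInv_mem hy) a
        rw [locEnd_apply _ _ hy, hc]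
        exact map_smul _ _ _
      rw [locMet_lambda _ he, h1.fderiv_eq]
      simp
    rw [lieConn_eq hgJ hv hd he, hl]
    simp

/-- If the degree of mobility is two and `v` is not affine, all solutions are combinations of the
identity and the solution attached to `v`. -/
lemma exists_combination [Nonempty M] (hgJ : IsKahler g J) (hv : IsCProjective g J v)
    (hd : 2 < Module.finrank ℝ E) (hv' : ¬ IsAffine g v) (hD : degreeOfMobility g J = 2)
    {A : EndField E M} (hA : A ∈ cCompatible g J) :
    ∃ a b : ℝ, A = a • idField E M + b • lieSolution v hgJ := by
  set I : cCompatible g J := ⟨idField E M, idField_mem hgJ⟩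
  set B : cCompatible g J := ⟨lieSolution v hgJ, lieSolution_mem hgJ hv hd⟩
  have hI (s : ℝ) (hs : s • idField E M = 0) : s = 0 := by
    obtain ⟨x⟩ := ‹Nonempty M›
    have : Nontrivial E := Module.nontrivial_of_finrank_pos (R := ℝ) (by omega)
    obtain ⟨u, hu⟩ := exists_ne (0 : E)
    have := congrArg (fun C : EndField E M ↦ (C x : E →L[ℝ] E) u) hs
    exact (smul_eq_zero.1 (this : s • u = 0)).resolve_right hu
  have hli : LinearIndependent ℝ ![I, B] := by
    rw [LinearIndependent.pair_iff]
    intro s t hst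
    have h1 : s • idField E M + t • lieSolution v hgJ = 0 := congrArg Subtype.val hst
    by_cases ht : t = 0
    · subst ht
      rw [zero_smul, add_zero] at h1
      exact ⟨hI s h1, rfl⟩
    -- Dividing the relation by `t` would make `lieSolution` a constant multiple of the identity,
    -- and `v` affine.
    · refine absurd (isAffine_of_lieSolution hgJ hv hd (c := -(t⁻¹ * s)) ?_) hv'
      have h2 : lieSolution v hgJ = t⁻¹ • (t • lieSolution v hgJ) := by
        rw [smul_smul, inv_mul_cancel₀ ht, one_smul]
      rw [h2, eq_neg_of_add_eq_zero_right h1]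
      module
  have : FiniteDimensional ℝ (cCompatible g J) :=
    Module.finite_of_finrank_pos (by rw [show Module.finrank ℝ (cCompatible g J) = 2 from hD]; simp)
  have hspan := hli.span_eq_top_of_card_eq_finrank' (by rw [Fintype.card_fin]; exact hD.symm)
  have hm : (⟨A, hA⟩ : cCompatible g J) ∈ Submodule.span ℝ (range ![I, B]) := by
    rw [hspan]; trivial
  rw [Matrix.range_cons, Matrix.range_cons, Matrix.range_empty, union_empty,
    singleton_union, Submodule.mem_span_pair] at hm
  obtain ⟨a, b, hab⟩ := hm
  exact ⟨a, b, (congrArg Subtype.val hab).symm⟩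

/-- The solution attached to `v` satisfies a quadratic evolution equation along `v`. -/
lemma exists_quadratic [Nonempty M] (hgJ : IsKahler g J) (hv : IsCProjective g J v)
    (hd : 2 < Module.finrank ℝ E) (hv' : ¬ IsAffine g v) (hD : degreeOfMobility g J = 2) :
    ∃ b c : ℝ, ∀ p e, e ∈ chartDom E p →
      lieEnd (locVec (fun y ↦ v y) p) (locEnd (fun y ↦ lieSolution v hgJ y) p) e =
        locEnd (fun y ↦ lieSolution v hgJ y) p e ∘L locEnd (fun y ↦ lieSolution v hgJ y) p e
        + b • locEnd (fun y ↦ lieSolution v hgJ y) p e + c • ContinuousLinearMap.id ℝ E := by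
  have hB := lieSolution_mem hgJ hv hd
  -- The variation is applied to `lieSolution` itself, so its product term becomes the square.
  obtain ⟨c, b, h⟩ := exists_combination hgJ hv hd hv' hD (variation_mem hgJ hv hd hB)
  refine ⟨b, c, fun p e he ↦ ?_⟩
  have h1 := locEnd_variation (v := v) hgJ hB.2 he
  rw [eq_sub_iff_add_eq] at h1
  rw [← h1, h]
  ext a
  obtain ⟨u, rfl⟩ := coordComp_surjective (chartInv_mem he) a
  simp only [add_apply, smul_apply, ContinuousLinearMap.comp_apply, locEnd_apply _ _ he,
    ContinuousLinearMap.id_apply]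
  have e1 : (c • idField E M + b • lieSolution v hgJ) (chartInv E p e) u =
      c • u + b • lieSolution v hgJ (chartInv E p e) u := rfl
  rw [e1, map_add, map_smul, map_smul]
  abel

end DegreeTwo

/-! ### Complex eigenvalues of real endomorphisms -/

section ComplexSpectrum

open Polynomial

variable {V : Type*} [NormedAddCommGroup V] [NormedSpace ℝ V] [FiniteDimensional ℝ V]

variable (V) in
/-- The complex matrix of an endomorphism, in a fixed basis. -/
def complexMatrix : (V →L[ℝ] V) →ₐ[ℝ]
    Matrix (Fin (Module.finrank ℝ V)) (Fin (Module.finrank ℝ V)) ℂ :=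
  (Algebra.ofId ℝ ℂ).mapMatrix.comp
    ((LinearMap.toMatrixAlgEquiv (Module.finBasis ℝ V)).toAlgHom.comp
      ({ ContinuousLinearMap.toLinearMapRingHom with commutes' := fun _ ↦ rfl } :
        (V →L[ℝ] V) →ₐ[ℝ] (V →ₗ[ℝ] V)))

lemma complexMatrix_apply (a : V →L[ℝ] V) : complexMatrix V a =
    (LinearMap.toMatrix (Module.finBasis ℝ V) (Module.finBasis ℝ V) a.toLinearMap).map
      (algebraMap ℝ ℂ) := rfl

lemma continuous_complexMatrix : Continuous (complexMatrix V) :=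
  (complexMatrix V).toLinearMap.continuous_of_finiteDimensional

lemma charpoly_complexMatrix (a : V →L[ℝ] V) : (complexMatrix V a).charpoly =
    (LinearMap.charpoly a.toLinearMap).map (algebraMap ℝ ℂ) := by
  rw [complexMatrix_apply, Matrix.charpoly_map, LinearMap.charpoly_toMatrix]

lemma trace_complexMatrix (a : V →L[ℝ] V) : (complexMatrix V a).trace = (traceL V a : ℂ) := by
  rw [traceL_apply, LinearMap.trace_eq_matrix_trace ℝ (Module.finBasis ℝ V), complexMatrix_apply]
  exact (AddMonoidHom.map_trace (algebraMap ℝ ℂ) _).symm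

lemma complexMatrix_aeval (a : V →L[ℝ] V) (r : ℝ[X]) :
    complexMatrix V (aeval a r) = aeval (complexMatrix V a) (r.map (algebraMap ℝ ℂ)) := by
  rw [aeval_map_algebraMap, aeval_algHom_apply]

/-- The complex eigenvalues of a real endomorphism. -/
def complexSpectrum (a : V →L[ℝ] V) : Set ℂ := {z | aeval z (LinearMap.charpoly a.toLinearMap) = 0}

lemma mem_complexSpectrum_iff {a : V →L[ℝ] V} {z : ℂ} :
    z ∈ complexSpectrum a ↔ z ∈ spectrum ℂ (complexMatrix V a) := by
  rw [Matrix.mem_spectrum_iff_isRoot_charpoly, charpoly_complexMatrix, IsRoot.def, eval_map_algebraMap]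
  rfl

lemma conj_mem_complexSpectrum {a : V →L[ℝ] V} {z : ℂ} (hz : z ∈ complexSpectrum a) :
    (starRingEnd ℂ) z ∈ complexSpectrum a := by
  have := congrArg (starRingEnd ℂ) (show aeval z _ = 0 from hz)
  rw [map_zero] at this
  rw [complexSpectrum, mem_ofPred_eq, ← this]
  exact (aeval_algHom_apply Complex.conjAe.toAlgHom z _)

lemma mem_complexSpectrum_aeval [Nontrivial V] {a : V →L[ℝ] V} {r : ℝ[X]} {z : ℂ} :
    z ∈ complexSpectrum (aeval a r) ↔ ∃ w ∈ complexSpectrum a, aeval w r = z := by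
  have : Nonempty (Fin (Module.finrank ℝ V)) := ⟨⟨0, Module.finrank_pos⟩⟩
  rw [mem_complexSpectrum_iff, complexMatrix_aeval, spectrum.map_polynomial_aeval_of_nonempty _ _
    (spectrum.nonempty_of_isAlgClosed_of_finiteDimensional ℂ _)]
  simp only [mem_image, mem_complexSpectrum_iff, eval_map_algebraMap]

variable (V) in
-- Eigenvalues are bounded by the norm of the complex matrix, which depends linearly and hence
-- boundedly on `a`. The constant is independent of `a`, as both the quadratic estimate and
-- compactness require.
lemma exists_complexSpectrum_bound :
    ∃ K : ℝ, 0 < K ∧ ∀ (a : V →L[ℝ] V) (z : ℂ), z ∈ complexSpectrum a → ‖z‖ ≤ K * ‖a‖ := by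
  let n1 : NormedRing (Matrix (Fin (Module.finrank ℝ V)) (Fin (Module.finrank ℝ V)) ℂ) :=
    Matrix.linftyOpNormedRing
  let n2 : NormedAlgebra ℂ (Matrix (Fin (Module.finrank ℝ V)) (Fin (Module.finrank ℝ V)) ℂ) :=
    Matrix.linftyOpNormedAlgebra
  let n3 : NormedAlgebra ℝ (Matrix (Fin (Module.finrank ℝ V)) (Fin (Module.finrank ℝ V)) ℂ) :=
    Matrix.linftyOpNormedAlgebra
  have : CompleteSpace (Matrix (Fin (Module.finrank ℝ V)) (Fin (Module.finrank ℝ V)) ℂ) :=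
    FiniteDimensional.complete ℂ _
  obtain ⟨C, hC, h⟩ := (LinearMap.toContinuousLinearMap (complexMatrix V).toLinearMap).bound
  set N := ‖(1 : Matrix (Fin (Module.finrank ℝ V)) (Fin (Module.finrank ℝ V)) ℂ)‖
  refine ⟨C * (N + 1), by positivity, fun a z hz ↦ ?_⟩
  have h1 := spectrum.norm_le_norm_mul_of_mem (mem_complexSpectrum_iff.1 hz)
  have h2 : ‖complexMatrix V a‖ ≤ C * ‖a‖ := h a
  have h3 : 0 ≤ C * ‖a‖ := by positivity
  calc ‖z‖ ≤ ‖complexMatrix V a‖ * N := h1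
    _ ≤ (C * ‖a‖) * (N + 1) := by gcongr; linarith
    _ = _ := by ring

/-- The trace is the sum of the real parts of the complex eigenvalues, counted with multiplicity. -/
lemma traceL_le {w : V →L[ℝ] V} {c : ℝ} (h : ∀ z ∈ complexSpectrum w, z.re ≤ c) :
    traceL V w ≤ Module.finrank ℝ V * c := by
  have h1 : (traceL V w : ℂ) = ((complexMatrix V w).charpoly.roots).sum := by
    rw [← trace_complexMatrix, Matrix.trace_eq_sum_roots_charpoly]
  have h2 : traceL V w = ((complexMatrix V w).charpoly.roots.map Complex.re).sum := by
    have := congrArg Complex.reAddGroupHom h1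
    rw [map_multiset_sum] at this
    exact this
  have h3 := Multiset.sum_le_card_nsmul ((complexMatrix V w).charpoly.roots.map Complex.re) c (by
    intro x hx
    obtain ⟨z, hz, rfl⟩ := Multiset.mem_map.1 hx
    exact h z (mem_complexSpectrum_iff.2
      (Matrix.mem_spectrum_iff_isRoot_charpoly.2 (isRoot_of_mem_roots hz))))
  rw [h2]
  refine h3.trans_eq ?_
  rw [Multiset.card_map, IsAlgClosed.card_roots_eq_natDegree, Matrix.charpoly_natDegree_eq_dim,
    Fintype.card_fin, nsmul_eq_mul]

/-- A complex polynomial is a complex combination of two real polynomials. -/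
lemma exists_real_polynomials (θ : ℂ[X]) : ∃ θ₁ θ₂ : ℝ[X],
    θ = θ₁.map (algebraMap ℝ ℂ) + C Complex.I * θ₂.map (algebraMap ℝ ℂ) := by
  induction θ using Polynomial.induction_on' with
  | add p q hp hq =>
    obtain ⟨p₁, p₂, hp⟩ := hp
    obtain ⟨q₁, q₂, hq⟩ := hq
    refine ⟨p₁ + q₁, p₂ + q₂, ?_⟩
    rw [hp, hq, Polynomial.map_add, Polynomial.map_add]
    ring
  | monomial n a =>
    refine ⟨monomial n a.re, monomial n a.im, ?_⟩
    rw [map_monomial, map_monomial, C_mul_monomial, ← map_add]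
    congr 1
    rw [mul_comm]
    exact (Complex.re_add_im a).symm

/-- The sum of a complex polynomial and its conjugate is real. -/
lemma exists_real_polynomial (f : ℂ[X]) : ∃ r : ℝ[X],
    r.map (algebraMap ℝ ℂ) = f + f.map (starRingEnd ℂ) := by
  induction f using Polynomial.induction_on' with
  | add p q hp hq =>
    obtain ⟨p₁, hp⟩ := hp
    obtain ⟨q₁, hq⟩ := hq
    refine ⟨p₁ + q₁, ?_⟩
    rw [Polynomial.map_add, Polynomial.map_add, hp, hq]
    ring
  | monomial n a =>
    refine ⟨monomial n (2 * a.re), ?_⟩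
    rw [map_monomial, map_monomial, ← map_add]
    congr 1
    rw [Complex.add_conj]
    simp

lemma exists_factor {χ : ℂ[X]} (hχ : χ ≠ 0) (z : ℂ) :
    ∃ (m : ℕ) (q : ℂ[X]), χ = (X - C z) ^ m * q ∧ IsCoprime (X - C z) q := by
  obtain ⟨q, h1, h2⟩ := exists_eq_pow_rootMultiplicity_mul_and_not_dvd χ hχ z
  exact ⟨_, q, h1, (irreducible_X_sub_C z).coprime_iff_not_dvd.2 h2⟩

lemma eval_ne_zero_of_isCoprime {q : ℂ[X]} {z : ℂ} (h : IsCoprime (X - C z) q) :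
    q.eval z ≠ 0 := by
  obtain ⟨a, b, hab⟩ := h
  intro h0
  have := congrArg (eval z) hab
  simp [h0] at this

/-- If all traces `tr (θ(a) w(a))` vanish, then `w` vanishes on the spectrum of `a`. -/
lemma aeval_eq_zero_of_trace [Nontrivial V] {a : V →L[ℝ] V} {w : ℝ[X]} {z : ℂ}
    (hz : z ∈ complexSpectrum a) (h : ∀ θ : ℝ[X], traceL V (aeval a (θ * w)) = 0) :
    aeval z w = 0 := by
  have : Nonempty (Fin (Module.finrank ℝ V)) := ⟨⟨0, Module.finrank_pos⟩⟩
  set W := w.map (algebraMap ℝ ℂ) with hW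
  set N := complexMatrix V a with hN
  -- By linearity the hypothesis extends from real to complex multipliers, which is necessary to
  -- isolate the single eigenvalue `z`.
  have h1 (θ : ℂ[X]) : (aeval N (θ * W)).trace = 0 := by
    obtain ⟨θ₁, θ₂, hθ⟩ := exists_real_polynomials θ
    have h2 (t : ℝ[X]) : (aeval N (t.map (algebraMap ℝ ℂ) * W)).trace = 0 := by
      rw [hW, ← Polynomial.map_mul, hN, ← complexMatrix_aeval, trace_complexMatrix, h]
      rfl
    rw [hθ, add_mul, map_add, Matrix.trace_add, h2, mul_assoc, C_mul', map_smul, Matrix.trace_smul,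
      h2, smul_zero, add_zero]
  have hχ : (N.charpoly) ≠ 0 := (Matrix.charpoly_monic N).ne_zero
  obtain ⟨m, q, hq, hc⟩ := exists_factor hχ z
  -- The factor `q` vanishes at all eigenvalues other than `z` but not at `z`. So `R` has at most
  -- one nonzero eigenvalue, `q(z) w(z)`, and its trace is this value times a positive multiplicity
  -- unless the value is zero.
  set R := aeval N (q * W) with hR
  have hspec : spectrum ℂ R = (fun k ↦ eval k (q * W)) '' spectrum ℂ N :=
    spectrum.map_polynomial_aeval_of_nonempty _ _
      (spectrum.nonempty_of_isAlgClosed_of_finiteDimensional ℂ _)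
  have hroots (μ : ℂ) (hμ : μ ∈ R.charpoly.roots) : μ = 0 ∨ μ = eval z (q * W) := by
    have h3 := Matrix.mem_spectrum_iff_isRoot_charpoly.2 (isRoot_of_mem_roots hμ)
    rw [hspec] at h3
    obtain ⟨k, hk, rfl⟩ := h3
    have h4 := Matrix.mem_spectrum_iff_isRoot_charpoly.1 hk
    rw [hq, IsRoot.def, eval_mul, mul_eq_zero] at h4
    rcases h4 with h4 | h4
    · right
      rw [eval_pow, eval_sub, eval_X, eval_C] at h4
      rw [sub_eq_zero.1 (eq_zero_of_pow_eq_zero h4)]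
    · left
      simp [h4]
  by_contra hne
  have hval : eval z (q * W) ≠ 0 := by
    rw [eval_mul]
    refine mul_ne_zero (eval_ne_zero_of_isCoprime hc) ?_
    rwa [hW, eval_map_algebraMap]
  have htr : R.charpoly.roots.sum = R.charpoly.roots.count (eval z (q * W)) • eval z (q * W) :=
    Multiset.sum_eq_nsmul_single _ fun μ hμ hmem ↦ (hroots μ hmem).resolve_right hμ
  have h6 := h1 q
  rw [← hR, Matrix.trace_eq_sum_roots_charpoly, htr, nsmul_eq_mul, mul_eq_zero] at h6
  have h7 : eval z (q * W) ∈ R.charpoly.roots := by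
    rw [mem_roots (Matrix.charpoly_monic R).ne_zero, ← Matrix.mem_spectrum_iff_isRoot_charpoly, hspec]
    exact ⟨z, mem_complexSpectrum_iff.1 hz, rfl⟩
  have h8 := Multiset.count_pos.2 h7
  rcases h6 with h6 | h6
  · have : R.charpoly.roots.count (eval z (q * W)) = 0 := by exact_mod_cast h6
    omega
  · exact hval h6

end ComplexSpectrum

/-! ### Test polynomials for extremal eigenvalues -/

section SpectralMaximum

open Polynomial

lemma exists_eval_bound (f : ℂ[X]) (R : ℝ) : ∃ B : ℝ, 0 < B ∧ ∀ z : ℂ, ‖z‖ ≤ R → ‖f.eval z‖ ≤ B := by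
  obtain ⟨B, hB⟩ := (isCompact_closedBall (0 : ℂ) R).exists_bound_of_continuousOn
    f.continuous.continuousOn
  exact ⟨max B 1, by positivity, fun z hz ↦
    (hB z (by simpa using hz)).trans (le_max_left _ _)⟩

/-- A polynomial vanishing on the zeros of `χ`, whose derivative at the zero `z₀` is `c`, and
whose real part is at most quadratic in `χ` on the half plane `Re c (z - z₀) ≤ 0`. -/
lemma exists_test_polynomial {χ : ℂ[X]} (hχ : χ ≠ 0) {z₀ : ℂ} (hz₀ : χ.eval z₀ = 0) (c : ℂ) :
    ∃ f : ℂ[X], f.derivative.eval z₀ = c ∧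
      (∀ z, χ.eval z = 0 → f.eval z = 0) ∧
      (∀ z, χ.eval z = 0 → z ≠ z₀ → f.derivative.eval z = 0) ∧
      ∀ R : ℝ, ∃ C : ℝ, 0 ≤ C ∧ ∀ z : ℂ, ‖z‖ ≤ R → (c * (z - z₀)).re ≤ 0 →
        (f.eval z).re ≤ C * ‖χ.eval z‖ ^ 2 := by
  obtain ⟨m, q, hq, hc⟩ := exists_factor hχ z₀
  -- Bézout for `(z - z₀)^(2m)` and `q²`, the two factors of `χ²`. The test polynomial is `f = c (z
  -- - z₀) b q²`: it agrees with `c (z - z₀)` to order `2m` beyond the first at `z₀` and vanishes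
  -- doubly at the other zeros of `χ`.
  obtain ⟨α, b, hab⟩ := (hc.pow_left (m := 2 * m)).pow_right (n := 2)
  have hm : m ≠ 0 := by
    rintro rfl
    rw [hq, pow_zero, one_mul] at hz₀
    exact eval_ne_zero_of_isCoprime hc hz₀
  have hab' (z : ℂ) : α.eval z * (z - z₀) ^ (2 * m) + b.eval z * q.eval z ^ 2 = 1 := by
    simpa using congrArg (eval z) hab
  have hroot (z : ℂ) (hz : χ.eval z = 0) (hne : z ≠ z₀) : q.eval z = 0 := by
    rw [hq, eval_mul, eval_pow, eval_sub, eval_X, eval_C] at hz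
    exact (mul_eq_zero.1 hz).resolve_left (pow_ne_zero _ (sub_ne_zero.2 hne))
  refine ⟨C c * ((X - C z₀) * (b * q ^ 2)), ?_, ?_, ?_, ?_⟩
  · have := hab' z₀
    rw [sub_self, zero_pow (by omega), mul_zero, zero_add] at this
    simp [derivative_mul, this]
  · intro z hz
    by_cases hne : z = z₀
    · simp [hne]
    · simp [hroot z hz hne]
  · intro z hz hne
    simp [derivative_mul, derivative_pow, hroot z hz hne]
  · intro R
    obtain ⟨A, hA0, hA⟩ := exists_eval_bound α R
    obtain ⟨B, hB0, hB⟩ := exists_eval_bound b R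
    refine ⟨2 * ‖c‖ * (|R| + ‖z₀‖) * A * B, by positivity, fun z hz hre ↦ ?_⟩
    set s := z - z₀ with hs
    set x := ‖s‖ ^ (2 * m) with hx
    set y := ‖q.eval z‖ ^ 2 with hy
    have hS : ‖s‖ ≤ |R| + ‖z₀‖ := (norm_sub_le _ _).trans (by gcongr; exact hz.trans (le_abs_self R))
    have hP : ‖α.eval z * s ^ (2 * m)‖ ≤ A * x := by
      rw [norm_mul, norm_pow]; gcongr; exact hA z hz
    have hQ : ‖b.eval z * q.eval z ^ 2‖ ≤ B * y := by
      rw [norm_mul, norm_pow]; gcongr; exact hB z hz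
    have hχz : ‖χ.eval z‖ ^ 2 = x * y := by
      rw [hq, eval_mul, eval_pow, eval_sub, eval_X, eval_C, norm_mul, norm_pow, hx, hy]
      ring
    have hf : eval z (C c * ((X - C z₀) * (b * q ^ 2))) = c * s * (b.eval z * q.eval z ^ 2) := by
      simp only [eval_mul, eval_C, eval_sub, eval_X, eval_pow]
      ring
    have hcs : ‖c * s‖ ≤ ‖c‖ * (|R| + ‖z₀‖) := by rw [norm_mul]; gcongr
    have hK : 0 ≤ ‖c‖ * (|R| + ‖z₀‖) := by positivity
    have hx0 : 0 ≤ x := by positivity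
    have hy0 : 0 ≤ y := by positivity
    have h1 := hab' z
    rw [hχz, hf]
    have hsum : 1 ≤ ‖α.eval z * s ^ (2 * m)‖ + ‖b.eval z * q.eval z ^ 2‖ := by
      rw [← norm_one (α := ℂ), ← h1]
      exact norm_add_le _ _
    -- One of the two Bézout terms has norm at least `1/2`. If it is `b q²`, then `f = c s - c s α
    -- s^(2m)`, where the first summand has nonpositive real part, the second is of order `x`, and
    -- `1 ≤ 2 B y` inserts the factor `y`. Otherwise `f` is of order `y` and `1 ≤ 2 A x` inserts the
    -- factor `x`.
    rcases le_total (1 / 2) (‖b.eval z * q.eval z ^ 2‖) with h2 | h2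
    · have e1 : c * s * (b.eval z * q.eval z ^ 2) =
          c * s - c * s * (α.eval z * s ^ (2 * m)) := by
        linear_combination (c * s) * h1
      have h3 : 1 ≤ 2 * (B * y) := by linarith
      calc (c * s * (b.eval z * q.eval z ^ 2)).re
          = (c * s).re - (c * s * (α.eval z * s ^ (2 * m))).re := by rw [e1, Complex.sub_re]
        _ ≤ ‖c * s * (α.eval z * s ^ (2 * m))‖ := by
          have := Complex.abs_re_le_norm (c * s * (α.eval z * s ^ (2 * m)))
          have := neg_abs_le (c * s * (α.eval z * s ^ (2 * m))).re
          linarith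
        _ ≤ ‖c‖ * (|R| + ‖z₀‖) * (A * x) := by rw [norm_mul]; gcongr
        _ ≤ ‖c‖ * (|R| + ‖z₀‖) * (A * x) * (2 * (B * y)) :=
          le_mul_of_one_le_right (by positivity) h3
        _ = _ := by ring
    · have h3 : 1 ≤ 2 * (A * x) := by linarith
      calc (c * s * (b.eval z * q.eval z ^ 2)).re
          ≤ ‖c * s * (b.eval z * q.eval z ^ 2)‖ := Complex.re_le_norm _
        _ ≤ ‖c‖ * (|R| + ‖z₀‖) * (B * y) := by rw [norm_mul]; gcongr
        _ ≤ ‖c‖ * (|R| + ‖z₀‖) * (B * y) * (2 * (A * x)) :=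
          le_mul_of_one_le_right (by positivity) h3
        _ = _ := by ring

end SpectralMaximum

/-! ### Derivatives of traces of polynomials -/

section TraceDerivative

open Polynomial

variable {V : Type*} [NormedAddCommGroup V] [NormedSpace ℝ V] [FiniteDimensional ℝ V]

/-- As `B'` need not commute with `B t`, the derivative itself is not `r'(B) B'`; the two agree
inside traces against operators commuting with `B t`, by cyclicity. The factor `C` is general
because the induction on powers replaces it by `B t * C`. -/
lemma hasDerivAt_aeval {B : ℝ → V →L[ℝ] V} {B' : V →L[ℝ] V} {t : ℝ} (hB : HasDerivAt B B' t)
    (r : ℝ[X]) : ∃ D : V →L[ℝ] V, HasDerivAt (fun s ↦ aeval (B s) r) D t ∧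
      ∀ C : V →L[ℝ] V, Commute C (B t) →
        traceL V (C * D) = traceL V (C * aeval (B t) (derivative r) * B') := by
  induction r using Polynomial.induction_on' with
  | add p q hp hq =>
    obtain ⟨D₁, h1, h2⟩ := hp
    obtain ⟨D₂, h3, h4⟩ := hq
    refine ⟨D₁ + D₂, ?_, fun C hC ↦ ?_⟩
    · simp only [map_add]
      exact h1.add h3
    · rw [mul_add, map_add, h2 C hC, h4 C hC, derivative_add, map_add, mul_add, add_mul, map_add]
  | monomial n a =>
    have key : ∃ D : V →L[ℝ] V, HasDerivAt (fun s ↦ B s ^ n) D t ∧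
        ∀ C : V →L[ℝ] V, Commute C (B t) →
          traceL V (C * D) = n * traceL V (C * B t ^ (n - 1) * B') := by
      induction n with
      | zero => exact ⟨0, by simpa using hasDerivAt_const t (1 : V →L[ℝ] V), by simp⟩
      | succ n ih =>
        obtain ⟨D, h1, h2⟩ := ih
        refine ⟨D * B t + B t ^ n * B', ?_, fun C hC ↦ ?_⟩
        · simp only [pow_succ]
          exact h1.mul hB
        · have e1 : traceL V (C * (D * B t)) = traceL V ((B t * C) * D) := by
            rw [← mul_assoc, mul_assoc (B t)]
            exact traceL_comp_comm (C * D) (B t)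
          have hC' : Commute (B t * C) (B t) := (Commute.refl _).mul_left hC
          rw [mul_add, map_add, e1, h2 _ hC', Nat.add_sub_cancel, ← mul_assoc]
          rcases n with _ | n
          · simp
          · have e2 : B t * C * B t ^ (n + 1 - 1) = C * B t ^ (n + 1) := by
              rw [Nat.add_sub_cancel, ← hC.eq, mul_assoc, ← pow_succ']
            rw [e2]
            push_cast
            ring
    obtain ⟨D, h1, h2⟩ := key
    refine ⟨a • D, ?_, fun C hC ↦ ?_⟩
    · simp only [aeval_monomial, Algebra.algebraMap_eq_smul_one, smul_mul_assoc, one_mul]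
      exact h1.const_smul a
    · rw [derivative_monomial, aeval_monomial, Algebra.algebraMap_eq_smul_one, smul_mul_assoc,
        one_mul, mul_smul_comm, mul_smul_comm, smul_mul_assoc, map_smul, map_smul, h2 C hC, smul_eq_mul,
        smul_eq_mul]
      ring

lemma hasDerivAt_trace_aeval {B : ℝ → V →L[ℝ] V} {B' : V →L[ℝ] V} {t : ℝ} (hB : HasDerivAt B B' t)
    (r : ℝ[X]) : HasDerivAt (fun s ↦ traceL V (aeval (B s) r))
      (traceL V (aeval (B t) (derivative r) * B')) t := by
  obtain ⟨D, h1, h2⟩ := hasDerivAt_aeval hB r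
  have h3 := (traceL V).hasFDerivAt.comp_hasDerivAt t h1
  have h4 := h2 1 (Commute.one_left _)
  rw [one_mul, one_mul] at h4
  rwa [h4] at h3

/-- A function with a quadratic upper bound has vanishing derivative. -/
lemma deriv_eq_zero_of_le {φ : ℝ → ℝ} {d C : ℝ} (hd : HasDerivAt φ d 0) (h0 : φ 0 = 0)
    (h : ∀ᶠ t in 𝓝 0, φ t ≤ C * t ^ 2) : d = 0 := by
  have h1 : HasDerivAt (fun t ↦ φ t - C * t ^ 2) d 0 := by
    exact (hd.sub (((hasDerivAt_id (0 : ℝ)).pow 2).const_mul C)).congr_deriv (by simp)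
  have h2 : IsLocalMax (fun t ↦ φ t - C * t ^ 2) 0 := by
    filter_upwards [h] with t ht
    simp only [h0]
    linarith
  exact h2.hasDerivAt_eq_zero h1

end TraceDerivative

/-! ### Extremal eigenvalues are roots of the quadratic polynomial -/

section LocalMaximum

open Polynomial

variable {V : Type*} [NormedAddCommGroup V] [NormedSpace ℝ V] [FiniteDimensional ℝ V]

lemma aeval_self_charpoly (a : V →L[ℝ] V) : aeval a (LinearMap.charpoly a.toLinearMap) = 0 := by
  have h := aeval_algHom_apply ({ ContinuousLinearMap.toLinearMapRingHom with
    commutes' := fun _ ↦ rfl } : (V →L[ℝ] V) →ₐ[ℝ] (V →ₗ[ℝ] V)) a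
    (LinearMap.charpoly a.toLinearMap)
  have h2 : aeval a.toLinearMap (LinearMap.charpoly a.toLinearMap) = 0 :=
    LinearMap.aeval_self_charpoly _
  exact ContinuousLinearMap.coe_injective (h.symm.trans h2)

lemma eval_map_conj (f : ℂ[X]) (z : ℂ) :
    (f.map (starRingEnd ℂ)).eval z = starRingEnd ℂ (f.eval (starRingEnd ℂ z)) := by
  rw [eval_map, ← eval₂_at_apply, Complex.conj_conj]

lemma aeval_of_map_eq {r : ℝ[X]} {f : ℂ[X]}
    (hr : r.map (algebraMap ℝ ℂ) = f + f.map (starRingEnd ℂ)) (z : ℂ) :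
    aeval z r = f.eval z + starRingEnd ℂ (f.eval (starRingEnd ℂ z)) := by
  rw [← eval_map_algebraMap, hr, eval_add, eval_map_conj]

/-- By cyclicity of the trace. Under traces against polynomials in `A` it makes the ordinary,
covariant and Lie derivatives of `A` interchangeable. -/
lemma traceL_commutator {C a : V →L[ℝ] V} (h : Commute C a) (X : V →L[ℝ] V) :
    traceL V (C * (X ∘L a - a ∘L X)) = 0 := by
  have e : C * (X ∘L a - a ∘L X) = (C * X) ∘L a - (a * C) ∘L X := by
    rw [← h.eq]
    exact mul_sub C (X * a) (a * X)
  rw [e, map_sub, traceL_comp_comm (C * X) a]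
  exact sub_self _

lemma commute_aeval (a : V →L[ℝ] V) (r : ℝ[X]) : Commute (aeval a r) a := by
  have := (Commute.all r X).map (aeval a : ℝ[X] →ₐ[ℝ] _)
  rwa [aeval_X] at this

lemma commutes_aeval {a J : V →L[ℝ] V} (h : ∀ x, a (J x) = J (a x)) (r : ℝ[X]) (x : V) :
    aeval a r (J x) = J (aeval a r x) := by
  induction r using Polynomial.induction_on' with
  | add p q hp hq => simp only [map_add, add_apply, hp, hq]
  | monomial n c =>
    have h1 : Commute a J := ContinuousLinearMap.ext h
    have h2 : (a ^ n) (J x) = J ((a ^ n) x) :=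
      congrArg (fun L : V →L[ℝ] V ↦ L x) (h1.pow_left n).eq
    simp only [aeval_monomial, Algebra.algebraMap_eq_smul_one, smul_mul_assoc, one_mul, smul_apply,
      map_smul, h2]

lemma selfadjoint_aeval {G : V →L[ℝ] V →L[ℝ] ℝ} {a : V →L[ℝ] V}
    (h : ∀ x y, G (a x) y = G x (a y)) (r : ℝ[X]) (x y : V) :
    G (aeval a r x) y = G x (aeval a r y) := by
  induction r using Polynomial.induction_on' with
  | add p q hp hq => simp only [map_add, add_apply, hp, hq]
  | monomial n c =>
    have key : ∀ x y, G ((a ^ n) x) y = G x ((a ^ n) y) := by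
      induction n with
      | zero => simp
      | succ n ih =>
        intro x y
        have e1 : (a ^ (n + 1)) x = (a ^ n) (a x) := rfl
        have e2 : (a ^ (n + 1)) y = a ((a ^ n) y) := by rw [pow_succ']; rfl
        rw [e1, e2, ih, h]
    simp only [aeval_monomial, Algebra.algebraMap_eq_smul_one, smul_mul_assoc, one_mul, smul_apply,
      map_smul, key]

variable [Nontrivial V]

/-- The trace of a polynomial function of a family of endomorphisms, whose spectra lie in a
half plane touched by the spectrum at time zero, is critical. -/
lemma exists_critical_polynomial {a : V →L[ℝ] V} {z₀ : ℂ} (hz₀ : z₀ ∈ complexSpectrum a) {c : ℂ}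
    (hc : c ≠ 0) (hc' : z₀.im = 0 → c.re ≠ 0) : ∃ r : ℝ[X], aeval z₀ (derivative r) ≠ 0 ∧
      ∀ (B : ℝ → V →L[ℝ] V) (B' : V →L[ℝ] V), HasDerivAt B B' 0 → B 0 = a →
        (∀ᶠ t in 𝓝 0, ∀ z ∈ complexSpectrum (B t), (c * (z - z₀)).re ≤ 0) →
        traceL V (aeval a (derivative r) * B') = 0 := by
  set χr := LinearMap.charpoly a.toLinearMap with hχr
  set χ : ℂ[X] := χr.map (algebraMap ℝ ℂ) with hχ
  have hχ0 : χ ≠ 0 := ((LinearMap.charpoly_monic a.toLinearMap).map _).ne_zero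
  have hχe (z : ℂ) : χ.eval z = aeval z χr := eval_map_algebraMap _ _
  have hspec (z : ℂ) (hz : z ∈ complexSpectrum a) : χ.eval z = 0 := (hχe z).trans hz
  obtain ⟨f, hf1, hf2, hf3, hf4⟩ := exists_test_polynomial hχ0 (hspec z₀ hz₀) c
  obtain ⟨r, hr⟩ := exists_real_polynomial f
  have hre := aeval_of_map_eq hr
  refine ⟨r, ?_, fun B B' hB hBa hmax ↦ ?_⟩
  · have hr' : (derivative r).map (algebraMap ℝ ℂ) =
        derivative f + (derivative f).map (starRingEnd ℂ) := by
      rw [← derivative_map, hr, derivative_add, derivative_map]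
    rw [aeval_of_map_eq hr', hf1]
    -- Here `r` is `f` plus its conjugate. At a real `z₀` the derivative is twice the real part of
    -- `c`; at a nonreal one the conjugate term vanishes, since `f'` is zero at the eigenvalue
    -- conjugate to `z₀`, and the derivative is `c`.
    by_cases h0 : starRingEnd ℂ z₀ = z₀
    · rw [h0, hf1, Complex.add_conj]
      have := hc' (Complex.conj_eq_iff_im.1 h0)
      exact_mod_cast mul_ne_zero two_ne_zero this
    · rw [hf3 _ (hspec _ (conj_mem_complexSpectrum hz₀)) h0]
      simpa using hc
  · obtain ⟨K, hK0, hK⟩ := exists_complexSpectrum_bound V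
    obtain ⟨C, hC0, hC⟩ := hf4 (K * (‖a‖ + 1))
    have hφ := hasDerivAt_trace_aeval hB r
    rw [hBa] at hφ
    have hra (z : ℂ) (hz : z ∈ complexSpectrum a) : aeval z r = 0 := by
      rw [hre, hf2 _ (hspec z hz), hf2 _ (hspec _ (conj_mem_complexSpectrum hz))]
      simp
    have h0 : traceL V (aeval (B 0) r) = 0 := by
      rw [hBa]
      apply le_antisymm
      · refine (traceL_le (c := 0) fun z hz ↦ ?_).trans_eq (mul_zero _)
        obtain ⟨w, hw, rfl⟩ := mem_complexSpectrum_aeval.1 hz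
        rw [hra w hw]
        rfl
      · rw [← neg_nonpos, ← map_neg, ← map_neg]
        refine (traceL_le (c := 0) fun z hz ↦ ?_).trans_eq (mul_zero _)
        obtain ⟨w, hw, rfl⟩ := mem_complexSpectrum_aeval.1 hz
        rw [map_neg, hra w hw]
        simp
    -- By Cayley–Hamilton the curve `χ(B t)` vanishes at zero, so it is of order `t`, and so is `χ`
    -- at every eigenvalue of `B t`. The test polynomial then has real part at most of order `t²`
    -- there. This avoids any differentiability of eigenvalues.
    obtain ⟨D, hD, -⟩ := hasDerivAt_aeval hB χr
    obtain ⟨L, hL0, hL⟩ := hD.isBigO_sub.exists_pos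
    have hnorm : ∀ᶠ t in 𝓝 0, ‖B t‖ < ‖a‖ + 1 := by
      have := hB.continuousAt.norm
      rw [ContinuousAt, hBa] at this
      exact this.eventually (gt_mem_nhds (lt_add_one _))
    -- The factor `2` stems from `f` and its conjugate in `r`, and the dimension from summing over
    -- eigenvalues.
    refine deriv_eq_zero_of_le (C := Module.finrank ℝ V * (2 * C * (K * L) ^ 2)) hφ h0 ?_
    filter_upwards [hL.bound, hnorm, hmax] with t ht1 ht2 ht3
    rw [mul_assoc]
    refine traceL_le fun z hz ↦ ?_
    obtain ⟨w, hw, rfl⟩ := mem_complexSpectrum_aeval.1 hz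
    rw [hBa, aeval_self_charpoly, sub_zero, sub_zero] at ht1
    have bound (w : ℂ) (hw : w ∈ complexSpectrum (B t)) :
        (f.eval w).re ≤ C * (K * L) ^ 2 * t ^ 2 := by
      have b1 : ‖w‖ ≤ K * (‖a‖ + 1) := (hK _ _ hw).trans (by gcongr)
      have b2 : ‖χ.eval w‖ ≤ K * (L * ‖t‖) := by
        rw [hχe]
        exact (hK _ _ (mem_complexSpectrum_aeval.2 ⟨w, hw, rfl⟩)).trans (by gcongr)
      calc (f.eval w).re ≤ C * ‖χ.eval w‖ ^ 2 := hC w b1 (ht3 w hw)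
        _ ≤ C * (K * (L * ‖t‖)) ^ 2 := by gcongr
        _ = C * (K * L) ^ 2 * t ^ 2 := by
          rw [mul_pow, mul_pow, Real.norm_eq_abs, sq_abs]; ring
    have c1 := bound w hw
    have c2 := bound _ (conj_mem_complexSpectrum hw)
    rw [hre, Complex.add_re, Complex.conj_re]
    linarith

/-- Criticality of `tr r(A)` in all directions annihilates `r'(A) l`, because the main equation
turns traces against `∂_u A` into pairings with `l`. The same mechanism applied to `L_v A = Q(A)`
kills all traces `tr (θ(A) r'(A) Q(A))`, and `r'(z₀) ≠ 0` leaves `Q(z₀) = 0`. -/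
lemma IsLocalKahler.root_of_max {Ω : Set V} {G : V → V →L[ℝ] V →L[ℝ] ℝ}
    {Γ : V → V →L[ℝ] V →L[ℝ] V} {J A : V → V →L[ℝ] V} {v : V → V} {e l : V}
    (h : IsLocalKahler Ω G Γ J) (he : e ∈ Ω)
    (hA : DifferentiableAt ℝ A e)
    (hAm : ∀ u y, covEnd Γ A e u y = mainRHS (G e) (J e) l u y)
    (hAs : ∀ a b, G e (A e a) b = G e a (A e b)) (hAJ : ∀ a, A e (J e a) = J e (A e a)) {b d : ℝ}
    (hq : lieEnd v A e = A e ∘L A e + b • A e + d • ContinuousLinearMap.id ℝ V) {z₀ c : ℂ}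
    (hz₀ : z₀ ∈ complexSpectrum (A e)) (hc : c ≠ 0) (hc' : z₀.im = 0 → c.re ≠ 0)
    (hmax : ∀ᶠ y in 𝓝 e, ∀ z ∈ complexSpectrum (A y), (c * (z - z₀)).re ≤ 0) :
    z₀ ^ 2 + b * z₀ + d = 0 := by
  obtain ⟨r, hr, hcrit⟩ := exists_critical_polynomial hz₀ hc hc'
  have htr (C : ℝ[X]) (u : V) : traceL V (aeval (A e) C * fderiv ℝ A e u) =
      4 * G e (aeval (A e) C l) u := by
    rw [← traceL_comp_mainRHS (h.symm e he) (h.invariant e he) (selfadjoint_aeval hAs C)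
      (commutes_aeval hAJ C) (hAm u)]
    have e1 : aeval (A e) C ∘L covEnd Γ A e u = aeval (A e) C * fderiv ℝ A e u
        + aeval (A e) C * (Γ e u ∘L A e - A e ∘L Γ e u) := mul_add _ _ _
    rw [e1, map_add, traceL_commutator (commute_aeval _ _), add_zero]
  have hl : aeval (A e) (derivative r) l = 0 := by
    refine h.nondegenerate e he _ fun u ↦ ?_
    have h1 := hcrit _ _ (hasDerivAt_line hA u) (by simp) (eventually_line hmax u)
    rw [htr] at h1
    linarith
  set Q : ℝ[X] := X ^ 2 + C b * X + C d with hQ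
  have hQA : aeval (A e) Q = lieEnd v A e := by
    rw [hq, hQ]
    simp only [map_add, map_mul, aeval_X, aeval_C, Algebra.algebraMap_eq_smul_one,
      smul_mul_assoc, one_mul, pow_two]
    rfl
  have hw : aeval z₀ (derivative r * Q) = 0 := by
    refine aeval_eq_zero_of_trace hz₀ fun θ ↦ ?_
    have e1 : aeval (A e) (θ * (derivative r * Q)) =
        aeval (A e) (θ * derivative r) * fderiv ℝ A e (v e)
        - aeval (A e) (θ * derivative r) * (fderiv ℝ v e ∘L A e - A e ∘L fderiv ℝ v e) := by
      rw [← mul_assoc, map_mul, hQA, lieEnd, mul_sub]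
    have e2 : aeval (A e) (θ * derivative r) l = 0 := by
      rw [map_mul]
      exact (congrArg (aeval (A e) θ) hl).trans (map_zero _)
    rw [e1, map_sub, traceL_commutator (commute_aeval _ _), sub_zero, htr, e2]
    simp
  rw [map_mul] at hw
  have := (mul_eq_zero.1 hw).resolve_left hr
  simpa [hQ] using this

end LocalMaximum

/-! ### The spectrum over a compact manifold -/

section GlobalSpectrum

open Polynomial

variable {E : Type*} [NormedAddCommGroup E] [NormedSpace ℝ E] [FiniteDimensional ℝ E]
  {M : Type*} [TopologicalSpace M] [ChartedSpace E M] [IsManifold 𝓘(ℝ, E) ∞ M]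

lemma isEigenvalueAt_iff {A : EndField E M} {p : M} {z : ℂ} :
    IsEigenvalueAt A p z ↔ z ∈ complexSpectrum (V := E) (A p) := by
  rw [IsEigenvalueAt, Module.End.hasEigenvalue_iff_isRoot_charpoly, LinearMap.charpoly_baseChange,
    IsRoot.def, eval_map_algebraMap]
  rfl

lemma complexSpectrum_locEnd (A : EndField E M) {p : M} {e : E} (he : e ∈ chartDom E p) :
    complexSpectrum (locEnd (fun y ↦ A y) p e) = complexSpectrum (V := E) (A (chartInv E p e)) := by
  let f : TangentSpace 𝓘(ℝ, E) (chartInv E p e) ≃ₗ[ℝ] E :=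
    LinearEquiv.ofLinearMap (coordComp p (chartInv E p e)).toLinearMap
      (coordFrame p (chartInv E p e)).toLinearMap
      (LinearMap.ext fun a ↦ coordComp_coordFrame (chartInv_mem he) a)
      (LinearMap.ext fun a ↦ coordFrame_coordComp (chartInv_mem he) a)
  have h : LinearMap.charpoly (locEnd (fun y ↦ A y) p e).toLinearMap =
      LinearMap.charpoly (A (chartInv E p e)).toLinearMap :=
    LinearEquiv.charpoly_conj f (A (chartInv E p e)).toLinearMap
  rw [complexSpectrum, h]
  rfl

lemma aeval_charpoly_eq_det (a : E →L[ℝ] E) (z : ℂ) :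
    aeval z (LinearMap.charpoly a.toLinearMap) =
      (Matrix.scalar _ z - complexMatrix E a).det := by
  rw [← Matrix.eval_charpoly, charpoly_complexMatrix, eval_map_algebraMap]

/-- The total spectrum of an endomorphism field. -/
def totalSpectrum (A : EndField E M) : Set (M × ℂ) :=
  {q | q.2 ∈ complexSpectrum (V := E) (A q.1)}

lemma eventually_complexSpectrum (A : EndField E M) (x₀ : M) : ∀ᶠ x in 𝓝 x₀,
    complexSpectrum (V := E) (A x) =
      complexSpectrum (locEnd (fun y ↦ A y) x₀ (extChartAt 𝓘(ℝ, E) x₀ x)) := by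
  filter_upwards [(chartAt E x₀).open_source.mem_nhds (mem_chart_source E x₀)] with x hx
  rw [complexSpectrum_locEnd A (chart_mem hx), chartInv_chart hx]

lemma continuousAt_locEnd_chart (A : EndField E M) (x₀ : M) :
    ContinuousAt (fun x ↦ locEnd (fun y ↦ A y) x₀ (extChartAt 𝓘(ℝ, E) x₀ x)) x₀ :=
  (smooth_locEnd A (chart_mem (mem_chart_source E x₀))).continuousAt.comp
    (continuousAt_extChartAt x₀)

/-- Locally it is the zero set of the characteristic determinant, which is jointly continuous in the
point and the complex number. -/
lemma isClosed_totalSpectrum (A : EndField E M) : IsClosed (totalSpectrum A) := by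
  rw [← isOpen_compl_iff, isOpen_iff_mem_nhds]
  rintro ⟨x₀, z₀⟩ h₀
  have hc : ContinuousAt (fun q : M × ℂ ↦ (Matrix.scalar _ q.2 - complexMatrix E
      (locEnd (fun y ↦ A y) x₀ (extChartAt 𝓘(ℝ, E) x₀ q.1))).det) (x₀, z₀) := by
    have h1 : ContinuousAt (fun q : M × ℂ ↦ complexMatrix E
        (locEnd (fun y ↦ A y) x₀ (extChartAt 𝓘(ℝ, E) x₀ q.1))) (x₀, z₀) :=
      continuous_complexMatrix.continuousAt.comp
        ((continuousAt_locEnd_chart A x₀).comp (f := Prod.fst) (x := (x₀, z₀)) continuousAt_fst)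
    have h2 : Continuous fun q : M × ℂ ↦
        Matrix.scalar (Fin (Module.finrank ℝ E)) q.2 := by
      simp only [Matrix.scalar_apply]
      exact (continuous_pi fun _ ↦ continuous_snd).matrix_diagonal
    exact (Continuous.matrix_det continuous_id).continuousAt.comp (h2.continuousAt.sub h1)
  have hev := (continuousAt_fst (p := (x₀, z₀))).eventually (eventually_complexSpectrum A x₀)
  have h1 : z₀ ∉ complexSpectrum (V := E) (A x₀) := h₀
  rw [(eventually_complexSpectrum A x₀).self_of_nhds, complexSpectrum, mem_ofPred_eq,
    aeval_charpoly_eq_det] at h1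
  filter_upwards [hev, hc.eventually_ne h1] with q hq1 hq2 hq3
  have h3 : q.2 ∈ complexSpectrum (V := E) (A q.1) := hq3
  rw [hq1, complexSpectrum, mem_ofPred_eq, aeval_charpoly_eq_det] at h3
  exact hq2 h3

lemma isCompact_totalSpectrum [CompactSpace M] (A : EndField E M) :
    IsCompact (totalSpectrum A) := by
  obtain ⟨K, hK0, hK⟩ := exists_complexSpectrum_bound E
  obtain ⟨R, hR⟩ : ∃ R : ℝ, ∀ x ∈ (univ : Set M), ∀ z ∈ complexSpectrum (V := E) (A x), ‖z‖ ≤ R := by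
    refine isCompact_univ.induction_on (p := fun s ↦ ∃ R : ℝ, ∀ x ∈ s,
      ∀ z ∈ complexSpectrum (V := E) (A x), ‖z‖ ≤ R) ⟨0, by simp⟩ ?_ ?_ fun x₀ _ ↦ ?_
    · rintro s t hst ⟨R, hR⟩
      exact ⟨R, fun x hx ↦ hR x (hst hx)⟩
    · rintro s t ⟨R, hR⟩ ⟨R', hR'⟩
      refine ⟨max R R', fun x hx z hz ↦ ?_⟩
      rcases hx with hx | hx
      · exact (hR x hx z hz).trans (le_max_left _ _)
      · exact (hR' x hx z hz).trans (le_max_right _ _)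
    · have h1 := (continuousAt_locEnd_chart A x₀).norm.eventually (gt_mem_nhds (lt_add_one _))
      refine ⟨_, mem_nhdsWithin_of_mem_nhds ((eventually_complexSpectrum A x₀).and h1),
        K * (‖locEnd (fun y ↦ A y) x₀ (extChartAt 𝓘(ℝ, E) x₀ x₀)‖ + 1), ?_⟩
      rintro x ⟨hx1, hx2⟩ z hz
      rw [hx1] at hz
      exact (hK _ _ hz).trans (by gcongr)
  refine (isCompact_univ.prod (isCompact_closedBall (0 : ℂ) R)).of_isClosed_subset
    (isClosed_totalSpectrum A) fun q hq ↦ ⟨mem_univ _, ?_⟩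
  simpa using hR q.1 (mem_univ _) q.2 hq

variable {g : PseudoRiemannianMetric E M} {J : EndField E M} {v : SmoothVectorField E M}

/-- Extremal eigenvalues of a solution are zeros of the polynomial in its evolution equation. -/
lemma root_of_max [Nontrivial E] (hgJ : IsKahler g J) {A : EndField E M}
    (hA : A ∈ cCompatible g J) {b d : ℝ}
    (hq : ∀ p e, e ∈ chartDom E p → lieEnd (locVec (fun y ↦ v y) p) (locEnd (fun y ↦ A y) p) e =
        locEnd (fun y ↦ A y) p e ∘L locEnd (fun y ↦ A y) p e
        + b • locEnd (fun y ↦ A y) p e + d • ContinuousLinearMap.id ℝ E)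
    {q : M × ℂ} (hmem : q ∈ totalSpectrum A) {c : ℂ} (hc : c ≠ 0) (hc' : q.2.im = 0 → c.re ≠ 0)
    (hmax : ∀ q' ∈ totalSpectrum A, (c * q'.2).re ≤ (c * q.2).re) :
    q.2 ^ 2 + b * q.2 + d = 0 := by
  have hx := mem_chart_source E q.1
  have he : extChartAt 𝓘(ℝ, E) q.1 q.1 ∈ chartDom E q.1 := chart_mem hx
  refine (hgJ.isLocalKahler q.1).root_of_max he (smooth_locEnd A he).diffAt
    (covEnd_of_mainEquation hA.2 he) (hA.1.locMet_locEnd he) (hA.1.locEnd_commutes he)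
    (hq q.1 _ he) ?_ hc hc' ?_
  · rw [complexSpectrum_locEnd A he, chartInv_chart hx]
    exact hmem
  · filter_upwards [eventually_chartDom he] with y hy z hz
    rw [complexSpectrum_locEnd A hy] at hz
    have := hmax (chartInv E q.1 y, z) hz
    rw [mul_sub, Complex.sub_re]
    linarith

/-- A real quadratic polynomial with a nonreal root has both roots on the vertical line of real part
`-b/2`. -/
lemma re_eq_of_quadratic {b d : ℝ} {z w : ℂ} (hz : z ^ 2 + b * z + d = 0) (him : z.im ≠ 0)
    (hw : w ^ 2 + b * w + d = 0) : w.re = z.re := by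
  have hb : b = -2 * z.re := by
    have := congrArg Complex.im hz
    simp only [pow_two, Complex.add_im, Complex.mul_im, Complex.ofReal_re, Complex.ofReal_im,
      Complex.zero_im, zero_mul, add_zero] at this
    have h2 : z.im * (2 * z.re + b) = 0 := by linear_combination this
    linarith [(mul_eq_zero.1 h2).resolve_left him]
  have h : (w - z) * (w + z + b) = 0 := by linear_combination hw - hz
  rcases mul_eq_zero.1 h with h | h
  · rw [sub_eq_zero.1 h]
  · have := congrArg Complex.re h
    simp only [Complex.add_re, Complex.ofReal_re, Complex.zero_re] at this
    linarith

/-- Either all eigenvalues are real, or they all are zeros of a fixed quadratic polynomial. -/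
lemma real_or_root [CompactSpace M] [Nontrivial E] (hgJ : IsKahler g J) {A : EndField E M}
    (hA : A ∈ cCompatible g J) {b d : ℝ}
    (hq : ∀ p e, e ∈ chartDom E p → lieEnd (locVec (fun y ↦ v y) p) (locEnd (fun y ↦ A y) p) e =
        locEnd (fun y ↦ A y) p e ∘L locEnd (fun y ↦ A y) p e
        + b • locEnd (fun y ↦ A y) p e + d • ContinuousLinearMap.id ℝ E) :
    (∀ q ∈ totalSpectrum A, q.2.im = 0) ∨ ∀ q ∈ totalSpectrum A, q.2 ^ 2 + b * q.2 + d = 0 := by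
  refine or_iff_not_imp_left.2 fun hne ↦ ?_
  push Not at hne
  obtain ⟨q₁, hq₁, him⟩ := hne
  have hmax (c : ℂ) : ∃ q ∈ totalSpectrum A, ∀ q' ∈ totalSpectrum A,
      (c * q'.2).re ≤ (c * q.2).re := by
    obtain ⟨q, h1, h2⟩ := (isCompact_totalSpectrum A).exists_isMaxOn ⟨q₁, hq₁⟩
      (f := fun q : M × ℂ ↦ (c * q.2).re) (by fun_prop)
    exact ⟨q, h1, fun q' h ↦ h2 h⟩
  -- With `c = -i` the maximized quantity is the imaginary part. Its maximum is nonzero, since a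
  -- nonreal eigenvalue occurs along with its conjugate.
  obtain ⟨q₀, h0, h0'⟩ := hmax (-Complex.I)
  have him₀ : q₀.2.im ≠ 0 := by
    have a1 := h0' q₁ hq₁
    have a2 := h0' (q₁.1, starRingEnd ℂ q₁.2) (conj_mem_complexSpectrum hq₁)
    simp only [neg_mul, Complex.neg_re, Complex.I_mul_re, neg_neg, Complex.conj_im] at a1 a2
    intro h
    rw [h] at a1 a2
    exact him (le_antisymm a1 (by linarith))
  have r0 := root_of_max hgJ hA hq h0 (neg_ne_zero.2 Complex.I_ne_zero) (fun h ↦ absurd h him₀) h0'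
  -- The eigenvalues of largest and smallest real part are also roots of the quadratic, so their
  -- real parts coincide with that of `q₀.2`.
  obtain ⟨q₂, h2, h2'⟩ := hmax 1
  obtain ⟨q₃, h3, h3'⟩ := hmax (-1)
  have r2 := root_of_max hgJ hA hq h2 one_ne_zero (fun _ ↦ by simp) h2'
  have r3 := root_of_max hgJ hA hq h3 (neg_ne_zero.2 one_ne_zero) (fun _ ↦ by simp) h3'
  have e2 := re_eq_of_quadratic r0 him₀ r2
  have e3 := re_eq_of_quadratic r0 him₀ r3
  intro q hqm
  -- All real parts being equal, every eigenvalue maximizes the real part and is itself a root.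
  refine root_of_max hgJ hA hq hqm one_ne_zero (fun _ ↦ by simp) fun q' hq' ↦ ?_
  have b1 := h2' q' hq'
  have b2 := h3' q hqm
  simp only [one_mul, neg_mul, Complex.neg_re] at b1 b2 ⊢
  linarith

lemma finite_quadratic_roots (b d : ℂ) : {z : ℂ | z ^ 2 + b * z + d = 0}.Finite := by
  have hp : (X ^ 2 + C b * X + C d : ℂ[X]) ≠ 0 := by
    have : (X ^ 2 + C b * X + C d : ℂ[X]).Monic := by monicity!
    exact this.ne_zero
  refine (finite_setOfPred_isRoot hp).subset fun z hz ↦ ?_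
  simpa [IsRoot.def] using hz

lemma exists_of_mem_complexSpectrum [Nontrivial E] {a : E →L[ℝ] E} {α β : ℝ} {z : ℂ}
    (hz : z ∈ complexSpectrum (α • ContinuousLinearMap.id ℝ E + β • a)) :
    ∃ w ∈ complexSpectrum a, z = α + β * w := by
  have h : α • ContinuousLinearMap.id ℝ E + β • a = aeval a (C α + C β * X) := by
    simp only [map_add, map_mul, aeval_C, aeval_X, Algebra.algebraMap_eq_smul_one, smul_mul_assoc,
      one_mul]
    rfl
  rw [h, mem_complexSpectrum_aeval] at hz
  obtain ⟨w, hw, hw'⟩ := hz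
  exact ⟨w, hw, by simpa using hw'.symm⟩

lemma exists_of_isEigenvalueAt [Nontrivial E] {B : EndField E M} {α β : ℝ} {p : M} {z : ℂ}
    (hz : IsEigenvalueAt (α • idField E M + β • B) p z) :
    ∃ w, (p, w) ∈ totalSpectrum B ∧ z = α + β * w := by
  have h : ((α • idField E M + β • B : EndField E M) p : E →L[ℝ] E) =
      α • ContinuousLinearMap.id ℝ E + β • (show E →L[ℝ] E from B p) := rfl
  rw [isEigenvalueAt_iff, h] at hz
  exact exists_of_mem_complexSpectrum (a := (show E →L[ℝ] E from B p)) hz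

end GlobalSpectrum

end CProj

/-! ### The theorem -/

theorem mainTheorem8
    {E : Type*} [NormedAddCommGroup E] [NormedSpace ℝ E] [FiniteDimensional ℝ E]
    {M : Type*} [TopologicalSpace M] [ChartedSpace E M] [IsManifold 𝓘(ℝ, E) ∞ M]
    [T2Space M] [CompactSpace M] [ConnectedSpace M]
    (n : ℕ) (hn : 2 ≤ n) (hdim : Module.finrank ℝ E = 2 * n)
    (g : CProj.PseudoRiemannianMetric E M) (J : CProj.EndField E M)
    (hgJ : CProj.IsKahler g J) (hD : CProj.degreeOfMobility g J = 2)
    (v : CProj.SmoothVectorField E M)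
    (hv : CProj.IsCProjective g J v) (hv' : ¬ CProj.IsAffine g v)
    (A : CProj.EndField E M) (hA : A ∈ CProj.cCompatible g J)
    (S : Set M) (hS : IsConnected S)
    (ρ : M → ℂ) (hρ : CProj.IsEigenvalueOn A S ρ)
    (hconst : ¬ ∃ c : ℂ, ∀ p ∈ S, ρ p = c) :
    ∀ p ∈ S, (ρ p).im = 0 := by
  have hd : 2 < Module.finrank ℝ E := by omega
  have : Nontrivial E := Module.nontrivial_of_finrank_pos (R := ℝ) (by omega)
  obtain ⟨b, d, hq⟩ := CProj.exists_quadratic hgJ hv hd hv' hD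
  obtain ⟨α, β, hAB⟩ := CProj.exists_combination hgJ hv hd hv' hD hA
  have hspec (p : M) (hp : p ∈ S) :
      ∃ w, (p, w) ∈ CProj.totalSpectrum (CProj.lieSolution v hgJ) ∧ ρ p = α + β * w := by
    have h1 := hρ.isEigenvalueAt p hp
    rw [hAB] at h1
    exact CProj.exists_of_isEigenvalueAt h1
  rcases CProj.real_or_root hgJ (CProj.lieSolution_mem hgJ hv hd) hq with hr | hr
  · intro p hp
    obtain ⟨w, hw, hw'⟩ := hspec p hp
    have : w.im = 0 := hr _ hw
    simp [hw', this]
  -- All values of `ρ` lie in the affine image of the root set of a quadratic polynomial, which is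
  -- finite and hence discrete; continuity on the connected set `S` makes `ρ` constant.
  · refine absurd ?_ hconst
    obtain ⟨p₀, hp₀⟩ := hS.nonempty
    set T : Set ℂ := (fun w ↦ (α : ℂ) + β * w) '' {z : ℂ | z ^ 2 + b * z + d = 0} with hT
    have hTf : T.Finite := (CProj.finite_quadratic_roots _ _).image _
    have hmaps : MapsTo ρ S T := fun p hp ↦ by
      obtain ⟨w, hw, hw'⟩ := hspec p hp
      exact ⟨w, hr _ hw, hw'.symm⟩
    exact ⟨ρ p₀, fun p hp ↦
      hS.isPreconnected.constant_of_mapsTo hTf.isDiscrete hρ.continuousOn hmaps hp hp₀⟩
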